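/- **Corollary 4.2 (far-field patterns for the unit ball).** Let $\Omega=\{x\in\mathbb R^3:|x|<1\}$, let $\rho,\kappa,\omega>0$, $\alpha\in\mathbb R$, $\beta>0$, and put $k=\omega\sqrt{\rho/\kappa}$. Let $u^i$ be an entire solution of $\Delta u^i+k^2u^i=0$ in $\mathbb R^3$. For $\delta>0$ and $\kappa_0>0$ put $\tilde\rho=\delta\rho$, $\tilde\kappa=\kappa_0(\alpha-\beta\mathrm i)$, $\tau=\tilde\kappa/\kappa$. Write $\partial_\nu u(x)=\hat x\cdot\nabla u(x)$, $\hat x=x/|x|$, and let $|_+$ and $|_-$ denote limits at $\partial\Omega$ from outside and inside. A function $u^s$ is radiating if $|x|(\partial_\nu u^s-\mathrm iku^s)\to0$ as $|x|\to\infty$, uniformly in all directions. All equations are understood classically ($C^2$ in the open regions, with $u$ and $\partial_\nu u$ having limits at every point of $\partial\Omega$). Consider the following problems, in each of which the total field minus $u^i$ is radiating. * Transmission problem: $\nabla\cdot(\rho^{-1}\nabla u_\delta)+\omega^2\kappa^{-1}u_\delta=0$ in $\mathbb R^3\setminus\overline\Omega$, $\nabla\cdot(\tilde\rho^{-1}\nabla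 u_\delta)+\omega^2\tilde\kappa^{-1}u_\delta=0$ in $\Omega$, and $u_\delta|_+=u_\delta|_-$, $\rho^{-1}\partial_\nu u_\delta|_+=\tilde\rho^{-1}\partial_\nu u_\delta|_-$ on $\partial\Omega$. * Obstacle problems, with $\Delta\psi+k^2\psi=0$ in $\mathbb R^3\setminus\overline\Omega$ for $\psi=v,t,w,u$, and boundary conditions taken from outside: * $v$: $\int_{\partial\Omega}\rho^{-1}\partial_\nu v\,ds+\frac{\omega^2}{\tilde\kappa}|\Omega|\,v=0$ at every point of $\partial\Omega$; * $t$: $t$ equals an unknown constant on $\partial\Omega$, and $\int_{\partial\Omega}\partial_\nu t\,ds=0$; * $w$ (sound-soft): $w=0$ on $\partial\Omega$; * $u$ (sound-hard): $\partial_\nu u=0$ on $\partial\Omega$. The far-field pattern of a total field with scattered part $u^s$ is the function $F$ on $\mathbb S^2$ with $u^s(x)=\frac{e^{\mathrm ik|x|}}{|x|}F(\hat x)+O(|x|^{-2})$ as $|x|\to\infty$, uniformly in $\hat x$. Let $F_\delta$ (depending on $\delta$ and $\kappa_0$), $F_v$ (depending on $\kappa_0$), $F_t,F_w,F_u$ be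 the far-field patterns of the solutions of these problems. Then they all belong to $L^2(\mathbb S^2)$, and the following convergences hold in $L^2(\mathbb S^2)$. 1. For each fixed $\kappa_0$: $F_\delta\to F_u$ as $\delta\to\infty$, and $\|F_\delta-F_u\|_{L^2(\mathbb S^2)}\le C\delta^{-1/2}$ for all sufficiently large $\delta$. 2. $F_\delta\to F_w$ as $\delta\to0$ and $|\tau|\to0$ (jointly; $\kappa_0\to0$), and $\|F_\delta-F_w\|_{L^2(\mathbb S^2)}\le C(\delta^{1/2}+|\tau|^{1/2})$ for all sufficiently small $\delta$ and $|\tau|$. 3. For each fixed $\kappa_0$: $F_\delta\to F_v$ as $\delta\to0$, and $\|F_\delta-F_v\|_{L^2(\mathbb S^2)}\le C\delta^{1/2}$ for all sufficiently small $\delta$. 4. $F_\delta\to F_t$ as $\delta\to0$ and $|\tau|\to\infty$ (jointly; $\kappa_0\to\infty$), and $\|F_\delta-F_t\|_{L^2(\mathbb S^2)}\le C(\delta^{1/2}+|\tau|^{-1/2})$ for all sufficiently small $\delta$ and sufficiently large $|\tau|$. Here $C$ may depend on $\rho,\kappa,\omega,\alpha,\beta$ and $u^i$, and in items 1 and 3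 on $\kappa_0$, but not on $\delta$, and in items 2 and 4 on neither $\delta$ nor $\kappa_0$. -/

import Mathlib

open MeasureTheory Filter Topology Set

noncomputable section

/-- Three-dimensional Euclidean space. -/
abbrev E3 : Type := EuclideanSpace ℝ (Fin 3)

/-- The unit sphere `S²`, the boundary of the unit ball. -/
abbrev S2 : Type := Metric.sphere (0 : E3) 1

/-- The surface measure of the unit sphere (total mass `4π`). -/
def surf : Measure S2 := (volume : Measure E3).toSphere

/-- The open unit ball, the inclusion `Ω`. -/
def innerDomain : Set E3 := {x | ‖x‖ < 1}

/-- The complement of the closed unit ball. -/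
def outerDomain : Set E3 := {x | 1 < ‖x‖}

/-- The volume `V(Ω)` of the inclusion. -/
def ballVolume : ℝ := (volume innerDomain).toReal

/-- The wavenumber `k = ω √(ρ/κ)` of the background medium. -/
def wavenumber (ρ κ ω : ℝ) : ℝ := ω * Real.sqrt (ρ / κ)

/-- `∂_ν u (x) = x̂ · ∇u(x)` with `x̂ = x / |x|`. -/
def normalDeriv (u : E3 → ℂ) (x : E3) : ℂ := fderiv ℝ u x (‖x‖⁻¹ • x)

/-- `u` has the boundary values `g` on the unit sphere, as limits from within `D`
(`D` is the inner or the outer domain). -/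
def HasBoundaryValue (D : Set E3) (u : E3 → ℂ) (g : S2 → ℂ) : Prop :=
  ∀ x : S2, Tendsto u (𝓝[D] (x : E3)) (𝓝 (g x))

/-- `u` is twice continuously differentiable in the open set `D` and solves there
`∇ · (ρ⁻¹ ∇ u) + ω² κ⁻¹ u = 0` with constant coefficients `ρ` and `κ`. -/
def SolvesHelmholtz (D : Set E3) (ρ : ℝ) (κ : ℂ) (ω : ℝ) (u : E3 → ℂ) : Prop :=
  ContDiffOn ℝ 2 u D ∧
    ∀ x ∈ D, (1 / (ρ : ℂ)) * Laplacian.laplacian u x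
      + (ω : ℂ) ^ 2 * (1 / κ) * u x = 0

/-- The incident field is an entire solution of `Δ uⁱ + k² uⁱ = 0`. -/
def IsIncident (k : ℝ) (ui : E3 → ℂ) : Prop :=
  ContDiff ℝ 2 ui ∧ ∀ x, Laplacian.laplacian ui x + (k : ℂ) ^ 2 * ui x = 0

/-- The Sommerfeld radiation condition in dimension three, uniformly in all directions. -/
def Sommerfeld (k : ℝ) (us : E3 → ℂ) : Prop :=
  Tendsto (fun x : E3 => (‖x‖ : ℂ) * (normalDeriv us x - Complex.I * k * us x))
    (Bornology.cobounded E3) (𝓝 0)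

/-- The scattering problem for the penetrable unit ball with density `ρ'` and complex bulk
modulus `κ'` in a background with density `ρ` and bulk modulus `κ`; `u` is the total field. -/
def SolvesTransmission (ρ κ ω ρ' : ℝ) (κ' : ℂ) (ui u : E3 → ℂ) : Prop :=
  SolvesHelmholtz outerDomain ρ κ ω u ∧
  SolvesHelmholtz innerDomain ρ' κ' ω u ∧
  (∃ g : S2 → ℂ, HasBoundaryValue outerDomain u g ∧ HasBoundaryValue innerDomain u g) ∧
  (∃ p q : S2 → ℂ,
    HasBoundaryValue outerDomain (normalDeriv u) p ∧
    HasBoundaryValue innerDomain (normalDeriv u) q ∧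
    ∀ x, (1 / (ρ : ℂ)) * p x = (1 / (ρ' : ℂ)) * q x) ∧
  Sommerfeld (wavenumber ρ κ ω) (fun x => u x - ui x)

/-- What the obstacle problems share: `u` solves the Helmholtz equation outside the closed unit
ball, its boundary values are `g` and those of its normal derivative are `p`, and the scattered
field `u - uⁱ` is radiating. The values of `u` in the closed ball play no role. -/
def SolvesExterior (k : ℝ) (ui u : E3 → ℂ) (g p : S2 → ℂ) : Prop :=
  (ContDiffOn ℝ 2 u outerDomain ∧
    ∀ x ∈ outerDomain, Laplacian.laplacian u x + (k : ℂ) ^ 2 * u x = 0) ∧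
  HasBoundaryValue outerDomain u g ∧
  HasBoundaryValue outerDomain (normalDeriv u) p ∧
  Sommerfeld k (fun x => u x - ui x)

/-- Obstacle with the nonlocal condition `∫_{∂Ω} ρ⁻¹ ∂_ν v ds + (ω²/κ') V(Ω) v = 0` on `∂Ω`. -/
def SolvesNonlocal (ρ κ ω : ℝ) (κ' : ℂ) (ui v : E3 → ℂ) : Prop :=
  ∃ g p : S2 → ℂ, SolvesExterior (wavenumber ρ κ ω) ui v g p ∧
    ∀ x, (∫ y, (1 / (ρ : ℂ)) * p y ∂surf) + (ω : ℂ) ^ 2 / κ' * (ballVolume : ℂ) * g x = 0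

/-- Obstacle with an unknown constant boundary value and zero flux `∫_{∂Ω} ∂_ν t ds = 0`. -/
def SolvesConstantValue (ρ κ ω : ℝ) (ui t : E3 → ℂ) : Prop :=
  ∃ g p : S2 → ℂ, SolvesExterior (wavenumber ρ κ ω) ui t g p ∧
    (∃ c : ℂ, ∀ x, g x = c) ∧ ∫ y, p y ∂surf = 0

/-- Sound-soft obstacle: `w = 0` on `∂Ω`. -/
def SolvesSoundSoft (ρ κ ω : ℝ) (ui w : E3 → ℂ) : Prop :=
  ∃ g p : S2 → ℂ, SolvesExterior (wavenumber ρ κ ω) ui w g p ∧ ∀ x, g x = 0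

/-- Sound-hard obstacle: `∂_ν u = 0` on `∂Ω`. -/
def SolvesSoundHard (ρ κ ω : ℝ) (ui u : E3 → ℂ) : Prop :=
  ∃ g p : S2 → ℂ, SolvesExterior (wavenumber ρ κ ω) ui u g p ∧ ∀ x, p x = 0

/-- `F` is the far-field pattern of the scattered field `us`:
`us(x) = (e^{ik|x|} / |x|) F(x̂) + O(|x|⁻²)`, uniformly for all directions `x̂`. -/
def IsFarFieldPattern (k : ℝ) (us : E3 → ℂ) (F : S2 → ℂ) : Prop :=
  ∃ C R : ℝ, ∀ r : ℝ, R ≤ r → ∀ θ : S2,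
    ‖us (r • (θ : E3)) - Complex.exp (Complex.I * k * r) / r * F θ‖ ≤ C / r ^ 2

/-- `F` is the far-field pattern of a scattering problem `P`, given as a predicate on total
fields, for the incident field `ui`. -/
def IsFarFieldOf (k : ℝ) (ui : E3 → ℂ) (P : (E3 → ℂ) → Prop) (F : S2 → ℂ) : Prop :=
  ∃ u : E3 → ℂ, P u ∧ IsFarFieldPattern k (fun x => u x - ui x) F

/-- The bulk modulus `κ₀ (α - β i)` of the absorbing inclusion. -/
def bulkModulus (α β κ₀ : ℝ) : ℂ := (κ₀ : ℂ) * ((α : ℂ) - (β : ℂ) * Complex.I)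

/-- The modulus `|τ|` of the bulk-modulus contrast `τ = κ₀ (α - β i) / κ`. -/
def absTau (κ α β κ₀ : ℝ) : ℝ := ‖bulkModulus α β κ₀ / (κ : ℂ)‖

/-- The distance in `L²(S²)`. -/
def l2Dist (F G : S2 → ℂ) : ENNReal := eLpNorm (fun θ => F θ - G θ) 2 surf

end

/-!
The far-field patterns are compared by an energy method. It needs neither an existence theory nor
expansions in spherical harmonics: every integral is taken over spheres or in polar coordinates, and
the identities below are differentiated with respect to the radius.

**Exterior.** Let `e` be the difference of two total fields for the same incident field, `g` and
`p` its Dirichlet and Neumann data on the unit sphere, `F` the difference of the far-field patterns,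
and `I = ∫ conj(g) p`. Conservation of the flux gives `Im I = k ‖F‖²` (`ExteriorField.im_pairing`).
The Rellich–Pohozaev identity makes the radial energy of `r e(r ·)` monotone; comparison with its
limit at infinity yields `Re I ≤ -‖g‖² / 2 + 2 k Im I` (`re_inner_le`,
`ExteriorField.re_pairing_le`). Hence it suffices to estimate `|I|`.

**Interior.** In the ball the equation is `Δu = δ z u` with `z = -ω² ρ / κ'` in the open lower half
plane, in a sector which depends only on `α / β`, and `|z| = k² / |τ|`. With `A` the Dirichlet
integral of `u` and `B = ∫ |u|²`, Green's identity and the transmission conditions give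
`A / δ + z B = I + J`, where `J` involves the data of the obstacle field. The sector and the two
facts on `I` imply `A / δ + |z| B + ‖g‖² / 2 ≤ N |J|` and `k ‖F‖² ≤ |J|` (`coercive`), with `N`
depending only on `α / β` and `k`.

**The four limits.** It remains to bound `J`; when the obstacle field is a constant `c` on the
sphere, `u - c` replaces `u` in `B`.
* Sound-soft: `J = ∫ conj(u) p_w` and `‖u‖² ≤ A + 4 B` on the sphere (`trace_le`), so that
  `|J|² ≤ C (δ + |τ|) |J|`.
* Constant value with zero flux, and nonlocal condition: the Neumann data of the obstacle field has
  mean zero up to a constant. Against functions of mean zero, boundary values are controlled by `A`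
  alone, by the Poincaré inequality (`InteriorField.norm_pairing_sq_le_of_mean_zero`). The remaining
  constant contributes `O(|z| |∫ (u - c)|)` in the first case. In the second case it is multiplied by
  the difference of the means of `u` over the sphere and over the ball, which `A` controls as well.
* Sound-hard: `J = ∫ conj(u_h) p` with `p = δ⁻¹ ∂_ν u`. Extending an exterior field into a boundary
  layer of width `δ^(-1/2)` by inversion, one bounds its pairing with `∂_ν u` by the energy of `u`
  (`norm_pairing_le_layer`). Applied to the obstacle field this bounds the energy, and applied to the
  radiating difference, whose local norms are bounded by `|I|`, it gives `|I| = O(δ⁻¹)`.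

In all cases `‖F‖²` is bounded by the square of the asserted rate.
-/


open scoped Pointwise InnerProductSpace ComplexConjugate

/-! ### Integration over spheres and rotations -/

instance isFiniteMeasure_surf : IsFiniteMeasure surf := by
  unfold surf; infer_instance

/-- Integral of `φ` over the sphere of radius `r`, with respect to the measure of the unit sphere. -/
noncomputable def sphInt {F : Type*} [NormedAddCommGroup F] [NormedSpace ℝ F] (φ : E3 → F) (r : ℝ) :
    F := ∫ θ : S2, φ (r • (θ : E3)) ∂surf

/-- The standard basis vectors of `E3`. -/
noncomputable def e3 (i : Fin 3) : E3 := EuclideanSpace.single i (1 : ℝ)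

section Sphere
variable {F : Type*} [NormedAddCommGroup F]

lemma norm_sphere (θ : S2) : ‖(θ : E3)‖ = 1 := by
  simp

lemma norm_smul_sphere {r : ℝ} (hr : 0 ≤ r) (θ : S2) : ‖r • (θ : E3)‖ = r := by
  rw [norm_smul, norm_sphere, mul_one, Real.norm_of_nonneg hr]

lemma integrable_sphere {f : S2 → F} (hf : Continuous f) : Integrable f surf := by
  have h := (hf.continuousOn (s := univ)).integrableOn_compact (μ := surf) isCompact_univ
  rwa [integrableOn_univ] at h

lemma continuous_restrict_sphere {φ : E3 → F} {D : Set E3} {r : ℝ} (hφ : ContinuousOn φ D)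
    (h : ∀ θ : S2, r • (θ : E3) ∈ D) : Continuous (fun θ : S2 => φ (r • (θ : E3))) := by
  rw [← continuousOn_univ]
  exact hφ.comp (f := fun θ : S2 => r • (θ : E3)) (by fun_prop) (fun θ _ => h θ)

lemma integrable_restrict_sphere {φ : E3 → F} {D : Set E3} {r : ℝ} (hφ : ContinuousOn φ D)
    (h : ∀ θ : S2, r • (θ : E3) ∈ D) : Integrable (fun θ : S2 => φ (r • (θ : E3))) surf :=
  integrable_sphere (continuous_restrict_sphere hφ h)

variable [NormedSpace ℝ F]

lemma continuousOn_sphere_integral {s : Set ℝ} {f : ℝ → S2 → F}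
    (hf : ContinuousOn (Function.uncurry f) (s ×ˢ univ)) :
    ContinuousOn (fun r => ∫ θ, f r θ ∂surf) s :=
  continuousOn_integral_of_compact_support (k := univ) isCompact_univ hf
    (fun _ _ _ h => absurd (mem_univ _) h)

lemma continuousOn_sphInt {φ : E3 → F} {D : Set E3} {s : Set ℝ} (hφ : ContinuousOn φ D)
    (h : ∀ r ∈ s, ∀ θ : S2, r • (θ : E3) ∈ D) : ContinuousOn (sphInt φ) s := by
  refine continuousOn_sphere_integral ?_
  refine hφ.comp (f := fun p : ℝ × S2 => p.1 • (p.2 : E3)) ?_ (fun p hp => h p.1 hp.1 p.2)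
  fun_prop

lemma hasDerivAt_sphere_integral {I : Set ℝ} (hI : IsOpen I) {t₀ : ℝ} (ht : t₀ ∈ I)
    {f f' : ℝ → S2 → F} (hf : ∀ t ∈ I, ∀ θ, HasDerivAt (fun t => f t θ) (f' t θ) t)
    (hfc : ∀ t ∈ I, Continuous (f t)) (hc : ContinuousOn (Function.uncurry f') (I ×ˢ univ)) :
    HasDerivAt (fun t => ∫ θ, f t θ ∂surf) (∫ θ, f' t₀ θ ∂surf) t₀ := by
  obtain ⟨ε, hε, hεI⟩ := Metric.nhds_basis_closedBall.mem_iff.1 (hI.mem_nhds ht)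
  have hK : IsCompact (Metric.closedBall t₀ ε ×ˢ (univ : Set S2)) :=
    (isCompact_closedBall _ _).prod isCompact_univ
  obtain ⟨C, hC⟩ := hK.exists_bound_of_continuousOn (hc.mono (prod_mono hεI subset_rfl))
  have hcs : ∀ t ∈ I, Continuous (f' t) := by
    intro t ht'
    rw [← continuousOn_univ]
    exact hc.comp (f := fun θ : S2 => (t, θ)) (by fun_prop) (fun θ _ => ⟨ht', mem_univ _⟩)
  refine (hasDerivAt_integral_of_dominated_loc_of_deriv_le (bound := fun _ => C)
    (Metric.closedBall_mem_nhds t₀ hε) ?_ (integrable_sphere (hfc _ ht))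
    (integrable_sphere (hcs _ ht)).aestronglyMeasurable ?_ (integrable_const _) ?_).2
  · filter_upwards [hI.mem_nhds ht] with t ht'
    exact (integrable_sphere (hfc _ ht')).aestronglyMeasurable
  · exact Eventually.of_forall fun θ t ht' => hC (t, θ) ⟨ht', mem_univ _⟩
  · exact Eventually.of_forall fun θ t ht' => hf t (hεI ht') θ

/-- Differentiation of a spherical integral with respect to the radius. -/
lemma hasDerivAt_sphInt {φ : E3 → F} {D : Set E3} (hD : IsOpen D) (hφ : ContDiffOn ℝ 1 φ D)
    {I : Set ℝ} (hI : IsOpen I) (h : ∀ r ∈ I, ∀ θ : S2, r • (θ : E3) ∈ D) {r : ℝ} (hr : r ∈ I) :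
    HasDerivAt (sphInt φ) (∫ θ : S2, fderiv ℝ φ (r • (θ : E3)) θ ∂surf) r := by
  refine hasDerivAt_sphere_integral hI hr (f := fun r θ => φ (r • (θ : E3)))
    (f' := fun r θ => fderiv ℝ φ (r • (θ : E3)) θ) ?_ ?_ ?_
  · intro t ht θ
    have h1 : HasFDerivAt φ (fderiv ℝ φ (t • (θ : E3))) (t • (θ : E3)) :=
      ((hφ.differentiableOn one_ne_zero).differentiableAt (hD.mem_nhds (h t ht θ))).hasFDerivAt
    have h2 : HasDerivAt (fun t : ℝ => t • (θ : E3)) (θ : E3) t := by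
      simpa using (hasDerivAt_id t).smul_const (θ : E3)
    exact h1.comp_hasDerivAt t h2
  · intro t ht
    exact continuous_restrict_sphere hφ.continuousOn (h t ht)
  · have h1 : ContinuousOn (fun p : ℝ × S2 => fderiv ℝ φ (p.1 • (p.2 : E3))) (I ×ˢ univ) :=
      (hφ.continuousOn_fderiv_of_isOpen hD le_rfl).comp (f := fun p : ℝ × S2 => p.1 • (p.2 : E3))
        (by fun_prop) (fun p hp => h p.1 hp.1 p.2)
    exact h1.clm_apply (by fun_prop)

end Sphere

section Rotation

/-- The unit sphere is invariant under linear isometries. -/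
noncomputable def sphereMap (L : E3 ≃ₗᵢ[ℝ] E3) (θ : S2) : S2 := ⟨L θ, by simp⟩

lemma continuous_sphereMap (L : E3 ≃ₗᵢ[ℝ] E3) : Continuous (sphereMap L) := by
  unfold sphereMap
  exact (L.continuous.comp continuous_subtype_val).subtype_mk _

lemma measurePreserving_sphereMap (L : E3 ≃ₗᵢ[ℝ] E3) : MeasurePreserving (sphereMap L) surf surf := by
  refine ⟨(continuous_sphereMap L).measurable, ?_⟩
  ext s hs
  rw [Measure.map_apply (continuous_sphereMap L).measurable hs]
  unfold surf
  rw [Measure.toSphere_apply' _ hs,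
    Measure.toSphere_apply' _ ((continuous_sphereMap L).measurable hs)]
  congr 1
  have : (Ioo (0 : ℝ) 1 • ((fun x : S2 => (x : E3)) '' (sphereMap L ⁻¹' s)) : Set E3)
      = L ⁻¹' (Ioo (0 : ℝ) 1 • ((fun x : S2 => (x : E3)) '' s)) := by
    ext x
    simp only [Set.mem_smul, mem_image, mem_preimage]
    constructor
    · rintro ⟨t, ht, y, ⟨θ, hθ, rfl⟩, rfl⟩
      exact ⟨t, ht, _, ⟨_, hθ, rfl⟩, by simp [sphereMap]⟩
    · rintro ⟨t, ht, y, ⟨θ, hθ, rfl⟩, h⟩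
      refine ⟨t, ht, L.symm θ, ⟨⟨L.symm θ, by simp⟩, ?_, rfl⟩, ?_⟩
      · simpa [sphereMap] using hθ
      · apply L.injective
        simpa using h
  rw [this]
  exact L.measurePreserving.measure_preimage_equiv (f := L.toHomeomorph.toMeasurableEquiv) _

lemma integral_sphereMap {F : Type*} [NormedAddCommGroup F] [NormedSpace ℝ F]
    (L : E3 ≃ₗᵢ[ℝ] E3) (f : S2 → F) : ∫ θ, f (sphereMap L θ) ∂surf = ∫ θ, f θ ∂surf := by
  refine (measurePreserving_sphereMap L).integral_comp ?_ f
  refine MeasurableEquiv.measurableEmbedding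
    (⟨⟨sphereMap L, sphereMap L.symm, ?_, ?_⟩, (continuous_sphereMap L).measurable,
      (continuous_sphereMap L.symm).measurable⟩ : S2 ≃ᵐ S2)
  · intro θ; ext1; simp [sphereMap]
  · intro θ; ext1; simp [sphereMap]

/-- The rotation by the angle `t` in the plane of the `i`-th and the `j`-th axis. -/
noncomputable def planeRotLin (i j : Fin 3) (t : ℝ) : E3 →ₗ[ℝ] E3 where
  toFun x := x + ((Real.cos t - 1) • (x i • e3 i + x j • e3 j)
    + Real.sin t • (x i • e3 j - x j • e3 i))
  map_add' x y := by simp only [PiLp.add_apply]; module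
  map_smul' c x := by simp only [PiLp.smul_apply, smul_eq_mul, RingHom.id_apply]; module

lemma norm_planeRotLin {i j : Fin 3} (hij : i ≠ j) (t : ℝ) (x : E3) :
    ‖planeRotLin i j t x‖ = ‖x‖ := by
  have h : ‖planeRotLin i j t x‖ ^ 2 = ‖x‖ ^ 2 := by
    rw [EuclideanSpace.norm_sq_eq, EuclideanSpace.norm_sq_eq, Fin.sum_univ_three,
      Fin.sum_univ_three]
    have hs := Real.sin_sq_add_cos_sq t
    fin_cases i <;> fin_cases j <;> simp [planeRotLin, e3] at hij ⊢ <;>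
      grind
  exact (sq_eq_sq₀ (norm_nonneg _) (norm_nonneg _)).1 h

/-- `planeRotLin` as a linear isometry. -/
noncomputable def planeRot {i j : Fin 3} (hij : i ≠ j) (t : ℝ) : E3 ≃ₗᵢ[ℝ] E3 :=
  LinearIsometry.toLinearIsometryEquiv ⟨planeRotLin i j t, norm_planeRotLin hij t⟩ rfl

lemma hasDerivAt_planeRot {i j : Fin 3} (hij : i ≠ j) (x : E3) (t : ℝ) :
    HasDerivAt (fun t => planeRot hij t x)
      ((-Real.sin t) • (x i • e3 i + x j • e3 j) + Real.cos t • (x i • e3 j - x j • e3 i)) t := by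
  have h1 := ((Real.hasDerivAt_cos t).sub_const 1).smul_const (x i • e3 i + x j • e3 j)
  have h2 := (Real.hasDerivAt_sin t).smul_const (x i • e3 j - x j • e3 i)
  exact (h1.add h2).const_add x

/-- The integral over the sphere of the derivative along a rotation vector field vanishes. -/
lemma integral_rot_deriv {F : Type*} [NormedAddCommGroup F] [NormedSpace ℝ F]
    {φ : E3 → F} {D : Set E3} (hD : IsOpen D) (hφ : ContDiffOn ℝ 1 φ D)
    (h : ∀ θ : S2, (θ : E3) ∈ D) (i j : Fin 3) :
    ∫ θ : S2, fderiv ℝ φ θ ((θ : E3) i • e3 j - (θ : E3) j • e3 i) ∂surf = 0 := by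
  by_cases hij : i = j
  · subst hij; simp
  let g : ℝ → S2 → E3 := fun t θ => (-Real.sin t) • ((θ : E3) i • e3 i + (θ : E3) j • e3 j)
    + Real.cos t • ((θ : E3) i • e3 j - (θ : E3) j • e3 i)
  have hmem : ∀ t (θ : S2), planeRot hij t θ ∈ D := fun t θ => h (sphereMap (planeRot hij t) θ)
  have hcont : Continuous (fun p : ℝ × S2 => planeRot hij p.1 (p.2 : E3)) := by
    change Continuous (fun p : ℝ × S2 => (p.2 : E3) + ((Real.cos p.1 - 1) •
      ((p.2 : E3) i • e3 i + (p.2 : E3) j • e3 j)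
      + Real.sin p.1 • ((p.2 : E3) i • e3 j - (p.2 : E3) j • e3 i)))
    fun_prop
  have key := hasDerivAt_sphere_integral isOpen_univ (mem_univ (0 : ℝ))
    (f := fun t θ => φ (planeRot hij t θ)) (f' := fun t θ => fderiv ℝ φ (planeRot hij t θ) (g t θ))
    ?_ ?_ ?_
  · have hconst : (fun t => ∫ θ : S2, φ (planeRot hij t θ) ∂surf)
        = fun _ => ∫ θ : S2, φ (θ : E3) ∂surf := by
      funext t
      exact integral_sphereMap (planeRot hij t) (fun θ : S2 => φ θ)
    rw [hconst] at key
    have h0 := key.unique (hasDerivAt_const _ _)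
    have hid : ∀ θ : S2, planeRot hij 0 (θ : E3) = θ := by
      intro θ
      change (θ : E3) + ((Real.cos 0 - 1) • ((θ : E3) i • e3 i + (θ : E3) j • e3 j)
        + Real.sin 0 • ((θ : E3) i • e3 j - (θ : E3) j • e3 i)) = θ
      simp
    simpa [hid, g] using h0
  · intro t _ θ
    have h1 : HasFDerivAt φ (fderiv ℝ φ (planeRot hij t θ)) (planeRot hij t (θ : E3)) :=
      ((hφ.differentiableOn one_ne_zero).differentiableAt (hD.mem_nhds (hmem t θ))).hasFDerivAt
    exact h1.comp_hasDerivAt t (hasDerivAt_planeRot hij θ t)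
  · intro t _
    rw [← continuousOn_univ]
    exact hφ.continuousOn.comp (by fun_prop) (fun θ _ => hmem t θ)
  · have h1 : ContinuousOn (fun p : ℝ × S2 => fderiv ℝ φ (planeRot hij p.1 (p.2 : E3)))
        (univ ×ˢ univ) :=
      (hφ.continuousOn_fderiv_of_isOpen hD le_rfl).comp hcont.continuousOn
        (fun p hp => hmem p.1 p.2)
    refine h1.clm_apply ?_
    simp only [g]
    fun_prop

end Rotation

/-! ### Divergence theorem and Green's identity on spheres -/

section Divergence

lemma e3_apply (i j : Fin 3) : e3 i j = if j = i then 1 else 0 := by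
  simp [e3]

lemma sum_smul_e3 (x : E3) : ∑ i, x i • e3 i = x := by
  ext j
  simp [e3_apply]

lemma clm_apply_eq_sum {F : Type*} [NormedAddCommGroup F] [NormedSpace ℝ F] (A : E3 →L[ℝ] F)
    (x : E3) : A x = ∑ i, x i • A (e3 i) := by
  conv_lhs => rw [← sum_smul_e3 x]
  simp

lemma sum_sq_sphere (θ : S2) : ∑ i, (θ : E3) i ^ 2 = 1 := by
  have h := EuclideanSpace.norm_sq_eq (θ : E3)
  rw [norm_sphere] at h
  simpa using h.symm

lemma rot_sum_identity {F : Type*} [NormedAddCommGroup F] [NormedSpace ℝ F] (A : E3 →L[ℝ] F)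
    (v : F) (r : ℝ) (θ : S2) (i : Fin 3) :
    ∑ j, (((θ : E3) j • e3 i - (θ : E3) i • e3 j) j • v
      + (θ : E3) j • r • A ((θ : E3) j • e3 i - (θ : E3) i • e3 j))
      = r • A (e3 i) - (2 : ℝ) • (θ : E3) i • v - r • (θ : E3) i • A θ := by
  have h1 : ∀ j, (((θ : E3) j • e3 i - (θ : E3) i • e3 j) j) =
      (if j = i then (θ : E3) i else 0) - (θ : E3) i := by
    intro j
    by_cases h : j = i
    · subst h; simp
    · simp [e3_apply, h]
  have h2 : ∀ j, (θ : E3) j • r • A ((θ : E3) j • e3 i - (θ : E3) i • e3 j)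
      = ((θ : E3) j ^ 2) • r • A (e3 i) - (r * (θ : E3) i) • ((θ : E3) j • A (e3 j)) := by
    intro j
    simp only [map_sub, map_smul]
    module
  simp only [h1, h2, Finset.sum_add_distrib, Finset.sum_sub_distrib, sub_smul, ← Finset.sum_smul,
    ← Finset.smul_sum, ← clm_apply_eq_sum, sum_sq_sphere]
  simp
  module

/-- **Divergence theorem on spherical shells**, in differential form: the derivative of the flux
through the sphere of radius `r` is the integral of the divergence over that sphere. -/
lemma hasDerivAt_flux {F : Type*} [NormedAddCommGroup F] [NormedSpace ℝ F]
    {V : Fin 3 → E3 → F} {D : Set E3} (hD : IsOpen D) (hV : ∀ i, ContDiffOn ℝ 1 (V i) D)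
    {I : Set ℝ} (hI : IsOpen I) (h : ∀ r ∈ I, ∀ θ : S2, r • (θ : E3) ∈ D) {r : ℝ} (hr : r ∈ I) :
    HasDerivAt (fun r => r ^ 2 • ∫ θ : S2, ∑ i, (θ : E3) i • V i (r • (θ : E3)) ∂surf)
      (r ^ 2 • ∫ θ : S2, ∑ i, fderiv ℝ (V i) (r • (θ : E3)) (e3 i) ∂surf) r := by
  have hdiff : ∀ t ∈ I, ∀ (θ : S2) i,
      HasFDerivAt (V i) (fderiv ℝ (V i) (t • (θ : E3))) (t • (θ : E3)) := fun t ht θ i =>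
    (((hV i).differentiableOn one_ne_zero).differentiableAt (hD.mem_nhds (h t ht θ))).hasFDerivAt
  have hcf : ∀ i, ContinuousOn (fun p : ℝ × S2 => fderiv ℝ (V i) (p.1 • (p.2 : E3)))
      (I ×ˢ univ) := fun i =>
    ((hV i).continuousOn_fderiv_of_isOpen hD le_rfl).comp
      (f := fun p : ℝ × S2 => p.1 • (p.2 : E3)) (by fun_prop) (fun p hp => h p.1 hp.1 p.2)
  have hcfr : ∀ i, Continuous (fun θ : S2 => fderiv ℝ (V i) (r • (θ : E3))) := fun i =>
    continuous_restrict_sphere ((hV i).continuousOn_fderiv_of_isOpen hD le_rfl) (h r hr)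
  have hcr : ∀ i, Continuous (fun θ : S2 => V i (r • (θ : E3))) := fun i =>
    continuous_restrict_sphere (hV i).continuousOn (h r hr)
  have key : HasDerivAt (fun r => ∫ θ : S2, ∑ i, (θ : E3) i • V i (r • (θ : E3)) ∂surf)
      (∫ θ : S2, ∑ i, (θ : E3) i • fderiv ℝ (V i) (r • (θ : E3)) θ ∂surf) r := by
    refine hasDerivAt_sphere_integral hI hr
      (f := fun r θ => ∑ i, (θ : E3) i • V i (r • (θ : E3)))
      (f' := fun r θ => ∑ i, (θ : E3) i • fderiv ℝ (V i) (r • (θ : E3)) θ) ?_ ?_ ?_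
    · intro t ht θ
      refine HasDerivAt.fun_sum fun i _ => HasDerivAt.const_smul _ ?_
      have h2 : HasDerivAt (fun t : ℝ => t • (θ : E3)) (θ : E3) t := by
        simpa using (hasDerivAt_id t).smul_const (θ : E3)
      exact (hdiff t ht θ i).comp_hasDerivAt t h2
    · intro t ht
      exact continuous_finsetSum _ fun i _ => Continuous.smul (by fun_prop)
        (continuous_restrict_sphere (hV i).continuousOn (h t ht))
    · refine continuousOn_finsetSum _ fun i _ => ContinuousOn.smul (by fun_prop) ?_
      exact (hcf i).clm_apply (by fun_prop)
  have hrot : ∀ i j, ∫ θ : S2, (((θ : E3) j • e3 i - (θ : E3) i • e3 j) j • V i (r • (θ : E3))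
      + (θ : E3) j • r • fderiv ℝ (V i) (r • (θ : E3))
          ((θ : E3) j • e3 i - (θ : E3) i • e3 j)) ∂surf = 0 := by
    intro i j
    have hD' : IsOpen ((fun x : E3 => r • x) ⁻¹' D) := hD.preimage (by fun_prop)
    have hφ : ContDiffOn ℝ 1 (fun x : E3 => x j • V i (r • x)) ((fun x : E3 => r • x) ⁻¹' D) := by
      refine ContDiffOn.smul (by fun_prop) ?_
      exact (hV i).comp (f := fun x : E3 => r • x) (by fun_prop) (fun x hx => hx)
    have h0 := integral_rot_deriv hD' hφ (fun θ => h r hr θ) j i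
    rw [← h0]
    congr 1
    funext θ
    have hsm : HasFDerivAt (fun x : E3 => r • x) (r • ContinuousLinearMap.id ℝ E3) (θ : E3) :=
      (hasFDerivAt_id (θ : E3)).const_smul r
    have hc := (hdiff r hr θ i).comp (θ : E3) hsm
    have hj : HasFDerivAt (fun x : E3 => x j) (EuclideanSpace.proj j : E3 →L[ℝ] ℝ) (θ : E3) :=
      (EuclideanSpace.proj j : E3 →L[ℝ] ℝ).hasFDerivAt
    have hfull := hj.smul hc
    have hfd : fderiv ℝ (fun x : E3 => x j • V i (r • x)) (θ : E3) = _ := hfull.fderiv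
    rw [hfd]
    simp [add_comm]
  have hdivI : r • ∫ θ : S2, ∑ i, fderiv ℝ (V i) (r • (θ : E3)) (e3 i) ∂surf
      = (2 : ℝ) • (∫ θ : S2, ∑ i, (θ : E3) i • V i (r • (θ : E3)) ∂surf)
        + r • ∫ θ : S2, ∑ i, (θ : E3) i • fderiv ℝ (V i) (r • (θ : E3)) θ ∂surf := by
    have hcont : ∀ i j, Continuous fun θ : S2 =>
        (((θ : E3) j • e3 i - (θ : E3) i • e3 j) j • V i (r • (θ : E3))
          + (θ : E3) j • r • fderiv ℝ (V i) (r • (θ : E3))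
            ((θ : E3) j • e3 i - (θ : E3) i • e3 j)) := fun i j =>
      (Continuous.smul (by fun_prop) (hcr i)).add
        (Continuous.smul (by fun_prop) (((hcfr i).clm_apply (by fun_prop)).const_smul r))
    have hz : ∫ θ : S2, ∑ i, ∑ j, (((θ : E3) j • e3 i - (θ : E3) i • e3 j) j • V i (r • (θ : E3))
      + (θ : E3) j • r • fderiv ℝ (V i) (r • (θ : E3))
          ((θ : E3) j • e3 i - (θ : E3) i • e3 j)) ∂surf = 0 := by
      rw [integral_finsetSum]
      · refine Finset.sum_eq_zero fun i _ => ?_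
        rw [integral_finsetSum]
        · exact Finset.sum_eq_zero fun j _ => hrot i j
        · exact fun j _ => integrable_sphere (hcont i j)
      · exact fun i _ => integrable_sphere (continuous_finsetSum _ fun j _ => hcont i j)
    simp only [rot_sum_identity, Finset.sum_sub_distrib, ← Finset.smul_sum] at hz
    have i1 : Integrable (fun θ : S2 => r • ∑ i, fderiv ℝ (V i) (r • (θ : E3)) (e3 i)) surf :=
      integrable_sphere (by fun_prop)
    have i2 : Integrable (fun θ : S2 => (2 : ℝ) • ∑ i, (θ : E3) i • V i (r • (θ : E3))) surf :=
      integrable_sphere ((continuous_finsetSum _ fun i _ =>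
        Continuous.smul (by fun_prop) (hcr i)).const_smul _)
    have i3 : Integrable
        (fun θ : S2 => r • ∑ i, (θ : E3) i • fderiv ℝ (V i) (r • (θ : E3)) θ) surf :=
      integrable_sphere (by fun_prop)
    rw [integral_sub (by exact i1.sub i2) i3, integral_sub i1 i2, integral_smul, integral_smul,
      integral_smul] at hz
    rw [sub_sub, sub_eq_zero] at hz
    exact hz
  have hfin := ((hasDerivAt_pow 2 r).smul key)
  refine hfin.congr_deriv ?_
  have e1 : r ^ 2 • ∫ θ : S2, ∑ i, fderiv ℝ (V i) (r • (θ : E3)) (e3 i) ∂surf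
      = r • (r • ∫ θ : S2, ∑ i, fderiv ℝ (V i) (r • (θ : E3)) (e3 i) ∂surf) := by
    rw [smul_smul, pow_two]
  rw [e1, hdivI]
  simp only [Nat.cast_ofNat, Nat.add_one_sub_one, pow_one]
  module

end Divergence

section Identities

/-- The partial derivative `∂_i u`. -/
noncomputable def pd (i : Fin 3) (u : E3 → ℂ) (x : E3) : ℂ := fderiv ℝ u x (e3 i)

/-- `|∇u|²`, the sum of the squared moduli of the partial derivatives. -/
noncomputable def gradSq (u : E3 → ℂ) (x : E3) : ℝ := ∑ i, ‖pd i u x‖ ^ 2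

variable {u v : E3 → ℂ} {D : Set E3}

lemma contDiffOn_pd (hD : IsOpen D) (hu : ContDiffOn ℝ 2 u D) (i : Fin 3) :
    ContDiffOn ℝ 1 (pd i u) D := by
  have h := hu.fderiv_of_isOpen (m := 1) hD (by norm_num)
  exact h.clm_apply contDiffOn_const

lemma continuousOn_pd (hD : IsOpen D) (hu : ContDiffOn ℝ 1 u D) (i : Fin 3) :
    ContinuousOn (pd i u) D :=
  (hu.continuousOn_fderiv_of_isOpen hD le_rfl).clm_apply continuousOn_const

lemma continuousOn_gradSq (hD : IsOpen D) (hu : ContDiffOn ℝ 1 u D) :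
    ContinuousOn (gradSq u) D := by
  have := fun i => continuousOn_pd hD hu i
  unfold gradSq
  fun_prop

lemma gradSq_nonneg (u : E3 → ℂ) (x : E3) : 0 ≤ gradSq u x :=
  Finset.sum_nonneg fun _ _ => by positivity

lemma laplacian_eq_sum_pd (hD : IsOpen D) (hu : ContDiffOn ℝ 2 u D) {x : E3} (hx : x ∈ D) :
    Laplacian.laplacian u x = ∑ i, fderiv ℝ (pd i u) x (e3 i) := by
  have hf : DifferentiableAt ℝ (fderiv ℝ u) x :=
    ((hu.fderiv_of_isOpen (m := 1) hD (by norm_num)).differentiableOn one_ne_zero).differentiableAt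
      (hD.mem_nhds hx)
  rw [InnerProductSpace.laplacian_eq_iteratedFDeriv_orthonormalBasis u
    (EuclideanSpace.basisFun (Fin 3) ℝ)]
  refine Finset.sum_congr rfl fun i _ => ?_
  rw [iteratedFDeriv_two_apply]
  have : pd i u = fun y => fderiv ℝ u y (e3 i) := rfl
  rw [this, fderiv_clm_apply hf (differentiableAt_const _)]
  simp [e3, EuclideanSpace.basisFun_apply]

lemma pd_comm (hD : IsOpen D) (hu : ContDiffOn ℝ 2 u D) {x : E3} (hx : x ∈ D) (i j : Fin 3) :
    fderiv ℝ (pd i u) x (e3 j) = fderiv ℝ (pd j u) x (e3 i) := by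
  have hf : DifferentiableAt ℝ (fderiv ℝ u) x :=
    ((hu.fderiv_of_isOpen (m := 1) hD (by norm_num)).differentiableOn one_ne_zero).differentiableAt
      (hD.mem_nhds hx)
  have hs := ((hu x hx).contDiffAt (hD.mem_nhds hx)).isSymmSndFDerivAt (by simp)
  have e : ∀ i, pd i u = fun y => fderiv ℝ u y (e3 i) := fun _ => rfl
  rw [e, e, fderiv_clm_apply hf (differentiableAt_const _),
    fderiv_clm_apply hf (differentiableAt_const _)]
  simpa using hs (e3 j) (e3 i)

lemma fderiv_radial (u : E3 → ℂ) (x : E3) (w : E3) :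
    fderiv ℝ u x w = ∑ i, (w i : ℂ) * pd i u x := by
  rw [clm_apply_eq_sum]
  simp [pd]

lemma norm_fderiv_sq_le (u : E3 → ℂ) (x w : E3) :
    ‖fderiv ℝ u x w‖ ^ 2 ≤ ‖w‖ ^ 2 * gradSq u x := by
  rw [fderiv_radial]
  have h1 : ‖∑ i, (w i : ℂ) * pd i u x‖ ≤ ∑ i, |w i| * ‖pd i u x‖ := by
    refine (norm_sum_le _ _).trans (le_of_eq ?_)
    simp
  have h2 := Finset.sum_mul_sq_le_sq_mul_sq Finset.univ (fun i => |w i|) (fun i => ‖pd i u x‖)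
  have h3 : ∑ i, |w i| ^ 2 = ‖w‖ ^ 2 := by
    rw [EuclideanSpace.norm_sq_eq]; simp
  rw [h3] at h2
  calc _ ≤ (∑ i, |w i| * ‖pd i u x‖) ^ 2 := by gcongr
    _ ≤ _ := h2

/-- The modulus of a radial derivative is at most that of the gradient. -/
lemma norm_fderiv_sphere_sq_le (u : E3 → ℂ) (x : E3) (θ : S2) :
    ‖fderiv ℝ u x θ‖ ^ 2 ≤ gradSq u x := by
  simpa [norm_sphere] using norm_fderiv_sq_le u x θ

/-- Green's first identity on spherical shells, in differential form. -/
lemma hasDerivAt_green (hD : IsOpen D) (hv : ContDiffOn ℝ 1 v D) (hu : ContDiffOn ℝ 2 u D)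
    {I : Set ℝ} (hI : IsOpen I) (h : ∀ r ∈ I, ∀ θ : S2, r • (θ : E3) ∈ D) {r : ℝ} (hr : r ∈ I) :
    HasDerivAt (fun r : ℝ => (r : ℂ) ^ 2 *
        ∫ θ : S2, conj (v (r • (θ : E3))) * fderiv ℝ u (r • (θ : E3)) θ ∂surf)
      ((r : ℂ) ^ 2 * ∫ θ : S2, ((∑ i, conj (pd i v (r • (θ : E3))) * pd i u (r • (θ : E3)))
        + conj (v (r • (θ : E3))) * Laplacian.laplacian u (r • (θ : E3))) ∂surf) r := by
  have hV : ∀ i, ContDiffOn ℝ 1 (fun x => conj (v x) * pd i u x) D := by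
    intro i
    refine ContDiffOn.mul ?_ (contDiffOn_pd hD hu i)
    exact Complex.conjCLE.contDiff.comp_contDiffOn hv
  have hdv : ∀ x ∈ D, HasFDerivAt v (fderiv ℝ v x) x := fun x hx =>
    ((hv.differentiableOn one_ne_zero).differentiableAt (hD.mem_nhds hx)).hasFDerivAt
  have hdu : ∀ i, ∀ x ∈ D, HasFDerivAt (pd i u) (fderiv ℝ (pd i u) x) x := fun i x hx =>
    (((contDiffOn_pd hD hu i).differentiableOn one_ne_zero).differentiableAt
      (hD.mem_nhds hx)).hasFDerivAt
  have key := hasDerivAt_flux hD hV hI h hr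
  refine (key.congr_deriv ?_).congr_of_eventuallyEq ?_
  · simp only [Complex.real_smul, Complex.ofReal_pow]
    congr 2
    funext θ
    rw [laplacian_eq_sum_pd hD hu (h r hr θ), Finset.mul_sum, ← Finset.sum_add_distrib]
    refine Finset.sum_congr rfl fun i _ => ?_
    have hc : HasFDerivAt (fun x => conj (v x))
        ((Complex.conjCLE : ℂ →L[ℝ] ℂ) ∘L fderiv ℝ v (r • (θ : E3))) (r • (θ : E3)) :=
      Complex.conjCLE.hasFDerivAt.comp _ (hdv _ (h r hr θ))
    have hm := (hc.mul (hdu i _ (h r hr θ))).fderiv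
    have hm' : fderiv ℝ (fun x => conj (v x) * pd i u x) (r • (θ : E3)) = _ := hm
    rw [hm']
    simp [pd]
    ring
  · refine Eventually.of_forall fun t => ?_
    simp only [Complex.real_smul, Complex.ofReal_pow]
    congr 2
    funext θ
    rw [fderiv_radial, Finset.mul_sum]
    refine Finset.sum_congr rfl fun i _ => ?_
    ring

end Identities

/-! ### The Rellich–Pohozaev identity -/

section Pohozaev
variable {u : E3 → ℂ} {D : Set E3}

/-- The vector field of the Rellich–Pohozaev identity with multiplier `x · ∇u`. -/
noncomputable def pohozaevField (k : ℝ) (u : E3 → ℂ) (i : Fin 3) (x : E3) : ℝ :=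
  2 * ⟪fderiv ℝ u x x, pd i u x⟫_ℝ
    + (k ^ 2 * ⟪u x, u x⟫_ℝ - ∑ j, ⟪pd j u x, pd j u x⟫_ℝ) * x i

lemma contDiffOn_pohozaevField (k : ℝ) (hD : IsOpen D) (hu : ContDiffOn ℝ 2 u D) (i : Fin 3) :
    ContDiffOn ℝ 1 (pohozaevField k u i) D := by
  have h1 : ContDiffOn ℝ 1 u D := hu.of_le (by norm_num)
  have h2 := fun i => contDiffOn_pd hD hu i
  have h3 : ContDiffOn ℝ 1 (fun x => fderiv ℝ u x x) D :=
    (hu.fderiv_of_isOpen (m := 1) hD (by norm_num)).clm_apply contDiffOn_id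
  unfold pohozaevField
  refine ContDiffOn.add (contDiffOn_const.mul (h3.inner ℝ (h2 i))) (ContDiffOn.mul ?_ (by fun_prop))
  exact (contDiffOn_const.mul (h1.inner ℝ h1)).sub
    (ContDiffOn.sum fun j _ => (h2 j).inner ℝ (h2 j))

lemma div_pohozaevField (k : ℝ) (hD : IsOpen D) (hu : ContDiffOn ℝ 2 u D) {x : E3} (hx : x ∈ D)
    (hΔ : Laplacian.laplacian u x = -(k : ℂ) ^ 2 * u x) :
    ∑ i, fderiv ℝ (pohozaevField k u i) x (e3 i) = 3 * k ^ 2 * ‖u x‖ ^ 2 - gradSq u x := by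
  have hdu : DifferentiableAt ℝ u x :=
    (hu.differentiableOn two_ne_zero).differentiableAt (hD.mem_nhds hx)
  have hdp : ∀ i, DifferentiableAt ℝ (pd i u) x := fun i =>
    ((contDiffOn_pd hD hu i).differentiableOn one_ne_zero).differentiableAt (hD.mem_nhds hx)
  have hsum : ∀ y, fderiv ℝ u y y = ∑ j, y j • pd j u y := by
    intro y; rw [fderiv_radial]; simp
  have hE : HasFDerivAt (fun y : E3 => fderiv ℝ u y y)
      (∑ j, (x j • fderiv ℝ (pd j u) x
        + (EuclideanSpace.proj j : E3 →L[ℝ] ℝ).smulRight (pd j u x))) x := by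
    simp_rw [hsum]
    refine HasFDerivAt.fun_sum fun j _ => ?_
    exact ((EuclideanSpace.proj j : E3 →L[ℝ] ℝ).hasFDerivAt (x := x)).smul (hdp j).hasFDerivAt
  have hEd : DifferentiableAt ℝ (fun y : E3 => fderiv ℝ u y y) x := hE.differentiableAt
  have hEi : ∀ i, fderiv ℝ (fun y : E3 => fderiv ℝ u y y) x (e3 i)
      = (∑ j, x j • fderiv ℝ (pd j u) x (e3 i)) + pd i u x := by
    intro i
    rw [hE.fderiv]
    simp [Finset.sum_add_distrib, e3_apply]
  have hfd : ∀ i, fderiv ℝ (pohozaevField k u i) x (e3 i)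
      = 2 * (⟪fderiv ℝ u x x, fderiv ℝ (pd i u) x (e3 i)⟫_ℝ
          + ⟪(∑ j, x j • fderiv ℝ (pd j u) x (e3 i)) + pd i u x, pd i u x⟫_ℝ)
        + (k ^ 2 * (2 * ⟪u x, pd i u x⟫_ℝ)
          - ∑ j, 2 * ⟪pd j u x, fderiv ℝ (pd j u) x (e3 i)⟫_ℝ) * x i
        + (k ^ 2 * ⟪u x, u x⟫_ℝ - ∑ j, ⟪pd j u x, pd j u x⟫_ℝ) := by
    intro i
    have a1 := (hEd.hasFDerivAt.inner ℝ (hdp i).hasFDerivAt).const_mul 2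
    have a2 := (hdu.hasFDerivAt.inner ℝ hdu.hasFDerivAt).const_mul (k ^ 2)
    have a3 := HasFDerivAt.fun_sum (u := Finset.univ) fun (j : Fin 3) _ =>
      ((hdp j).hasFDerivAt.inner ℝ (hdp j).hasFDerivAt)
    have a4 := (EuclideanSpace.proj i : E3 →L[ℝ] ℝ).hasFDerivAt (x := x)
    have a5 := (a1.add ((a2.sub a3).mul a4)).fderiv
    have a6 : fderiv ℝ (pohozaevField k u i) x = _ := a5
    rw [a6]
    simp only [_root_.add_apply, _root_.smul_apply, Pi.sub_apply,
      ContinuousLinearMap.comp_apply, fderivInnerCLM_apply, _root_.sum_apply,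
      ContinuousLinearMap.prod_apply, _root_.sub_apply, smul_eq_mul, hEi]
    have e1 : fderiv ℝ u x (e3 i) = pd i u x := rfl
    have e2 : (EuclideanSpace.proj i : E3 →L[ℝ] ℝ) (e3 i) = 1 := by simp [e3_apply]
    have e3' : (EuclideanSpace.proj i : E3 →L[ℝ] ℝ) x = x i := rfl
    rw [e1, e2, e3']
    have e4 : ∀ j, ⟪pd j u x, fderiv ℝ (pd j u) x (e3 i)⟫_ℝ
        + ⟪fderiv ℝ (pd j u) x (e3 i), pd j u x⟫_ℝ
        = 2 * ⟪pd j u x, fderiv ℝ (pd j u) x (e3 i)⟫_ℝ := by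
      intro j; rw [real_inner_comm (pd j u x)]; ring
    simp only [e4]
    rw [real_inner_comm (u x) (pd i u x)]
    ring
  simp only [hfd]
  have hself : ∀ w : ℂ, ⟪w, w⟫_ℝ = ‖w‖ ^ 2 := fun w => real_inner_self_eq_norm_sq w
  have hL : ∑ i, ⟪fderiv ℝ u x x, fderiv ℝ (pd i u) x (e3 i)⟫_ℝ
      = -k ^ 2 * ∑ i, x i * ⟪u x, pd i u x⟫_ℝ := by
    rw [← inner_sum, ← laplacian_eq_sum_pd hD hu hx, hΔ, hsum, sum_inner, Finset.mul_sum]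
    refine Finset.sum_congr rfl fun i _ => ?_
    have : -(k : ℂ) ^ 2 * u x = (-k ^ 2 : ℝ) • u x := by simp
    rw [this, real_inner_smul_left, real_inner_smul_right, real_inner_comm]
    ring
  have hC : ∑ i, ⟪∑ j, x j • fderiv ℝ (pd j u) x (e3 i), pd i u x⟫_ℝ
      = ∑ i, (∑ j, ⟪pd j u x, fderiv ℝ (pd j u) x (e3 i)⟫_ℝ) * x i := by
    simp only [sum_inner, real_inner_smul_left]
    rw [Finset.sum_comm]
    refine Finset.sum_congr rfl fun i _ => ?_
    rw [Finset.sum_mul]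
    refine Finset.sum_congr rfl fun j _ => ?_
    rw [pd_comm hD hu hx i j, real_inner_comm]
    ring
  simp only [inner_add_left, hself, Finset.sum_add_distrib, mul_add, sub_mul,
    Finset.sum_sub_distrib, ← Finset.mul_sum, hL]
  simp only [mul_assoc, ← Finset.mul_sum, hC]
  simp only [gradSq]
  have e5 : ∑ i, (⟪u x, pd i u x⟫_ℝ) * x i = ∑ i, x i * ⟪u x, pd i u x⟫_ℝ :=
    Finset.sum_congr rfl fun i _ => mul_comm _ _
  rw [e5]
  simp
  ring

/-- The Rellich–Pohozaev identity on spheres, in differential form. -/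
lemma hasDerivAt_pohozaev (k : ℝ) (hD : IsOpen D) (hu : ContDiffOn ℝ 2 u D)
    (hΔ : ∀ x ∈ D, Laplacian.laplacian u x = -(k : ℂ) ^ 2 * u x)
    {I : Set ℝ} (hI : IsOpen I) (h : ∀ r ∈ I, ∀ θ : S2, r • (θ : E3) ∈ D) {r : ℝ} (hr : r ∈ I) :
    HasDerivAt (fun r : ℝ => r ^ 3 * ∫ θ : S2, (2 * ‖fderiv ℝ u (r • (θ : E3)) θ‖ ^ 2
        + k ^ 2 * ‖u (r • (θ : E3))‖ ^ 2 - gradSq u (r • (θ : E3))) ∂surf)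
      (r ^ 2 * ∫ θ : S2, (3 * k ^ 2 * ‖u (r • (θ : E3))‖ ^ 2 - gradSq u (r • (θ : E3))) ∂surf)
      r := by
  have key := hasDerivAt_flux hD (fun i => contDiffOn_pohozaevField k hD hu i) hI h hr
  refine (key.congr_deriv ?_).congr_of_eventuallyEq ?_
  · rw [smul_eq_mul]
    congr 2
    funext θ
    exact div_pohozaevField k hD hu (h r hr θ) (hΔ _ (h r hr θ))
  · refine Eventually.of_forall fun t => ?_
    simp only [smul_eq_mul]
    rw [pow_succ, mul_assoc, ← integral_const_mul]
    congr 2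
    funext θ
    set w := fderiv ℝ u (t • (θ : E3)) θ with hw
    have h1 : fderiv ℝ u (t • (θ : E3)) (t • (θ : E3)) = t • w := by rw [map_smul]
    have h2 : w = ∑ i, (θ : E3) i • pd i u (t • (θ : E3)) := by
      rw [hw, fderiv_radial]; simp
    simp only [pohozaevField, h1, real_inner_smul_left, real_inner_self_eq_norm_sq]
    have h3 : ∑ i, (θ : E3) i * ⟪w, pd i u (t • (θ : E3))⟫_ℝ = ‖w‖ ^ 2 := by
      calc _ = ⟪w, ∑ i, (θ : E3) i • pd i u (t • (θ : E3))⟫_ℝ := by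
            rw [inner_sum]; simp only [real_inner_smul_right]
        _ = ‖w‖ ^ 2 := by rw [← h2, real_inner_self_eq_norm_sq]
    have h4 := sum_sq_sphere θ
    simp only [PiLp.smul_apply, smul_eq_mul, gradSq]
    rw [← h3]
    simp only [Fin.sum_univ_three] at h4 ⊢
    linear_combination (-t * (k ^ 2 * ‖u (t • (θ : E3))‖ ^ 2 -
      (‖pd 0 u (t • (θ : E3))‖ ^ 2 + ‖pd 1 u (t • (θ : E3))‖ ^ 2
        + ‖pd 2 u (t • (θ : E3))‖ ^ 2))) * h4

end Pohozaev

/-! ### Spherical means of squares and fluxes -/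

section SphereMeans

lemma norm_integral_conj_mul_sq_le {f g : S2 → ℂ} (hf : Continuous f) (hg : Continuous g) :
    ‖∫ θ, conj (f θ) * g θ ∂surf‖ ^ 2 ≤ (∫ θ, ‖f θ‖ ^ 2 ∂surf) * ∫ θ, ‖g θ‖ ^ 2 ∂surf := by
  have h1 : ‖∫ θ, conj (f θ) * g θ ∂surf‖ ≤ ∫ θ, ‖f θ‖ * ‖g θ‖ ∂surf := by
    refine (norm_integral_le_integral_norm _).trans (le_of_eq ?_)
    simp
  have hm : ∀ {f : S2 → ℂ}, Continuous f → MemLp f (ENNReal.ofReal 2) surf := fun hf =>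
    hf.memLp_of_hasCompactSupport (HasCompactSupport.of_compactSpace _)
  have h2 := integral_mul_norm_le_Lp_mul_Lq (μ := surf) Real.HolderConjugate.two_two
    (hm hf) (hm hg)
  simp only [← Real.sqrt_eq_rpow, Real.rpow_two] at h2
  have h3 : 0 ≤ ∫ θ, ‖f θ‖ ^ 2 ∂surf := integral_nonneg fun _ => by positivity
  have h4 : 0 ≤ ∫ θ, ‖g θ‖ ^ 2 ∂surf := integral_nonneg fun _ => by positivity
  calc _ ≤ (√(∫ θ, ‖f θ‖ ^ 2 ∂surf) * √(∫ θ, ‖g θ‖ ^ 2 ∂surf)) ^ 2 := by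
        gcongr; exact h1.trans h2
    _ = _ := by rw [mul_pow, Real.sq_sqrt h3, Real.sq_sqrt h4]

/-- `∫ |u(rθ)|² dθ`. -/
noncomputable def sphSq (u : E3 → ℂ) (r : ℝ) : ℝ := ∫ θ : S2, ‖u (r • (θ : E3))‖ ^ 2 ∂surf

/-- `∫ |∇u(rθ)|² dθ`. -/
noncomputable def sphGrad (u : E3 → ℂ) (r : ℝ) : ℝ := ∫ θ : S2, gradSq u (r • (θ : E3)) ∂surf

/-- `∫ |∂_r u(rθ)|² dθ`. -/
noncomputable def sphRad (u : E3 → ℂ) (r : ℝ) : ℝ :=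
  ∫ θ : S2, ‖fderiv ℝ u (r • (θ : E3)) θ‖ ^ 2 ∂surf

/-- `∫ conj(v(rθ)) ∂_r u(rθ) dθ`. -/
noncomputable def sphFlux (v u : E3 → ℂ) (r : ℝ) : ℂ :=
  ∫ θ : S2, conj (v (r • (θ : E3))) * fderiv ℝ u (r • (θ : E3)) θ ∂surf

variable {u v : E3 → ℂ} {D : Set E3} {I : Set ℝ} {r : ℝ}

lemma sphSq_nonneg (u : E3 → ℂ) (r : ℝ) : 0 ≤ sphSq u r := integral_nonneg fun _ => by positivity

lemma sphGrad_nonneg (u : E3 → ℂ) (r : ℝ) : 0 ≤ sphGrad u r :=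
  integral_nonneg fun _ => gradSq_nonneg _ _

lemma sphRad_nonneg (u : E3 → ℂ) (r : ℝ) : 0 ≤ sphRad u r :=
  integral_nonneg fun _ => by positivity

lemma continuous_radial_deriv (hD : IsOpen D) (hu : ContDiffOn ℝ 1 u D)
    (h : ∀ θ : S2, r • (θ : E3) ∈ D) :
    Continuous fun θ : S2 => fderiv ℝ u (r • (θ : E3)) θ :=
  (continuous_restrict_sphere (hu.continuousOn_fderiv_of_isOpen hD le_rfl) h).clm_apply
    (by fun_prop)

lemma continuousOn_sphSq (hu : ContinuousOn u D) (h : ∀ r ∈ I, ∀ θ : S2, r • (θ : E3) ∈ D) :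
    ContinuousOn (sphSq u) I :=
  continuousOn_sphInt (φ := fun x => ‖u x‖ ^ 2) (hu.norm.pow 2) h

lemma continuousOn_sphGrad (hD : IsOpen D) (hu : ContDiffOn ℝ 1 u D)
    (h : ∀ r ∈ I, ∀ θ : S2, r • (θ : E3) ∈ D) : ContinuousOn (sphGrad u) I :=
  continuousOn_sphInt (continuousOn_gradSq hD hu) h

lemma sphRad_le_sphGrad (hD : IsOpen D) (hu : ContDiffOn ℝ 1 u D)
    (h : ∀ θ : S2, r • (θ : E3) ∈ D) : sphRad u r ≤ sphGrad u r := by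
  refine integral_mono (integrable_sphere ((continuous_radial_deriv hD hu h).norm.pow 2))
    (integrable_restrict_sphere (continuousOn_gradSq hD hu) h) fun θ => ?_
  exact norm_fderiv_sphere_sq_le u _ θ

lemma norm_sphFlux_sq_le (hD : IsOpen D) (hv : ContinuousOn v D) (hu : ContDiffOn ℝ 1 u D)
    (h : ∀ θ : S2, r • (θ : E3) ∈ D) : ‖sphFlux v u r‖ ^ 2 ≤ sphSq v r * sphRad u r :=
  norm_integral_conj_mul_sq_le (continuous_restrict_sphere hv h) (continuous_radial_deriv hD hu h)

lemma hasDerivAt_sphSq (hD : IsOpen D) (hu : ContDiffOn ℝ 1 u D) (hI : IsOpen I)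
    (h : ∀ r ∈ I, ∀ θ : S2, r • (θ : E3) ∈ D) (hr : r ∈ I) :
    HasDerivAt (sphSq u) (2 * (sphFlux u u r).re) r := by
  have hφ : ContDiffOn ℝ 1 (fun x => ‖u x‖ ^ 2) D := hu.norm_sq ℝ
  refine (hasDerivAt_sphInt hD hφ hI h hr).congr_deriv ?_
  have hint : Integrable (fun θ : S2 => conj (u (r • (θ : E3))) * fderiv ℝ u (r • (θ : E3)) θ)
      surf := by
    refine integrable_sphere (Continuous.mul ?_ (continuous_radial_deriv hD hu (h r hr)))
    exact Complex.continuous_conj.comp (continuous_restrict_sphere hu.continuousOn (h r hr))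
  have hre : (sphFlux u u r).re
      = ∫ θ : S2, (conj (u (r • (θ : E3))) * fderiv ℝ u (r • (θ : E3)) θ).re ∂surf :=
    (integral_re hint).symm
  rw [hre, ← integral_const_mul]
  congr 1
  funext θ
  have hd : HasFDerivAt u (fderiv ℝ u (r • (θ : E3))) (r • (θ : E3)) :=
    ((hu.differentiableOn one_ne_zero).differentiableAt (hD.mem_nhds (h r hr θ))).hasFDerivAt
  rw [hd.norm_sq.fderiv]
  simp [Complex.inner]
  ring

lemma hasDerivAt_sphFlux (hD : IsOpen D) (hu : ContDiffOn ℝ 2 u D) {lam : ℂ}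
    (hΔ : ∀ x ∈ D, Laplacian.laplacian u x = lam * u x) (hI : IsOpen I)
    (h : ∀ r ∈ I, ∀ θ : S2, r • (θ : E3) ∈ D) (hr : r ∈ I) :
    HasDerivAt (fun r : ℝ => (r : ℂ) ^ 2 * sphFlux u u r)
      ((r : ℂ) ^ 2 * (sphGrad u r + lam * sphSq u r)) r := by
  have hu1 : ContDiffOn ℝ 1 u D := hu.of_le (by norm_num)
  refine (hasDerivAt_green hD hu1 hu hI h hr).congr_deriv ?_
  congr 1
  have h1 := integrable_restrict_sphere (continuousOn_gradSq hD hu1) (h r hr)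
  have h2 := integrable_restrict_sphere (φ := fun x => ‖u x‖ ^ 2) (hu.continuousOn.norm.pow 2)
    (h r hr)
  unfold sphGrad sphSq
  rw [← integral_complex_ofReal, ← integral_complex_ofReal, ← integral_const_mul, ← integral_add]
  · congr 1
    funext θ
    rw [hΔ _ (h r hr θ)]
    simp only [gradSq, Complex.ofReal_sum, Complex.ofReal_pow,
      ← Complex.conj_mul']
    ring
  · exact h1.ofReal
  · exact h2.ofReal.const_mul _

lemma hasDerivAt_sphPohozaev (k : ℝ) (hD : IsOpen D) (hu : ContDiffOn ℝ 2 u D)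
    (hΔ : ∀ x ∈ D, Laplacian.laplacian u x = -(k : ℂ) ^ 2 * u x) (hI : IsOpen I)
    (h : ∀ r ∈ I, ∀ θ : S2, r • (θ : E3) ∈ D) (hr : r ∈ I) :
    HasDerivAt (fun r : ℝ => r ^ 3 * (2 * sphRad u r + k ^ 2 * sphSq u r - sphGrad u r))
      (r ^ 2 * (3 * k ^ 2 * sphSq u r - sphGrad u r)) r := by
  have hu1 : ContDiffOn ℝ 1 u D := hu.of_le (by norm_num)
  have h1 := fun t ht => integrable_restrict_sphere (continuousOn_gradSq hD hu1) (h t ht)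
  have h2 := fun t ht => integrable_restrict_sphere (φ := fun x => ‖u x‖ ^ 2)
    (hu.continuousOn.norm.pow 2) (h t ht)
  have h3 : ∀ t ∈ I, Integrable (fun θ : S2 => ‖fderiv ℝ u (t • (θ : E3)) θ‖ ^ 2) surf :=
    fun t ht => integrable_sphere ((continuous_radial_deriv hD hu1 (h t ht)).norm.pow 2)
  refine ((hasDerivAt_pohozaev k hD hu hΔ hI h hr).congr_deriv ?_).congr_of_eventuallyEq ?_
  · rw [integral_sub ((h2 r hr).const_mul _) (h1 r hr), integral_const_mul]
    rfl
  · filter_upwards [hI.mem_nhds hr] with t ht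
    rw [integral_sub (by exact ((h3 t ht).const_mul 2).add ((h2 t ht).const_mul _)) (h1 t ht),
      integral_add ((h3 t ht).const_mul 2) ((h2 t ht).const_mul _), integral_const_mul,
      integral_const_mul]
    rfl

end SphereMeans

section Calculus

lemma hasDerivAt_max_zero_sq (x : ℝ) : HasDerivAt (fun x : ℝ => max x 0 ^ 2) (2 * max x 0) x := by
  rcases lt_trichotomy x 0 with hx | rfl | hx
  · rw [max_eq_right hx.le, mul_zero]
    refine (hasDerivAt_const x (0 : ℝ)).congr_of_eventuallyEq ?_
    filter_upwards [gt_mem_nhds hx] with y hy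
    simp [max_eq_right (le_of_lt hy)]
  · rw [max_self, mul_zero, hasDerivAt_iff_isLittleO_nhds_zero]
    refine Asymptotics.IsBigO.trans_isLittleO (g := fun h : ℝ => h ^ 2) ?_ ?_
    · refine Asymptotics.isBigO_of_le _ fun h => ?_
      simp only [zero_add, max_self, smul_zero, sub_zero, norm_pow, Real.norm_eq_abs]
      norm_num
      rcases le_total h 0 with hh | hh
      · simp [max_eq_right hh]; positivity
      · simp [max_eq_left hh]
    · exact Asymptotics.isLittleO_pow_id one_lt_two
  · rw [max_eq_left hx.le]
    refine (by simpa using hasDerivAt_pow 2 x : HasDerivAt (fun x : ℝ => x ^ 2) (2 * x) x)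
      |>.congr_of_eventuallyEq ?_
    filter_upwards [lt_mem_nhds hx] with y hy
    simp [max_eq_left (le_of_lt hy)]

/-- A function which can only increase where it is positive, and whose limit at infinity is
nonpositive, is nonpositive. -/
lemma nonpos_of_deriv_nonneg_of_pos {p p' : ℝ → ℝ} {a l : ℝ}
    (hp : ∀ r > a, HasDerivAt p (p' r) r) (hpos : ∀ r > a, 0 < p r → 0 ≤ p' r)
    (hl : Tendsto p atTop (𝓝 l)) (hl0 : l ≤ 0) {r : ℝ} (hr : a < r) : p r ≤ 0 := by
  have hd : ∀ t > a, HasDerivAt (fun t => max (p t) 0 ^ 2) (2 * max (p t) 0 * p' t) t :=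
    fun t ht => (hasDerivAt_max_zero_sq (p t)).comp t (hp t ht)
  have hmono : MonotoneOn (fun t => max (p t) 0 ^ 2) (Ioi a) := by
    refine monotoneOn_of_deriv_nonneg (convex_Ioi a)
      (fun t ht => (hd t ht).continuousAt.continuousWithinAt)
      (fun t ht => (hd t (interior_subset ht)).differentiableAt.differentiableWithinAt) ?_
    intro t ht
    have ht' : a < t := interior_subset ht
    rw [(hd t ht').deriv]
    rcases le_or_gt (p t) 0 with h | h
    · simp [max_eq_right h]
    · have := hpos t ht' h
      positivity
  have hlim : Tendsto (fun t => max (p t) 0 ^ 2) atTop (𝓝 0) := by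
    have := (hl.max (tendsto_const_nhds (x := (0 : ℝ)))).pow 2
    simpa [max_eq_right hl0] using this
  have hle : max (p r) 0 ^ 2 ≤ 0 := by
    refine ge_of_tendsto hlim ?_
    filter_upwards [eventually_ge_atTop r] with t ht
    exact hmono (mem_Ioi.2 hr) (mem_Ioi.2 (hr.trans_le ht)) ht
  have : max (p r) 0 = 0 := by nlinarith [sq_nonneg (max (p r) 0)]
  exact max_eq_right_iff.1 this

end Calculus

/-! ### Asymptotics of radiating fields -/

section Exterior

lemma isOpen_outerDomain : IsOpen outerDomain := isOpen_lt continuous_const continuous_norm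

lemma isOpen_innerDomain : IsOpen innerDomain := isOpen_lt continuous_norm continuous_const

lemma smul_mem_outerDomain {r : ℝ} (hr : r ∈ Ioi (1 : ℝ)) (θ : S2) :
    r • (θ : E3) ∈ outerDomain := by
  change 1 < ‖r • (θ : E3)‖
  rw [norm_smul_sphere (zero_le_one.trans (le_of_lt hr))]
  exact hr

lemma normalDeriv_smul_sphere (u : E3 → ℂ) {r : ℝ} (hr : 0 < r) (θ : S2) :
    normalDeriv u (r • (θ : E3)) = fderiv ℝ u (r • (θ : E3)) θ := by
  unfold normalDeriv
  rw [norm_smul_sphere hr.le, smul_smul, inv_mul_cancel₀ hr.ne', one_smul]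

variable {k : ℝ} {e : E3 → ℂ} {F : S2 → ℂ}

/-- The oscillating factor `e^{-ikr}`. -/
noncomputable def phase (k r : ℝ) : ℂ := Complex.exp (-(Complex.I * k * r))

lemma norm_phase (k r : ℝ) : ‖phase k r‖ = 1 := by
  have : phase k r = Complex.exp ((-(k * r) : ℝ) * Complex.I) := by
    unfold phase; congr 1; push_cast; ring
  rw [this, Complex.norm_exp_ofReal_mul_I]

lemma conj_phase_mul (k r : ℝ) : conj (phase k r) * phase k r = 1 := by
  rw [Complex.conj_mul', norm_phase]; simp

lemma phase_mul_farField (hF : IsFarFieldPattern k e F) :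
    ∃ C R : ℝ, 0 < R ∧ 0 ≤ C ∧ ∀ r ≥ R, ∀ θ : S2,
      ‖phase k r * (r * e (r • (θ : E3))) - F θ‖ ≤ C / r := by
  obtain ⟨C, R, h⟩ := hF
  refine ⟨|C|, max R 1, by positivity, abs_nonneg _, fun r hr θ => ?_⟩
  have hr1 : 1 ≤ r := (le_max_right _ _).trans hr
  have hr0 : 0 < r := by linarith
  have hrc : (r : ℂ) ≠ 0 := by exact_mod_cast hr0.ne'
  have hph : phase k r * Complex.exp (Complex.I * k * r) = 1 := by
    unfold phase; rw [← Complex.exp_add]; simp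
  have e1 : phase k r * (r * e (r • (θ : E3))) - F θ = phase k r * r *
      (e (r • (θ : E3)) - Complex.exp (Complex.I * k * r) / r * F θ) := by
    have : phase k r * r * (Complex.exp (Complex.I * k * r) / r * F θ)
      = (phase k r * Complex.exp (Complex.I * k * r)) * F θ := by field_simp
    rw [mul_sub, this, hph]; ring
  rw [e1, norm_mul, norm_mul, norm_phase, one_mul, Complex.norm_real, Real.norm_of_nonneg hr0.le]
  have h2 := h r ((le_max_left _ _).trans hr) θ
  calc _ ≤ r * (C / r ^ 2) := by gcongr
    _ = C / r := by field_simp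
    _ ≤ _ := by gcongr; exact le_abs_self C

lemma continuous_farField (he : ContinuousOn e outerDomain) (hF : IsFarFieldPattern k e F) :
    Continuous F := by
  obtain ⟨C, R, hR, hC, h⟩ := phase_mul_farField hF
  have hu : TendstoUniformly (fun (r : ℝ) (θ : S2) => phase k r * (r * e (r • (θ : E3)))) F
      atTop := by
    rw [Metric.tendstoUniformly_iff]
    intro ε hε
    filter_upwards [eventually_ge_atTop R, eventually_gt_atTop (C / ε)] with r hr hr2 θ
    rw [dist_comm, dist_eq_norm]
    refine (h r hr θ).trans_lt ?_
    have hr0 : 0 < r := hR.trans_le hr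
    rw [div_lt_iff₀ hr0]
    rw [div_lt_iff₀ hε] at hr2
    linarith
  refine hu.continuous (Eventually.frequently ?_)
  filter_upwards [eventually_gt_atTop 1] with r hr
  exact continuous_const.mul (continuous_const.mul
    (continuous_restrict_sphere he (smul_mem_outerDomain hr)))

lemma Sommerfeld.uniform (hS : Sommerfeld k e) {ε : ℝ} (hε : 0 < ε) :
    ∀ᶠ r : ℝ in atTop, ∀ θ : S2, ‖(r : ℂ) * (fderiv ℝ e (r • (θ : E3)) θ
      - Complex.I * k * e (r • (θ : E3)))‖ < ε := by
  have h := (Metric.tendsto_nhds.1 hS) ε hε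
  obtain ⟨R, _, hR⟩ := (Metric.hasBasis_cobounded_compl_closedBall (0 : E3)).eventually_iff.1 h
  filter_upwards [eventually_gt_atTop R, eventually_gt_atTop 0] with r hr hr0 θ
  have := hR (x := r • (θ : E3)) (by simpa [norm_smul_sphere hr0.le] using hr)
  rw [dist_zero_right, norm_smul_sphere hr0.le, normalDeriv_smul_sphere _ hr0] at this
  exact this

/-- For a radiating field `e` with far-field pattern `F`, the functions `f = r e` and
`f' = e + r ∂_r e` satisfy `e^{-ikr} f → F` and `e^{-ikr} f' → ik F`, boundedly. -/
lemma radiating_asymptotics (he : ContinuousOn e outerDomain) (hS : Sommerfeld k e)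
    (hF : IsFarFieldPattern k e F) :
    (∃ C : ℝ, ∀ᶠ r : ℝ in atTop, ∀ θ : S2,
      ‖phase k r * (r * e (r • (θ : E3)))‖ ≤ C ∧
      ‖phase k r * (e (r • (θ : E3)) + r * fderiv ℝ e (r • (θ : E3)) θ)‖ ≤ C) ∧
    (∀ θ : S2, Tendsto (fun r : ℝ => phase k r * (r * e (r • (θ : E3)))) atTop (𝓝 (F θ))) ∧
    (∀ θ : S2, Tendsto (fun r : ℝ => phase k r * (e (r • (θ : E3))
      + r * fderiv ℝ e (r • (θ : E3)) θ)) atTop (𝓝 (Complex.I * k * F θ))) := by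
  obtain ⟨C, R, hR, hC, h⟩ := phase_mul_farField hF
  obtain ⟨B, hB⟩ := isCompact_univ.exists_bound_of_continuousOn
    (continuous_farField he hF).continuousOn
  have hinv : Tendsto (fun r : ℝ => C / r) atTop (𝓝 0) := tendsto_const_nhds.div_atTop tendsto_id
  have hlim1 : ∀ θ : S2, Tendsto (fun r : ℝ => phase k r * (r * e (r • (θ : E3)))) atTop
      (𝓝 (F θ)) := by
    intro θ
    rw [tendsto_iff_norm_sub_tendsto_zero]
    refine squeeze_zero' (Eventually.of_forall fun _ => norm_nonneg _) ?_ hinv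
    filter_upwards [eventually_ge_atTop R] with r hr using h r hr θ
  have hdecomp : ∀ (r : ℝ) (θ : S2), r ≠ 0 →
      phase k r * (e (r • (θ : E3)) + r * fderiv ℝ e (r • (θ : E3)) θ)
      = (phase k r * (r * e (r • (θ : E3)))) * ((r : ℂ)⁻¹ + Complex.I * k)
        + phase k r * (r * (fderiv ℝ e (r • (θ : E3)) θ - Complex.I * k * e (r • (θ : E3)))) := by
    intro r θ hr
    have hrc : (r : ℂ) ≠ 0 := by exact_mod_cast hr
    field_simp
    ring
  refine ⟨⟨(B + C / R) * (1 + |k|) + (B + C / R) + 1, ?_⟩, hlim1, fun θ => ?_⟩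
  · have hB0 : 0 ≤ B := by
      have : Nonempty S2 := ⟨⟨e3 0, by simp [e3]⟩⟩
      exact (norm_nonneg _).trans (hB (Classical.arbitrary S2) (mem_univ _))
    filter_upwards [eventually_ge_atTop R, eventually_ge_atTop 1, hS.uniform one_pos]
      with r hr hr1 hs θ
    have hr0 : 0 < r := hR.trans_le hr
    have h1 : ‖phase k r * (r * e (r • (θ : E3)))‖ ≤ B + C / R := by
      have h2 := norm_add_le (phase k r * (r * e (r • (θ : E3))) - F θ) (F θ)
      rw [sub_add_cancel] at h2
      have h3 := h r hr θ
      have h4 : C / r ≤ C / R := by gcongr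
      have h5 := hB θ (mem_univ _)
      linarith
    have hCR : 0 ≤ C / R := by positivity
    have h1' : 0 ≤ (B + C / R) * (1 + |k|) := by positivity
    refine ⟨by linarith, ?_⟩
    rw [hdecomp r θ hr0.ne']
    refine (norm_add_le _ _).trans ?_
    rw [norm_mul, norm_mul (phase k r) (_ * (_ - _)), norm_phase, one_mul]
    have h6 : ‖(r : ℂ)⁻¹ + Complex.I * k‖ ≤ 1 + |k| := by
      refine (norm_add_le _ _).trans (add_le_add ?_ ?_)
      · rw [norm_inv, Complex.norm_real, Real.norm_of_nonneg hr0.le]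
        exact inv_le_one_of_one_le₀ hr1
      · simp
    have h7 := (hs θ).le
    have h8 : ‖phase k r * (r * e (r • (θ : E3)))‖ * ‖(r : ℂ)⁻¹ + Complex.I * k‖
        ≤ (B + C / R) * (1 + |k|) := by gcongr
    linarith
  · have hi : Tendsto (fun r : ℝ => ((r : ℂ)⁻¹ + Complex.I * k)) atTop (𝓝 (Complex.I * k)) := by
      have : Tendsto (fun r : ℝ => ((r⁻¹ : ℝ) : ℂ)) atTop (𝓝 ((0 : ℝ) : ℂ)) :=
        (Complex.continuous_ofReal.tendsto _).comp tendsto_inv_atTop_zero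
      simpa using this.add_const (Complex.I * k)
    have hz : Tendsto (fun r : ℝ => phase k r * (r * (fderiv ℝ e (r • (θ : E3)) θ
        - Complex.I * k * e (r • (θ : E3))))) atTop (𝓝 0) := by
      rw [Metric.tendsto_nhds]
      intro ε hε
      filter_upwards [hS.uniform hε] with r hr
      rw [dist_zero_right, norm_mul, norm_phase, one_mul]
      exact hr θ
    have := ((hlim1 θ).mul hi).add hz
    rw [add_zero, mul_comm (F θ)] at this
    refine this.congr' ?_
    filter_upwards [eventually_gt_atTop 0] with r hr
    exact (hdecomp r θ hr.ne').symm

lemma tendsto_integral_conj_mul {a b : ℝ → S2 → ℂ} {a' b' : S2 → ℂ} {C : ℝ}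
    (hac : ∀ᶠ r in atTop, Continuous (a r)) (hbc : ∀ᶠ r in atTop, Continuous (b r))
    (hC : ∀ᶠ r in atTop, ∀ θ, ‖a r θ‖ ≤ C ∧ ‖b r θ‖ ≤ C)
    (ha : ∀ θ, Tendsto (fun r => a r θ) atTop (𝓝 (a' θ)))
    (hb : ∀ θ, Tendsto (fun r => b r θ) atTop (𝓝 (b' θ))) :
    Tendsto (fun r => ∫ θ, conj (a r θ) * b r θ ∂surf) atTop
      (𝓝 (∫ θ, conj (a' θ) * b' θ ∂surf)) := by
  refine tendsto_integral_filter_of_dominated_convergence (fun _ => C * C) ?_ ?_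
    (integrable_const _) ?_
  · filter_upwards [hac, hbc] with r h1 h2
    exact (integrable_sphere ((Complex.continuous_conj.comp h1).mul h2)).aestronglyMeasurable
  · filter_upwards [hC] with r h
    refine Eventually.of_forall fun θ => ?_
    obtain ⟨h1, h2⟩ := h θ
    rw [norm_mul, RCLike.norm_conj]
    exact mul_le_mul h1 h2 (norm_nonneg _) ((norm_nonneg _).trans h1)
  · refine Eventually.of_forall fun θ => ?_
    exact ((Complex.continuous_conj.tendsto _).comp (ha θ)).mul (hb θ)

end Exterior

/-! ### Coercivity of the exterior problem -/

section Radiating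

variable {k : ℝ} {e : E3 → ℂ} {F : S2 → ℂ}

/-- The squared norm in `L²(S²)`. -/
noncomputable def l2Sq (F : S2 → ℂ) : ℝ := ∫ θ, ‖F θ‖ ^ 2 ∂surf

lemma l2Sq_nonneg (F : S2 → ℂ) : 0 ≤ l2Sq F := integral_nonneg fun _ => by positivity

/-- `‖f'‖²` on the unit sphere, where `f(r) = r e(r ·)`. -/
noncomputable def derSq (e : E3 → ℂ) (r : ℝ) : ℝ :=
  sphSq e r + 2 * r * (sphFlux e e r).re + r ^ 2 * sphRad e r

lemma integral_conj_mul_self {f : S2 → ℂ} :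
    ∫ θ, conj (f θ) * f θ ∂surf = ((∫ θ, ‖f θ‖ ^ 2 ∂surf : ℝ) : ℂ) := by
  rw [← integral_complex_ofReal]
  congr 1
  funext θ
  rw [Complex.conj_mul']; simp

section Expansions

variable {D : Set E3} {r : ℝ}

lemma integral_conj_f_f' (hD : IsOpen D) (he : ContDiffOn ℝ 1 e D)
    (h : ∀ θ : S2, r • (θ : E3) ∈ D) (c : ℂ) (hc : conj c * c = 1) :
    ∫ θ : S2, conj (c * (r * e (r • (θ : E3))))
      * (c * (e (r • (θ : E3)) + r * fderiv ℝ e (r • (θ : E3)) θ)) ∂surf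
      = ((r * sphSq e r : ℝ) : ℂ) + (r : ℂ) ^ 2 * sphFlux e e r := by
  have c1 := continuous_restrict_sphere he.continuousOn h
  have c2 := continuous_radial_deriv hD he h
  have c3 : Continuous fun θ : S2 => conj (e (r • (θ : E3))) := Complex.continuous_conj.comp c1
  have e1 : ∀ θ : S2, conj (c * (r * e (r • (θ : E3))))
      * (c * (e (r • (θ : E3)) + r * fderiv ℝ e (r • (θ : E3)) θ))
      = (r : ℂ) * (conj (e (r • (θ : E3))) * e (r • (θ : E3)))
        + (r : ℂ) ^ 2 * (conj (e (r • (θ : E3))) * fderiv ℝ e (r • (θ : E3)) θ) := by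
    intro θ
    simp only [map_mul, Complex.conj_ofReal]
    linear_combination ((r : ℂ) * conj (e (r • (θ : E3)))
      * (e (r • (θ : E3)) + r * fderiv ℝ e (r • (θ : E3)) θ)) * hc
  simp only [e1]
  rw [integral_add, integral_const_mul, integral_const_mul, integral_conj_mul_self]
  · simp [sphSq, sphFlux]
  · exact (integrable_sphere (c3.mul c1)).const_mul _
  · exact (integrable_sphere (c3.mul c2)).const_mul _

lemma integral_f_sq (c : ℂ) (hc : conj c * c = 1) :
    ∫ θ : S2, conj (c * (r * e (r • (θ : E3)))) * (c * (r * e (r • (θ : E3)))) ∂surf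
      = ((r ^ 2 * sphSq e r : ℝ) : ℂ) := by
  have e1 : ∀ θ : S2, conj (c * (r * e (r • (θ : E3)))) * (c * (r * e (r • (θ : E3))))
      = (r : ℂ) ^ 2 * (conj (e (r • (θ : E3))) * e (r • (θ : E3))) := by
    intro θ
    simp only [map_mul, Complex.conj_ofReal]
    linear_combination ((r : ℂ) * conj (e (r • (θ : E3))) * (r * e (r • (θ : E3)))) * hc
  simp only [e1]
  rw [integral_const_mul, integral_conj_mul_self]
  simp [sphSq]

lemma integral_f'_sq (hD : IsOpen D) (he : ContDiffOn ℝ 1 e D)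
    (h : ∀ θ : S2, r • (θ : E3) ∈ D) (c : ℂ) (hc : conj c * c = 1) :
    ∫ θ : S2, conj (c * (e (r • (θ : E3)) + r * fderiv ℝ e (r • (θ : E3)) θ))
      * (c * (e (r • (θ : E3)) + r * fderiv ℝ e (r • (θ : E3)) θ)) ∂surf
      = (derSq e r : ℂ) := by
  have c1 := continuous_restrict_sphere he.continuousOn h
  have c2 := continuous_radial_deriv hD he h
  have c3 : Continuous fun θ : S2 => conj (e (r • (θ : E3))) := Complex.continuous_conj.comp c1
  have i1 := integrable_sphere (c1.norm.pow 2)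
  have i2 := integrable_sphere (c2.norm.pow 2)
  have i3 := integrable_sphere (c3.mul c2)
  have e1 : ∀ θ : S2, conj (c * (e (r • (θ : E3)) + r * fderiv ℝ e (r • (θ : E3)) θ))
      * (c * (e (r • (θ : E3)) + r * fderiv ℝ e (r • (θ : E3)) θ))
      = ((‖e (r • (θ : E3))‖ ^ 2
        + 2 * r * (conj (e (r • (θ : E3))) * fderiv ℝ e (r • (θ : E3)) θ).re
        + r ^ 2 * ‖fderiv ℝ e (r • (θ : E3)) θ‖ ^ 2 : ℝ) : ℂ) := by
    intro θ
    set a := e (r • (θ : E3))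
    set b := fderiv ℝ e (r • (θ : E3)) θ
    have : conj (c * (a + r * b)) * (c * (a + r * b))
        = conj (a + r * b) * (a + r * b) := by
      simp only [map_mul]
      linear_combination (conj (a + r * b) * (a + r * b)) * hc
    rw [this, Complex.conj_mul', ← Complex.ofReal_pow, Complex.sq_norm, Complex.sq_norm,
      Complex.sq_norm]
    congr 1
    simp [Complex.normSq_apply]
    ring
  simp only [e1]
  rw [integral_complex_ofReal, integral_add, integral_add, integral_const_mul, integral_const_mul]
  · have : ∫ θ : S2, (conj (e (r • (θ : E3))) * fderiv ℝ e (r • (θ : E3)) θ).re ∂surf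
        = (sphFlux e e r).re := integral_re i3
    rw [this]
    rfl
  · exact i1
  · exact i3.re.const_mul _
  · exact i1.add (i3.re.const_mul _)
  · exact i2.const_mul _

/-- Cauchy–Schwarz for `Re ⟨f, f'⟩`. -/
lemma re_inner_sq_le (hD : IsOpen D) (he : ContDiffOn ℝ 1 e D)
    (h : ∀ θ : S2, r • (θ : E3) ∈ D) :
    (r * sphSq e r + r ^ 2 * (sphFlux e e r).re) ^ 2 ≤ (r ^ 2 * sphSq e r) * derSq e r := by
  have c1 := continuous_restrict_sphere he.continuousOn h
  have c2 := continuous_radial_deriv hD he h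
  have h1 : conj (1 : ℂ) * 1 = 1 := by simp
  have hcs := norm_integral_conj_mul_sq_le
    (f := fun θ : S2 => 1 * (r * e (r • (θ : E3))))
    (g := fun θ : S2 => 1 * (e (r • (θ : E3)) + r * fderiv ℝ e (r • (θ : E3)) θ))
    (continuous_const.mul (continuous_const.mul c1))
    (continuous_const.mul (c1.add (continuous_const.mul c2)))
  have a1 := integral_f_sq (e := e) (r := r) 1 h1
  have a2 := integral_f'_sq hD he h 1 h1
  rw [integral_conj_mul_self] at a1 a2
  rw [integral_conj_f_f' hD he h 1 h1, Complex.ofReal_inj.1 a1, Complex.ofReal_inj.1 a2] at hcs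
  refine le_trans ?_ hcs
  rw [sq_le_sq, abs_norm]
  refine le_trans (le_of_eq ?_) (Complex.abs_re_le_norm _)
  congr 1
  simp [← Complex.ofReal_pow]

end Expansions

section Limits
variable (he : ContDiffOn ℝ 1 e outerDomain) (hS : Sommerfeld k e) (hF : IsFarFieldPattern k e F)
include he hS hF

lemma tendsto_radiating :
    Tendsto (fun r => r ^ 2 * sphSq e r) atTop (𝓝 (l2Sq F)) ∧
    Tendsto (fun r : ℝ => ((r * sphSq e r : ℝ) : ℂ) + (r : ℂ) ^ 2 * sphFlux e e r) atTop
      (𝓝 (Complex.I * k * l2Sq F)) ∧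
    Tendsto (derSq e) atTop (𝓝 (k ^ 2 * l2Sq F)) := by
  obtain ⟨⟨C, hC⟩, hl1, hl2⟩ := radiating_asymptotics he.continuousOn hS hF
  have hca : ∀ᶠ r : ℝ in atTop, Continuous fun θ : S2 => phase k r * (r * e (r • (θ : E3))) := by
    filter_upwards [eventually_gt_atTop 1] with r hr
    exact continuous_const.mul (continuous_const.mul
      (continuous_restrict_sphere he.continuousOn (smul_mem_outerDomain hr)))
  have hcb : ∀ᶠ r : ℝ in atTop, Continuous fun θ : S2 =>
      phase k r * (e (r • (θ : E3)) + r * fderiv ℝ e (r • (θ : E3)) θ) := by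
    filter_upwards [eventually_gt_atTop 1] with r hr
    have c1 := continuous_restrict_sphere he.continuousOn (smul_mem_outerDomain hr)
    have c2 := continuous_radial_deriv isOpen_outerDomain he (smul_mem_outerDomain hr)
    exact continuous_const.mul (c1.add (continuous_const.mul c2))
  have t1 := tendsto_integral_conj_mul hca hca (hC.mono fun r h θ => ⟨(h θ).1, (h θ).1⟩) hl1 hl1
  have t2 := tendsto_integral_conj_mul hca hcb hC hl1 hl2
  have t3 := tendsto_integral_conj_mul hcb hcb (hC.mono fun r h θ => ⟨(h θ).2, (h θ).2⟩) hl2 hl2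
  refine ⟨?_, ?_, ?_⟩
  · have := (Complex.continuous_re.tendsto _).comp t1
    rw [integral_conj_mul_self, Complex.ofReal_re] at this
    refine this.congr fun r => ?_
    simp only [Function.comp]
    rw [integral_f_sq _ (conj_phase_mul k r), Complex.ofReal_re]
  · have e1 : ∫ θ, conj (F θ) * (Complex.I * k * F θ) ∂surf = Complex.I * k * l2Sq F := by
      have : ∀ θ, conj (F θ) * (Complex.I * k * F θ) = Complex.I * k * (conj (F θ) * F θ) :=
        fun θ => by ring
      simp only [this]
      rw [integral_const_mul, integral_conj_mul_self]
      rfl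
    rw [e1] at t2
    refine t2.congr' ?_
    filter_upwards [eventually_gt_atTop 1] with r hr
    exact integral_conj_f_f' isOpen_outerDomain he (smul_mem_outerDomain hr) _ (conj_phase_mul k r)
  · have := (Complex.continuous_re.tendsto _).comp t3
    rw [integral_conj_mul_self, Complex.ofReal_re] at this
    have e1 : ∫ θ, ‖Complex.I * k * F θ‖ ^ 2 ∂surf = k ^ 2 * l2Sq F := by
      simp only [norm_mul, Complex.norm_I, one_mul, Complex.norm_real, mul_pow, Real.norm_eq_abs,
        sq_abs]
      rw [integral_const_mul]; rfl
    rw [e1] at this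
    refine this.congr' ?_
    filter_upwards [eventually_gt_atTop 1] with r hr
    simp only [Function.comp]
    rw [integral_f'_sq isOpen_outerDomain he (smul_mem_outerDomain hr) _ (conj_phase_mul k r),
      Complex.ofReal_re]

end Limits

lemma hasDerivAt_sphSq_outer (he : ContDiffOn ℝ 2 e outerDomain) {r : ℝ} (hr : 1 < r) :
    HasDerivAt (sphSq e) (2 * (sphFlux e e r).re) r :=
  hasDerivAt_sphSq isOpen_outerDomain (he.of_le (by norm_num)) isOpen_Ioi
    (fun _ hr => smul_mem_outerDomain hr) (mem_Ioi.2 hr)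

section Energy
variable (he : ContDiffOn ℝ 2 e outerDomain)
  (hΔ : ∀ x ∈ outerDomain, Laplacian.laplacian e x = -(k : ℂ) ^ 2 * e x)
include he hΔ

/-- The derivative of `r² ∫ conj(e) ∂_r e` outside the ball, split into real and imaginary parts. -/
lemma hasDerivAt_re_im_flux {r : ℝ} (hr : 1 < r) :
    HasDerivAt (fun r => r ^ 2 * (sphFlux e e r).re)
      (r ^ 2 * (sphGrad e r - k ^ 2 * sphSq e r)) r ∧
    HasDerivAt (fun r => r ^ 2 * (sphFlux e e r).im) 0 r := by
  have h := hasDerivAt_sphFlux isOpen_outerDomain he hΔ isOpen_Ioi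
    (fun r hr => smul_mem_outerDomain hr) (mem_Ioi.2 hr)
  have hre := Complex.reCLM.hasFDerivAt.comp_hasDerivAt r h
  have him := Complex.imCLM.hasFDerivAt.comp_hasDerivAt r h
  constructor
  · refine (hre.congr_deriv ?_).congr_of_eventuallyEq (Eventually.of_forall fun t => ?_)
    · simp [← Complex.ofReal_pow, ← Complex.ofReal_neg, ← Complex.ofReal_mul, ← Complex.ofReal_add]
      left; ring
    · simp [← Complex.ofReal_pow]
  · refine (him.congr_deriv ?_).congr_of_eventuallyEq (Eventually.of_forall fun t => ?_)
    · simp [← Complex.ofReal_pow, ← Complex.ofReal_neg, ← Complex.ofReal_mul, ← Complex.ofReal_add]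
    · simp [← Complex.ofReal_pow]

/-- The radial energy `‖f'‖² + k²‖f‖² - ⟨Lf, f⟩ / r²`, with `L` the negative Laplacian of the unit
sphere, expressed through spherical integrals of `e`. -/
noncomputable def radialEnergy (k : ℝ) (e : E3 → ℂ) (r : ℝ) : ℝ :=
  sphSq e r + 2 * r * (sphFlux e e r).re
    + r ^ 2 * (2 * sphRad e r + k ^ 2 * sphSq e r - sphGrad e r)

lemma hasDerivAt_radialEnergy {r : ℝ} (hr : 1 < r) :
    HasDerivAt (radialEnergy k e) (2 * r * (sphGrad e r - sphRad e r)) r := by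
  have hr0 : r ≠ 0 := by linarith
  have h1 := hasDerivAt_sphSq_outer he hr
  have h2 := (hasDerivAt_re_im_flux he hΔ hr).1
  have h3 := hasDerivAt_sphPohozaev k isOpen_outerDomain he hΔ isOpen_Ioi
    (fun r hr => smul_mem_outerDomain hr) (mem_Ioi.2 hr)
  have h4 := hasDerivAt_inv hr0
  have h5 := (h1.add ((h2.const_mul 2).mul h4)).add (h3.mul h4)
  refine (h5.congr_deriv ?_).congr_of_eventuallyEq ?_
  · field_simp
    ring
  · filter_upwards [isOpen_Ioi.mem_nhds (mem_Ioi.2 hr)] with t ht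
    have ht0 : t ≠ 0 := by have := mem_Ioi.1 ht; linarith
    simp only [radialEnergy, Pi.add_apply, Pi.mul_apply]
    field_simp

lemma radialEnergy_monotoneOn : MonotoneOn (radialEnergy k e) (Ioi 1) := by
  refine monotoneOn_of_deriv_nonneg (convex_Ioi 1)
    (fun t ht => (hasDerivAt_radialEnergy he hΔ ht).continuousAt.continuousWithinAt)
    (fun t ht => (hasDerivAt_radialEnergy he hΔ
      (interior_subset ht)).differentiableAt.differentiableWithinAt) ?_
  intro t ht
  have ht' : 1 < t := interior_subset ht
  rw [(hasDerivAt_radialEnergy he hΔ ht').deriv]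
  have := sphRad_le_sphGrad isOpen_outerDomain (he.of_le (by norm_num)) (smul_mem_outerDomain ht')
  have h2 : 0 ≤ sphGrad e t - sphRad e t := by linarith
  have : 0 < t := by linarith
  positivity

variable (hS : Sommerfeld k e) (hF : IsFarFieldPattern k e F)
include hS hF

/-- The energy of a radiating field is at most its value at infinity: the angular part of the
energy has a sign. -/
lemma radialEnergy_le {r : ℝ} (hr : 1 < r) : radialEnergy k e r ≤ 2 * k ^ 2 * l2Sq F := by
  obtain ⟨t1, -, t3⟩ := tendsto_radiating (he.of_le (by norm_num)) hS hF
  have t4 := t3.add (t1.const_mul (k ^ 2))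
  have : 2 * k ^ 2 * l2Sq F = k ^ 2 * l2Sq F + k ^ 2 * l2Sq F := by ring
  rw [this]
  refine ge_of_tendsto t4 ?_
  filter_upwards [eventually_ge_atTop r] with t ht
  have ht1 : 1 < t := hr.trans_le ht
  refine (radialEnergy_monotoneOn he hΔ (mem_Ioi.2 hr) (mem_Ioi.2 ht1) ht).trans ?_
  have := sphRad_le_sphGrad isOpen_outerDomain (he.of_le (by norm_num)) (smul_mem_outerDomain ht1)
  unfold radialEnergy derSq
  nlinarith [sq_nonneg t]

/-- Conservation of the flux: `k ‖F‖²` is the imaginary part of `r² ∫ conj(e) ∂_r e`. -/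
lemma im_flux_eq {r : ℝ} (hr : 1 < r) : r ^ 2 * (sphFlux e e r).im = k * l2Sq F := by
  obtain ⟨-, t2, -⟩ := tendsto_radiating (he.of_le (by norm_num)) hS hF
  have t3 := (Complex.continuous_im.tendsto _).comp t2
  have e1 : (Complex.I * k * l2Sq F).im = k * l2Sq F := by simp
  rw [e1] at t3
  refine tendsto_nhds_unique (f := fun _ : ℝ => r ^ 2 * (sphFlux e e r).im) (l := atTop)
    tendsto_const_nhds (t3.congr' ?_)
  filter_upwards [eventually_ge_atTop r] with t ht
  have hc : ∀ x ∈ Icc r t, (fun r => r ^ 2 * (sphFlux e e r).im) x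
      = (fun r => r ^ 2 * (sphFlux e e r).im) r :=
    constant_of_has_deriv_right_zero
      (fun x hx => (hasDerivAt_re_im_flux he hΔ
        (hr.trans_le hx.1)).2.continuousAt.continuousWithinAt)
      (fun x hx => (hasDerivAt_re_im_flux he hΔ (hr.trans_le hx.1)).2.hasDerivWithinAt)
  have := hc t ⟨ht, le_rfl⟩
  simp only [Function.comp]
  refine Eq.trans ?_ this
  simp [← Complex.ofReal_pow]

/-- **Coercivity of the exterior problem.** With `f(r) = r e(r ·)`, a radiating field satisfies
`Re ⟨f, f'⟩ ≤ ‖f‖² / 2 + 2 k² ‖F‖²`. The difference of both sides cannot start to grow, because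
`(Re ⟨f, f'⟩)' ≥ 2‖f'‖² - 2k²‖F‖²`, and at infinity it is nonpositive. -/
lemma re_inner_le {r : ℝ} (hr : 1 < r) :
    r * sphSq e r + r ^ 2 * (sphFlux e e r).re
      ≤ r ^ 2 * sphSq e r / 2 + 2 * k ^ 2 * l2Sq F := by
  have he1 : ContDiffOn ℝ 1 e outerDomain := he.of_le (by norm_num)
  obtain ⟨t1, t2, -⟩ := tendsto_radiating he1 hS hF
  have hM0 := l2Sq_nonneg F
  let p : ℝ → ℝ := fun r => (r * sphSq e r + r ^ 2 * (sphFlux e e r).re)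
    - (r ^ 2 * sphSq e r / 2 + 2 * k ^ 2 * l2Sq F)
  let p' : ℝ → ℝ := fun r => (2 * derSq e r - radialEnergy k e r)
    - (r * sphSq e r + r ^ 2 * (sphFlux e e r).re)
  have hd : ∀ r > 1, HasDerivAt p (p' r) r := by
    intro t ht
    have h1 := hasDerivAt_sphSq_outer he ht
    have h2 := (hasDerivAt_re_im_flux he hΔ ht).1
    have h5 := (((hasDerivAt_id t).mul h1).add h2).sub
      ((((hasDerivAt_pow 2 t).mul h1).div_const 2).add_const (2 * k ^ 2 * l2Sq F))
    refine (h5.congr_deriv ?_)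
    simp only [p', derSq, radialEnergy, id]
    push_cast
    ring
  have hpos : ∀ r > 1, 0 < p r → 0 ≤ p' r := by
    intro t ht hp
    have hcs := re_inner_sq_le isOpen_outerDomain he1 (smul_mem_outerDomain (mem_Ioi.2 ht))
    have hE := radialEnergy_le he hΔ hS hF ht
    have hsq := sphSq_nonneg e t
    simp only [p] at hp
    simp only [p']
    set Q := t * sphSq e t + t ^ 2 * (sphFlux e e t).re
    set M := t ^ 2 * sphSq e t
    have hM : 0 ≤ M := by positivity
    have hkF : 0 ≤ k ^ 2 * l2Sq F := by positivity
    have hQ : 0 < Q := by linarith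
    have hMpos : 0 < M := by
      rcases hM.lt_or_eq with h | h
      · exact h
      · rw [← h] at hcs; nlinarith
    have key : M * (Q + 2 * k ^ 2 * l2Sq F) ≤ M * (2 * derSq e t) := by
      nlinarith [mul_nonneg hkF hQ.le, mul_nonneg hkF hM]
    have := le_of_mul_le_mul_left key hMpos
    linarith
  have hlim : Tendsto p atTop (𝓝 (0 - (l2Sq F / 2 + 2 * k ^ 2 * l2Sq F))) := by
    have t3 := (Complex.continuous_re.tendsto _).comp t2
    have e1 : (Complex.I * k * l2Sq F).re = 0 := by simp
    rw [e1] at t3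
    refine (t3.sub ((t1.div_const 2).add_const (2 * k ^ 2 * l2Sq F))).congr fun r => ?_
    simp [p, ← Complex.ofReal_pow]
  have hl0 : 0 - (l2Sq F / 2 + 2 * k ^ 2 * l2Sq F) ≤ 0 := by
    have : 0 ≤ k ^ 2 * l2Sq F := by positivity
    linarith
  have := nonpos_of_deriv_nonneg_of_pos hd hpos hlim hl0 hr
  simp only [p] at this
  linarith

end Energy
end Radiating

/-! ### Exterior fields up to the boundary -/

section BoundaryLimits

/-- Boundary values are continuous and attained uniformly. The filter `l` describes how the radius
tends to `1`, from inside or from outside. -/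
lemma tendstoUniformly_boundary {G : Type*} [NormedAddCommGroup G]
    {D : Set E3} {l : Filter ℝ} [NeBot l] (hl : l ≤ 𝓝 1)
    (hlD : ∀ᶠ r in l, ∀ θ : S2, r • (θ : E3) ∈ D) {φ : E3 → G}
    {h : S2 → G} (hb : ∀ x : S2, Tendsto φ (𝓝[D] (x : E3)) (𝓝 (h x))) :
    Continuous h ∧ TendstoUniformly (fun (r : ℝ) (θ : S2) => φ (r • (θ : E3))) h l := by
  have hmap : ∀ θ : S2, Tendsto (fun p : ℝ × S2 => p.1 • (p.2 : E3)) (l ×ˢ 𝓝 θ)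
      (𝓝[D] (θ : E3)) := by
    intro θ
    refine tendsto_nhdsWithin_iff.2 ⟨?_, ?_⟩
    · have : Tendsto (fun p : ℝ × S2 => p.1 • (p.2 : E3)) (𝓝 1 ×ˢ 𝓝 θ) (𝓝 ((1 : ℝ) • (θ : E3))) := by
        rw [← nhds_prod_eq]
        exact Continuous.tendsto (by fun_prop) ((1, θ) : ℝ × S2)
      rw [one_smul] at this
      exact this.mono_left (prod_mono hl le_rfl)
    · filter_upwards [hlD.prod_inl (𝓝 θ)] with p hp using hp p.2
  have hcl : ∀ θ : S2, (θ : E3) ∈ closure D := fun θ =>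
    mem_closure_iff_nhdsWithin_neBot.2 ((hmap θ).neBot)
  have hcont : Continuous h := by
    have h1 : ContinuousOn (extendFrom D φ) (Metric.sphere (0 : E3) 1) := by
      refine continuousOn_extendFrom (fun x hx => hcl ⟨x, hx⟩) fun x hx => ⟨h ⟨x, hx⟩, hb ⟨x, hx⟩⟩
    have h2 : h = fun θ : S2 => extendFrom D φ θ := by
      funext θ
      exact (extendFrom_eq (hcl θ) (hb θ)).symm
    rw [h2]
    exact continuousOn_iff_continuous_domRestrict.1 h1
  refine ⟨hcont, ?_⟩
  rw [← tendstoLocallyUniformly_iff_tendstoUniformly_of_compactSpace,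
    tendstoLocallyUniformly_iff_forall_tendsto]
  intro θ
  have t1 : Tendsto (fun y : ℝ × S2 => h y.2) (l ×ˢ 𝓝 θ) (𝓝 (h θ)) :=
    (hcont.tendsto θ).comp tendsto_snd
  have t2 : Tendsto (fun y : ℝ × S2 => φ (y.1 • (y.2 : E3))) (l ×ˢ 𝓝 θ) (𝓝 (h θ)) :=
    (hb θ).comp (hmap θ)
  exact (t1.prodMk_nhds t2).mono_right (nhds_le_uniformity _)

/-- Spherical integrals with a continuous weight converge to those of the boundary values. -/
lemma tendsto_integral_boundary_mul {D : Set E3} {l : Filter ℝ} [NeBot l]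
    [l.IsCountablyGenerated] (hl : l ≤ 𝓝 1)
    (hlD : ∀ᶠ r in l, ∀ θ : S2, r • (θ : E3) ∈ D) {φ : E3 → ℂ} (hφ : ContinuousOn φ D)
    {h : S2 → ℂ} (hb : ∀ x : S2, Tendsto φ (𝓝[D] (x : E3)) (𝓝 (h x))) {w : S2 → ℂ}
    (hw : Continuous w) :
    Tendsto (fun r => ∫ θ : S2, φ (r • (θ : E3)) * w θ ∂surf) l (𝓝 (∫ θ, h θ * w θ ∂surf)) := by
  obtain ⟨hcont, hunif⟩ := tendstoUniformly_boundary hl hlD hb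
  obtain ⟨C, hC⟩ := isCompact_univ.exists_bound_of_continuousOn hcont.continuousOn
  refine tendsto_integral_filter_of_dominated_convergence (fun θ => (C + 1) * ‖w θ‖) ?_ ?_
    (integrable_sphere (continuous_const.mul hw.norm))
    (Eventually.of_forall fun θ => (hunif.tendsto_at θ).mul_const _)
  · filter_upwards [hlD] with r hr
    exact (integrable_sphere ((continuous_restrict_sphere hφ hr).mul hw)).aestronglyMeasurable
  · filter_upwards [Metric.tendstoUniformly_iff.1 hunif 1 one_pos] with r hr
    refine Eventually.of_forall fun θ => ?_
    have h1 := hr θ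
    rw [dist_comm, dist_eq_norm] at h1
    have h2 := norm_add_le (φ (r • (θ : E3)) - h θ) (h θ)
    rw [sub_add_cancel] at h2
    have h3 := hC θ (mem_univ _)
    rw [norm_mul]
    gcongr
    linarith

/-- Spherical integrals converge to the integral of the boundary values. -/
lemma tendsto_integral_boundary {G : Type*} [NormedAddCommGroup G] [NormedSpace ℝ G]
    {D : Set E3} {l : Filter ℝ} [NeBot l] [l.IsCountablyGenerated] (hl : l ≤ 𝓝 1)
    (hlD : ∀ᶠ r in l, ∀ θ : S2, r • (θ : E3) ∈ D) {φ : E3 → G} (hφ : ContinuousOn φ D)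
    {h : S2 → G} (hb : ∀ x : S2, Tendsto φ (𝓝[D] (x : E3)) (𝓝 (h x))) :
    Continuous h ∧ Tendsto (fun r => ∫ θ : S2, φ (r • (θ : E3)) ∂surf) l (𝓝 (∫ θ, h θ ∂surf)) := by
  obtain ⟨hcont, hunif⟩ := tendstoUniformly_boundary hl hlD hb
  refine ⟨hcont, ?_⟩
  obtain ⟨C, hC⟩ := isCompact_univ.exists_bound_of_continuousOn hcont.continuousOn
  refine tendsto_integral_filter_of_dominated_convergence (fun _ => C + 1) ?_ ?_
    (integrable_const _) (Eventually.of_forall fun θ => hunif.tendsto_at θ)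
  · filter_upwards [hlD] with r hr
    exact (integrable_restrict_sphere hφ hr).aestronglyMeasurable
  · filter_upwards [Metric.tendstoUniformly_iff.1 hunif 1 one_pos] with r hr
    refine Eventually.of_forall fun θ => ?_
    have h1 := hr θ
    rw [dist_comm, dist_eq_norm] at h1
    have h2 := norm_add_le (φ (r • (θ : E3)) - h θ) (h θ)
    rw [sub_add_cancel] at h2
    have h3 := hC θ (mem_univ _)
    linarith

lemma continuousOn_normalDeriv {u : E3 → ℂ} {D : Set E3} (hD : IsOpen D)
    (hu : ContDiffOn ℝ 1 u D) (h0 : ∀ x ∈ D, x ≠ 0) : ContinuousOn (normalDeriv u) D := by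
  unfold normalDeriv
  refine (hu.continuousOn_fderiv_of_isOpen hD le_rfl).clm_apply ?_
  refine ContinuousOn.smul (ContinuousOn.inv₀ continuous_norm.continuousOn ?_) continuousOn_id
  intro x hx
  simpa using h0 x hx

end BoundaryLimits

/-- A solution of `Δe + k² e = 0` outside the closed unit ball, with boundary values `g` and normal
derivative `p` on the unit sphere. -/
structure ExteriorField (k : ℝ) (e : E3 → ℂ) (g p : S2 → ℂ) : Prop where
  contDiffOn : ContDiffOn ℝ 2 e outerDomain
  laplacian : ∀ x ∈ outerDomain, Laplacian.laplacian e x = -(k : ℂ) ^ 2 * e x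
  value : HasBoundaryValue outerDomain e g
  deriv : HasBoundaryValue outerDomain (normalDeriv e) p

/-- The boundary pairing `∫ conj(g) p` over the unit sphere. -/
noncomputable def pairing (g p : S2 → ℂ) : ℂ := ∫ θ, conj (g θ) * p θ ∂surf

namespace ExteriorField

variable {k : ℝ} {e : E3 → ℂ} {g p : S2 → ℂ} {F : S2 → ℂ}

lemma eventually_mem : ∀ᶠ r in 𝓝[>] (1 : ℝ), ∀ θ : S2, r • (θ : E3) ∈ outerDomain := by
  filter_upwards [self_mem_nhdsWithin] with r hr using smul_mem_outerDomain hr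

lemma contDiffOn_one (h : ExteriorField k e g p) : ContDiffOn ℝ 1 e outerDomain :=
  h.contDiffOn.of_le (by norm_num)

lemma continuousOn_normalDeriv (h : ExteriorField k e g p) :
    ContinuousOn (normalDeriv e) outerDomain := by
  refine _root_.continuousOn_normalDeriv isOpen_outerDomain h.contDiffOn_one ?_
  rintro x hx rfl
  have : (1 : ℝ) < ‖(0 : E3)‖ := hx
  rw [norm_zero] at this
  linarith

lemma continuous_value (h : ExteriorField k e g p) : Continuous g :=
  (tendsto_integral_boundary nhdsWithin_le_nhds eventually_mem h.contDiffOn.continuousOn h.value).1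

lemma continuous_deriv (h : ExteriorField k e g p) : Continuous p :=
  (tendsto_integral_boundary nhdsWithin_le_nhds eventually_mem h.continuousOn_normalDeriv h.deriv).1

lemma tendsto_sphSq (h : ExteriorField k e g p) :
    Tendsto (sphSq e) (𝓝[>] 1) (𝓝 (l2Sq g)) :=
  (tendsto_integral_boundary (φ := fun x => ‖e x‖ ^ 2) nhdsWithin_le_nhds eventually_mem
    (h.contDiffOn.continuousOn.norm.pow 2) fun x => ((h.value x).norm.pow 2)).2

lemma tendsto_flux (h : ExteriorField k e g p) :
    Tendsto (sphFlux e e) (𝓝[>] 1) (𝓝 (pairing g p)) := by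
  have := (tendsto_integral_boundary (φ := fun x => conj (e x) * normalDeriv e x)
    nhdsWithin_le_nhds eventually_mem
    ((Complex.continuous_conj.comp_continuousOn h.contDiffOn.continuousOn).mul
      h.continuousOn_normalDeriv)
    fun x => ((Complex.continuous_conj.tendsto _).comp (h.value x)).mul (h.deriv x)).2
  refine this.congr' ?_
  filter_upwards [self_mem_nhdsWithin] with r hr
  have hr0 : 0 < r := zero_lt_one.trans hr
  simp only [normalDeriv_smul_sphere _ hr0]
  rfl

lemma tendsto_id_one : Tendsto (fun r : ℝ => r) (𝓝[>] 1) (𝓝 1) := nhdsWithin_le_nhds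

lemma tendsto_re_flux (h : ExteriorField k e g p) :
    Tendsto (fun r => r ^ 2 * (sphFlux e e r).re) (𝓝[>] 1) (𝓝 (pairing g p).re) := by
  have h1 := (Complex.continuous_re.tendsto _).comp h.tendsto_flux
  simpa using (tendsto_id_one.pow 2).mul h1

/-- The far-field pattern of a radiating field is controlled by the flux through the sphere. -/
lemma im_pairing (h : ExteriorField k e g p) (hS : Sommerfeld k e) (hF : IsFarFieldPattern k e F) :
    (pairing g p).im = k * l2Sq F := by
  have h1 := (Complex.continuous_im.tendsto _).comp h.tendsto_flux
  have h2 : Tendsto (fun r => r ^ 2 * (sphFlux e e r).im) (𝓝[>] 1) (𝓝 (pairing g p).im) := by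
    simpa using (tendsto_id_one.pow 2).mul h1
  refine tendsto_nhds_unique h2 (tendsto_const_nhds.congr' ?_)
  filter_upwards [self_mem_nhdsWithin] with r hr
  exact (im_flux_eq h.contDiffOn h.laplacian hS hF hr).symm

lemma re_pairing_le (h : ExteriorField k e g p) (hS : Sommerfeld k e)
    (hF : IsFarFieldPattern k e F) :
    (pairing g p).re ≤ -(l2Sq g / 2) + 2 * k * (pairing g p).im := by
  have h1 := (tendsto_id_one.mul h.tendsto_sphSq).add h.tendsto_re_flux
  have h2 := (((tendsto_id_one.pow 2).mul h.tendsto_sphSq).div_const 2).add_const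
    (2 * k ^ 2 * l2Sq F)
  have h3 := le_of_tendsto_of_tendsto h1 h2 (by
    filter_upwards [self_mem_nhdsWithin] with r hr
    exact re_inner_le h.contDiffOn h.laplacian hS hF hr)
  rw [h.im_pairing hS hF]
  linarith

lemma integral_grad_eq (h : ExteriorField k e g p) {a b : ℝ} (ha : 1 < a) (hab : a ≤ b) :
    ∫ r in a..b, r ^ 2 * sphGrad e r = b ^ 2 * (sphFlux e e b).re - a ^ 2 * (sphFlux e e a).re
      + ∫ r in a..b, k ^ 2 * (r ^ 2 * sphSq e r) := by
  have hsub : uIcc a b ⊆ Ioi 1 := by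
    rw [uIcc_of_le hab]; exact fun x hx => ha.trans_le hx.1
  have c1 : ContinuousOn (fun r => r ^ 2 * sphGrad e r) (uIcc a b) :=
    (continuousOn_id.pow 2).mul ((continuousOn_sphGrad isOpen_outerDomain h.contDiffOn_one
      (fun r hr => smul_mem_outerDomain hr)).mono hsub)
  have c2 : ContinuousOn (fun r => k ^ 2 * (r ^ 2 * sphSq e r)) (uIcc a b) :=
    continuousOn_const.mul ((continuousOn_id.pow 2).mul ((continuousOn_sphSq
      h.contDiffOn.continuousOn (fun r hr => smul_mem_outerDomain hr)).mono hsub))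
  have key := intervalIntegral.integral_eq_sub_of_hasDerivAt
    (fun r hr => (hasDerivAt_re_im_flux h.contDiffOn h.laplacian (hsub hr)).1)
    (ContinuousOn.intervalIntegrable (by
      refine (c1.sub c2).congr fun r _ => ?_
      simp only [Pi.sub_apply]; ring))
  rw [← key, ← intervalIntegral.integral_add]
  · refine intervalIntegral.integral_congr fun r _ => ?_
    ring
  · refine ContinuousOn.intervalIntegrable ((c1.sub c2).congr fun r _ => ?_)
    simp only [Pi.sub_apply]; ring
  · exact c2.intervalIntegrable

/-- A bound of the Dirichlet integral in a shell, up to the boundary. -/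
lemma integral_grad_le (h : ExteriorField k e g p) {b S : ℝ}
    (hS : ∀ r, 1 < r → r ≤ b → r ^ 2 * sphSq e r ≤ S) {a : ℝ} (ha : 1 < a) (hab : a ≤ b) :
    ∫ r in a..b, r ^ 2 * sphGrad e r
      ≤ b ^ 2 * (sphFlux e e b).re - (pairing g p).re + k ^ 2 * ((b - 1) * S) := by
  have hS0 : 0 ≤ S := by
    have := hS a ha hab
    have h2 := sphSq_nonneg e a
    have : 0 ≤ a ^ 2 * sphSq e a := by positivity
    linarith
  have hlim := (h.tendsto_re_flux.const_sub (b ^ 2 * (sphFlux e e b).re)).add_const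
    (k ^ 2 * ((b - 1) * S))
  refine ge_of_tendsto hlim ?_
  filter_upwards [Ioo_mem_nhdsGT ha] with t ht
  have c1 : ContinuousOn (fun r => r ^ 2 * sphGrad e r) (Ioi 1) :=
    (continuousOn_id.pow 2).mul (continuousOn_sphGrad isOpen_outerDomain h.contDiffOn_one
      (fun r hr => smul_mem_outerDomain hr))
  have c2 : ContinuousOn (fun r => k ^ 2 * (r ^ 2 * sphSq e r)) (Ioi 1) :=
    continuousOn_const.mul ((continuousOn_id.pow 2).mul (continuousOn_sphSq
      h.contDiffOn.continuousOn (fun r hr => smul_mem_outerDomain hr)))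
  have hsub : ∀ {x y : ℝ}, 1 < x → x ≤ y → uIcc x y ⊆ Ioi 1 := by
    intro x y hx hxy
    rw [uIcc_of_le hxy]; exact fun z hz => hx.trans_le hz.1
  have hadd := intervalIntegral.integral_add_adjacent_intervals
    (c1.mono (hsub ht.1 ht.2.le)).intervalIntegrable (c1.mono (hsub ha hab)).intervalIntegrable
    (μ := volume)
  have hnn : 0 ≤ ∫ r in t..a, r ^ 2 * sphGrad e r :=
    intervalIntegral.integral_nonneg ht.2.le fun r _ => by
      have := sphGrad_nonneg e r
      positivity
  have htb : t ≤ b := ht.2.le.trans hab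
  have heq := h.integral_grad_eq ht.1 htb
  have hmass : ∫ r in t..b, k ^ 2 * (r ^ 2 * sphSq e r) ≤ k ^ 2 * ((b - 1) * S) := by
    calc _ ≤ ∫ r in t..b, k ^ 2 * S := by
          refine intervalIntegral.integral_mono_on htb
            (c2.mono (hsub ht.1 htb)).intervalIntegrable intervalIntegrable_const fun r hr => ?_
          have := hS r (ht.1.trans_le hr.1) hr.2
          gcongr
      _ = k ^ 2 * ((b - t) * S) := by rw [intervalIntegral.integral_const, smul_eq_mul]; ring
      _ ≤ _ := by
          have := ht.1.le
          gcongr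
  linarith

/-- Local bounds in the shell `1 < |x| ≤ 2`. -/
lemma exists_local_bound (h : ExteriorField k e g p) :
    ∃ K : ℝ, 0 ≤ K ∧ (∀ r, 1 < r → r ≤ 2 → sphSq e r ≤ K) ∧
      ∀ a, 1 < a → a ≤ 2 → ∫ r in a..2, r ^ 2 * sphGrad e r ≤ K := by
  obtain ⟨η, hη, hb⟩ : ∃ η > (1 : ℝ), ∀ r, 1 < r → r < η → sphSq e r ≤ l2Sq g + 1 := by
    have := h.tendsto_sphSq.eventually (gt_mem_nhds (lt_add_one (l2Sq g)))
    rw [eventually_iff, mem_nhdsGT_iff_exists_Ioo_subset] at this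
    obtain ⟨η, hη, hsub⟩ := this
    exact ⟨η, hη, fun r h1 h2 => le_of_lt (hsub ⟨h1, h2⟩)⟩
  have c2 : ContinuousOn (sphSq e) (Ioi 1) := continuousOn_sphSq
      h.contDiffOn.continuousOn (fun r hr => smul_mem_outerDomain hr)
  obtain ⟨C, hC⟩ := (isCompact_Icc (a := η) (b := 2)).exists_bound_of_continuousOn
    (c2.mono fun x hx => mem_Ioi.2 (lt_of_lt_of_le hη hx.1))
  have hb2 : ∀ r, 1 < r → r ≤ 2 → sphSq e r ≤ l2Sq g + 1 + |C| := by
    intro r h1 h2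
    rcases lt_or_ge r η with h3 | h3
    · have := hb r h1 h3
      have := abs_nonneg C
      linarith
    · have h4 := hC r ⟨h3, h2⟩
      have h5 := le_abs_self (sphSq e r)
      have h6 := le_abs_self C
      have h7 := l2Sq_nonneg g
      rw [Real.norm_eq_abs] at h4
      linarith
  set S := l2Sq g + 1 + |C| with hS
  have hS0 : 0 ≤ S := by
    have h7 := l2Sq_nonneg g
    positivity
  have hS4 : ∀ r, 1 < r → r ≤ 2 → r ^ 2 * sphSq e r ≤ 4 * S := by
    intro r h1 h2
    have h3 := hb2 r h1 h2
    have h4 := sphSq_nonneg e r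
    have : r ^ 2 ≤ 4 := by nlinarith
    nlinarith
  refine ⟨max S (2 ^ 2 * (sphFlux e e 2).re - (pairing g p).re + k ^ 2 * ((2 - 1) * (4 * S))),
    le_max_of_le_left hS0, fun r h1 h2 => le_max_of_le_left (hb2 r h1 h2),
    fun a h1 h2 => le_max_of_le_right (h.integral_grad_le hS4 h1 h2)⟩

/-- Local bounds of a radiating field in the shell `1 < |x| ≤ 2` by its flux through the sphere. -/
lemma local_bound_of_radiating (hk : 0 < k) (h : ExteriorField k e g p) (hS : Sommerfeld k e)
    (hF : IsFarFieldPattern k e F) :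
    (∀ r, 1 < r → r ≤ 2 → sphSq e r ≤ (100 * (1 + k) ^ 3) * ‖pairing g p‖) ∧
      ∀ a, 1 < a → a ≤ 2 →
        ∫ r in a..2, r ^ 2 * sphGrad e r ≤ (100 * (1 + k) ^ 3) * ‖pairing g p‖ := by
  set J := ‖pairing g p‖ with hJ
  have hJ0 : 0 ≤ J := norm_nonneg _
  have hre : |(pairing g p).re| ≤ J := Complex.abs_re_le_norm _
  have him : |(pairing g p).im| ≤ J := Complex.abs_im_le_norm _
  have hM := l2Sq_nonneg F
  have hkF : k * l2Sq F ≤ J := by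
    rw [← h.im_pairing hS hF]; exact (le_abs_self _).trans him
  have hkF2 : 2 * k ^ 2 * l2Sq F ≤ 2 * k * J := by nlinarith
  have hg : l2Sq g ≤ (2 + 4 * k) * J := by
    have h1 := h.re_pairing_le hS hF
    have h2 := neg_abs_le (pairing g p).re
    have h3 := le_abs_self (pairing g p).im
    nlinarith
  let c := 4 * k ^ 2 * l2Sq F
  have hc0 : 0 ≤ c := by positivity
  -- Gronwall: `M = r² ∫ |e|²` satisfies `M' ≤ M + 4 k² ‖F‖²`
  have hanti : AntitoneOn (fun r => (r ^ 2 * sphSq e r + c) * Real.exp (-r)) (Ioi 1) := by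
    have hd : ∀ r > 1, HasDerivAt (fun r => (r ^ 2 * sphSq e r + c) * Real.exp (-r))
        ((2 * (r * sphSq e r + r ^ 2 * (sphFlux e e r).re) - (r ^ 2 * sphSq e r + c))
          * Real.exp (-r)) r := by
      intro r hr
      have h1 := hasDerivAt_sphSq_outer h.contDiffOn hr
      have h2 := ((((hasDerivAt_pow 2 r).mul h1).add_const c).mul (hasDerivAt_neg r).exp)
      refine h2.congr_deriv ?_
      simp only [Pi.mul_apply]
      push_cast
      ring
    refine antitoneOn_of_deriv_nonpos (convex_Ioi 1)
      (fun t ht => (hd t ht).continuousAt.continuousWithinAt)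
      (fun t ht => (hd t (interior_subset ht)).differentiableAt.differentiableWithinAt) ?_
    intro t ht
    have ht' : 1 < t := interior_subset ht
    rw [(hd t ht').deriv]
    have h1 := re_inner_le h.contDiffOn h.laplacian hS hF ht'
    refine mul_nonpos_of_nonpos_of_nonneg ?_ (Real.exp_pos _).le
    simp only [c]
    linarith
  have hMr : ∀ r, 1 < r → r ≤ 2 → r ^ 2 * sphSq e r ≤ 3 * ((2 + 8 * k) * J) := by
    intro r h1 h2
    have hlim : Tendsto (fun r => (r ^ 2 * sphSq e r + c) * Real.exp (-r)) (𝓝[>] 1)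
        (𝓝 ((1 ^ 2 * l2Sq g + c) * Real.exp (-1))) :=
      (((tendsto_id_one.pow 2).mul h.tendsto_sphSq).add_const c).mul
        ((Real.continuous_exp.comp continuous_neg).continuousAt.tendsto.comp tendsto_id_one)
    have hle : (r ^ 2 * sphSq e r + c) * Real.exp (-r)
        ≤ (1 ^ 2 * l2Sq g + c) * Real.exp (-1) := by
      refine ge_of_tendsto hlim ?_
      filter_upwards [Ioo_mem_nhdsGT h1] with t ht
      exact hanti (mem_Ioi.2 ht.1) (mem_Ioi.2 h1) ht.2.le
    have hexp : Real.exp (-1) ≤ Real.exp (-r) * 3 := by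
      have : Real.exp (-1) = Real.exp (-r) * Real.exp (r - 1) := by
        rw [← Real.exp_add]; congr 1; ring
      rw [this]
      have h4 : Real.exp (r - 1) ≤ Real.exp 1 := Real.exp_le_exp.2 (by linarith)
      have h5 := Real.exp_one_lt_d9
      have := Real.exp_pos (-r)
      nlinarith
    have hpos := Real.exp_pos (-r)
    have hgc : 0 ≤ 1 ^ 2 * l2Sq g + c := by have := l2Sq_nonneg g; positivity
    have : (r ^ 2 * sphSq e r + c) * Real.exp (-r)
        ≤ (3 * (1 ^ 2 * l2Sq g + c)) * Real.exp (-r) := by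
      refine hle.trans ?_
      nlinarith
    have := le_of_mul_le_mul_right this hpos
    simp only [c] at this hc0
    nlinarith
  have hk1 : 3 * ((2 + 8 * k) * J) ≤ (100 * (1 + k) ^ 3) * J := by
    have : 3 * (2 + 8 * k) ≤ 100 * (1 + k) ^ 3 := by
      nlinarith [pow_pos hk 2, pow_pos hk 3]
    nlinarith
  refine ⟨fun r h1 h2 => ?_, fun a h1 h2 => ?_⟩
  · have h3 := hMr r h1 h2
    have h4 := sphSq_nonneg e r
    have h5 : 1 * sphSq e r ≤ r ^ 2 * sphSq e r := by
      gcongr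
      nlinarith
    linarith
  · refine (h.integral_grad_le hMr h1 h2).trans ?_
    have h3 := re_inner_le h.contDiffOn h.laplacian hS hF (one_lt_two)
    have h4 := hMr 2 one_lt_two le_rfl
    have h5 := sphSq_nonneg e 2
    have h6 := neg_abs_le (pairing g p).re
    have h7 : 2 ^ 2 * (sphFlux e e 2).re - (pairing g p).re + k ^ 2 * ((2 - 1) * (3 * ((2 + 8 * k) * J)))
        ≤ (3 / 2 * (2 + 8 * k) + 2 * k + 1 + k ^ 2 * (3 * (2 + 8 * k))) * J := by
      nlinarith
    refine h7.trans (mul_le_mul_of_nonneg_right ?_ hJ0)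
    nlinarith [pow_pos hk 2, pow_pos hk 3]

end ExteriorField

/-! ### Energy, mass and mean in the ball -/

section IntervalLemmas

/-- Cauchy–Schwarz for interval integrals. -/
lemma sq_integral_le_mul {a b : ℝ} (hab : a ≤ b) {x f g : ℝ → ℝ} (hx : ContinuousOn x (Icc a b))
    (hf : ContinuousOn f (Icc a b)) (hg : ContinuousOn g (Icc a b))
    (hf0 : ∀ t ∈ Icc a b, 0 ≤ f t) (hg0 : ∀ t ∈ Icc a b, 0 ≤ g t)
    (h : ∀ t ∈ Icc a b, x t ^ 2 ≤ f t * g t) :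
    (∫ t in a..b, x t) ^ 2 ≤ (∫ t in a..b, f t) * ∫ t in a..b, g t := by
  rw [← uIcc_of_le hab] at hx hf hg
  have ix := hx.intervalIntegrable (μ := volume)
  have iF := hf.intervalIntegrable (μ := volume)
  have ig := hg.intervalIntegrable (μ := volume)
  have key : ∀ m : ℝ, 0 ≤ (∫ t in a..b, f t) * (m * m) + (2 * ∫ t in a..b, x t) * m
      + ∫ t in a..b, g t := by
    intro m
    have : (∫ t in a..b, f t) * (m * m) + (2 * ∫ t in a..b, x t) * m + ∫ t in a..b, g t
        = ∫ t in a..b, (f t * (m * m) + (2 * x t) * m + g t) := by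
      rw [intervalIntegral.integral_add ((iF.mul_const _).add ((ix.const_mul 2).mul_const _)) ig,
        intervalIntegral.integral_add (iF.mul_const _) ((ix.const_mul 2).mul_const _),
        intervalIntegral.integral_mul_const, intervalIntegral.integral_mul_const,
        intervalIntegral.integral_const_mul]
    rw [this]
    refine intervalIntegral.integral_nonneg hab fun t ht => ?_
    have h1 := h t ht
    rcases (hf0 t ht).lt_or_eq with h2 | h2
    · have : 0 ≤ f t * (f t * (m * m) + (2 * x t) * m + g t) := by
        nlinarith [sq_nonneg (f t * m + x t)]
      exact nonneg_of_mul_nonneg_right this h2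
    · rw [← h2, zero_mul] at h1
      have : x t = 0 := by nlinarith
      rw [← h2, this]
      simpa using hg0 t ht
  have := discrim_le_zero key
  unfold discrim at this
  linarith

/-- The primitive of a continuous function which has a limit at the right end point converges. -/
lemma exists_tendsto_primitive {G : Type*} [NormedAddCommGroup G] [NormedSpace ℝ G]
    [CompleteSpace G] {φ : ℝ → G} {L : G} (hφ : ContinuousOn φ (Ico 0 1))
    (hL : Tendsto φ (𝓝[<] 1) (𝓝 L)) :
    ∃ l : G, Tendsto (fun s => ∫ t in (0 : ℝ)..s, φ t) (𝓝[<] 1) (𝓝 l) := by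
  have hc : ContinuousOn (Function.update φ 1 L) (Icc 0 1) := by
    intro x hx
    rcases hx.2.lt_or_eq with h | rfl
    · have h1 : ContinuousWithinAt φ (Icc 0 1) x := by
        refine (hφ x ⟨hx.1, h⟩).mono_of_mem_nhdsWithin ?_
        filter_upwards [self_mem_nhdsWithin, mem_nhdsWithin_of_mem_nhds (Iio_mem_nhds h)]
          with y hy hy2 using ⟨hy.1, hy2⟩
      refine h1.congr_of_eventuallyEq ?_ (Function.update_of_ne h.ne _ _)
      filter_upwards [mem_nhdsWithin_of_mem_nhds (Iio_mem_nhds h)] with y hy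
      exact Function.update_of_ne (ne_of_lt hy) _ _
    · rw [continuousWithinAt_update_same]
      refine hL.mono_left (nhdsWithin_mono _ ?_)
      rintro y ⟨hy, hy1⟩
      exact lt_of_le_of_ne hy.2 hy1
  have hi : IntegrableOn (Function.update φ 1 L) (uIcc 0 1) := by
    rw [uIcc_of_le zero_le_one]
    exact hc.integrableOn_compact isCompact_Icc
  have h1 := intervalIntegral.continuousOn_primitive_interval hi
  have h2 := (h1 1 right_mem_uIcc).tendsto
  refine ⟨∫ t in (0 : ℝ)..1, Function.update φ 1 L t, ?_⟩
  have h3 : Tendsto (fun s => ∫ t in (0 : ℝ)..s, Function.update φ 1 L t) (𝓝[<] 1)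
      (𝓝 (∫ t in (0 : ℝ)..1, Function.update φ 1 L t)) := by
    refine h2.mono_left ?_
    rw [uIcc_of_le zero_le_one]
    refine nhdsWithin_le_iff.2 ?_
    filter_upwards [Ioo_mem_nhdsLT (zero_lt_one' ℝ)] with x hx using ⟨hx.1.le, hx.2.le⟩
  refine h3.congr' ?_
  filter_upwards [Ioo_mem_nhdsLT (zero_lt_one' ℝ)] with s hs
  refine intervalIntegral.integral_congr fun t ht => ?_
  rw [uIcc_of_le hs.1.le] at ht
  exact Function.update_of_ne (ht.2.trans_lt hs.2).ne _ _

end IntervalLemmas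

/-- A solution of `Δu = lam u` in the open unit ball, with boundary values `g` and normal
derivative `q` on the unit sphere. -/
structure InteriorField (lam : ℂ) (u : E3 → ℂ) (g q : S2 → ℂ) : Prop where
  contDiffOn : ContDiffOn ℝ 2 u innerDomain
  laplacian : ∀ x ∈ innerDomain, Laplacian.laplacian u x = lam * u x
  value : HasBoundaryValue innerDomain u g
  deriv : HasBoundaryValue innerDomain (normalDeriv u) q

/-- The Dirichlet integral of `u` over the ball of radius `s`. -/
noncomputable def energyIn (u : E3 → ℂ) (s : ℝ) : ℝ := ∫ t in (0 : ℝ)..s, t ^ 2 * sphGrad u t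

/-- The integral of `|u|²` over the ball of radius `s`. -/
noncomputable def massIn (u : E3 → ℂ) (s : ℝ) : ℝ := ∫ t in (0 : ℝ)..s, t ^ 2 * sphSq u t

/-- The integral of `u` over the ball of radius `s`. -/
noncomputable def meanIn (u : E3 → ℂ) (s : ℝ) : ℂ := ∫ t in (0 : ℝ)..s, (t : ℂ) ^ 2 * sphInt u t

/-- The total mass of the surface measure. -/
noncomputable def sphMass : ℝ := surf.real univ

lemma sphMass_nonneg : 0 ≤ sphMass := measureReal_nonneg

lemma norm_integral_sphere_sq_le {f : S2 → ℂ} (hf : Continuous f) :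
    ‖∫ θ, f θ ∂surf‖ ^ 2 ≤ sphMass * l2Sq f := by
  have := norm_integral_conj_mul_sq_le (f := fun _ => 1) continuous_const hf
  simpa [sphMass, l2Sq] using this

lemma smul_mem_innerDomain {r : ℝ} (hr : r ∈ Ioo (-1 : ℝ) 1) (θ : S2) :
    r • (θ : E3) ∈ innerDomain := by
  change ‖r • (θ : E3)‖ < 1
  rw [norm_smul, norm_sphere, mul_one, Real.norm_eq_abs]
  exact abs_lt.2 hr

lemma tendsto_id_one_left : Tendsto (fun r : ℝ => r) (𝓝[<] 1) (𝓝 1) := nhdsWithin_le_nhds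

lemma Icc_subset_Ioo_neg {s : ℝ} (hs : s < 1) : Icc 0 s ⊆ Ioo (-1 : ℝ) 1 :=
  fun _ hx => ⟨by linarith [hx.1], hx.2.trans_lt hs⟩

section ShiftedField

variable {u : E3 → ℂ} {D : Set E3}

lemma fderiv_shift (u : E3 → ℂ) (c : ℂ) (x : E3) :
    fderiv ℝ (fun y => u y - c) x = fderiv ℝ u x := by
  rw [fderiv_sub_const]

lemma gradSq_shift (u : E3 → ℂ) (c : ℂ) : gradSq (fun y => u y - c) = gradSq u := by
  funext x
  simp only [gradSq, pd, fderiv_shift]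

lemma sphGrad_shift (u : E3 → ℂ) (c : ℂ) : sphGrad (fun y => u y - c) = sphGrad u := by
  funext x
  simp only [sphGrad, gradSq_shift]

lemma energyIn_shift (u : E3 → ℂ) (c : ℂ) : energyIn (fun y => u y - c) = energyIn u := by
  funext x
  simp only [energyIn, sphGrad_shift]

end ShiftedField

section BallIdentities

variable {v : E3 → ℂ}

lemma continuousOn_sphSq_inner (hv : ContinuousOn v innerDomain) :
    ContinuousOn (sphSq v) (Ioo (-1) 1) :=
  continuousOn_sphSq hv fun _ hr => smul_mem_innerDomain hr

lemma continuousOn_sphGrad_inner (hv : ContDiffOn ℝ 1 v innerDomain) :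
    ContinuousOn (sphGrad v) (Ioo (-1) 1) :=
  continuousOn_sphGrad isOpen_innerDomain hv fun _ hr => smul_mem_innerDomain hr

/-- The trace inequality for the ball of radius `s`. -/
lemma trace_le (hv : ContDiffOn ℝ 1 v innerDomain) {s : ℝ} (hs0 : 0 ≤ s) (hs : s < 1) :
    s ^ 3 * sphSq v s ≤ energyIn v s + 4 * massIn v s := by
  have hsub := Icc_subset_Ioo_neg hs
  have hmem : ∀ r ∈ Ioo (-1 : ℝ) 1, ∀ θ : S2, r • (θ : E3) ∈ innerDomain :=
    fun _ hr => smul_mem_innerDomain hr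
  have cS := (continuousOn_sphSq_inner hv.continuousOn).mono hsub
  have cG := (continuousOn_sphGrad_inner hv).mono hsub
  have cF : ContinuousOn (sphFlux v v) (Ioo (-1) 1) := by
    refine continuousOn_sphere_integral ?_
    refine ContinuousOn.mul (Complex.continuous_conj.comp_continuousOn
      (hv.continuousOn.comp (f := fun p : ℝ × S2 => p.1 • (p.2 : E3)) (by fun_prop)
        (fun p hp => hmem p.1 hp.1 p.2))) ?_
    exact ((hv.continuousOn_fderiv_of_isOpen isOpen_innerDomain le_rfl).comp
      (f := fun p : ℝ × S2 => p.1 • (p.2 : E3)) (by fun_prop)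
        (fun p hp => hmem p.1 hp.1 p.2)).clm_apply (by fun_prop)
  have cR : ContinuousOn (fun t => (sphFlux v v t).re) (Icc 0 s) :=
    Complex.continuous_re.comp_continuousOn (cF.mono hsub)
  have hd : ∀ t ∈ uIcc 0 s, HasDerivAt (fun t => t ^ 3 * sphSq v t)
      (3 * t ^ 2 * sphSq v t + t ^ 3 * (2 * (sphFlux v v t).re)) t := by
    intro t ht
    rw [uIcc_of_le hs0] at ht
    have h1 := hasDerivAt_sphSq isOpen_innerDomain hv isOpen_Ioo hmem (hsub ht)
    have h2 := (hasDerivAt_pow 3 t).mul h1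
    refine h2.congr_deriv ?_
    push_cast
    ring
  have c1 : ContinuousOn (fun t => 3 * t ^ 2 * sphSq v t + t ^ 3 * (2 * (sphFlux v v t).re))
      (Icc 0 s) :=
    ((continuousOn_const.mul (continuousOn_id.pow 2)).mul cS).add
      ((continuousOn_id.pow 3).mul (continuousOn_const.mul cR))
  have c2 : ContinuousOn (fun t => t ^ 2 * sphGrad v t) (Icc 0 s) := (continuousOn_id.pow 2).mul cG
  have c3 : ContinuousOn (fun t => 4 * (t ^ 2 * sphSq v t)) (Icc 0 s) :=
    continuousOn_const.mul ((continuousOn_id.pow 2).mul cS)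
  rw [← uIcc_of_le hs0] at c1 c2 c3
  have key := intervalIntegral.integral_eq_sub_of_hasDerivAt hd c1.intervalIntegrable
  have h0 : s ^ 3 * sphSq v s = ∫ t in (0 : ℝ)..s,
      (3 * t ^ 2 * sphSq v t + t ^ 3 * (2 * (sphFlux v v t).re)) := by
    rw [key]; simp
  rw [h0, energyIn, massIn, ← intervalIntegral.integral_const_mul, ← intervalIntegral.integral_add
    c2.intervalIntegrable c3.intervalIntegrable]
  refine intervalIntegral.integral_mono_on hs0 c1.intervalIntegrable
    (c2.add c3).intervalIntegrable fun t ht => ?_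
  have ht1 : t ≤ 1 := ht.2.trans hs.le
  have h1 := norm_sphFlux_sq_le isOpen_innerDomain hv.continuousOn hv (hmem t (hsub ht))
  have h2 := sphRad_le_sphGrad isOpen_innerDomain hv (hmem t (hsub ht))
  have h3 := sphSq_nonneg v t
  have h4 := sphRad_nonneg v t
  have h5 : (sphFlux v v t).re ≤ ‖sphFlux v v t‖ := Complex.re_le_norm _
  have h6 : 2 * ‖sphFlux v v t‖ ≤ sphSq v t + sphRad v t := by
    have h7 : (2 * ‖sphFlux v v t‖) ^ 2 ≤ (sphSq v t + sphRad v t) ^ 2 := by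
      nlinarith [sq_nonneg (sphSq v t - sphRad v t)]
    exact le_of_sq_le_sq h7 (by positivity)
  have h8 : 2 * (sphFlux v v t).re ≤ sphSq v t + sphGrad v t := by linarith
  have h9 : t ^ 3 * (2 * (sphFlux v v t).re) ≤ t ^ 3 * (sphSq v t + sphGrad v t) :=
    mul_le_mul_of_nonneg_left h8 (pow_nonneg ht.1 3)
  have h10 : t ^ 3 * (sphSq v t + sphGrad v t) ≤ t ^ 2 * (sphSq v t + sphGrad v t) := by
    have := sphGrad_nonneg v t
    refine mul_le_mul_of_nonneg_right ?_ (by positivity)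
    exact pow_le_pow_of_le_one ht.1 ht1 (by norm_num)
  change _ ≤ t ^ 2 * sphGrad v t + 4 * (t ^ 2 * sphSq v t)
  nlinarith

/-- The means over the sphere and over the ball differ by a multiple of the energy. -/
lemma norm_mean_sub_sq_le (hv : ContDiffOn ℝ 1 v innerDomain) {s : ℝ} (hs0 : 0 ≤ s) (hs : s < 1) :
    ‖(s : ℂ) ^ 3 * sphInt v s - 3 * meanIn v s‖ ^ 2 ≤ sphMass * energyIn v s := by
  have hsub := Icc_subset_Ioo_neg hs
  have hmem : ∀ r ∈ Ioo (-1 : ℝ) 1, ∀ θ : S2, r • (θ : E3) ∈ innerDomain :=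
    fun _ hr => smul_mem_innerDomain hr
  have cI : ContinuousOn (sphInt v) (Icc 0 s) := (continuousOn_sphInt hv.continuousOn hmem).mono hsub
  have cG := (continuousOn_sphGrad_inner hv).mono hsub
  let w : ℝ → ℂ := fun t => ∫ θ : S2, fderiv ℝ v (t • (θ : E3)) θ ∂surf
  have cW : ContinuousOn w (Icc 0 s) := by
    refine ContinuousOn.mono (continuousOn_sphere_integral ?_) hsub
    exact ((hv.continuousOn_fderiv_of_isOpen isOpen_innerDomain le_rfl).comp
      (f := fun p : ℝ × S2 => p.1 • (p.2 : E3)) (by fun_prop)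
        (fun p hp => hmem p.1 hp.1 p.2)).clm_apply (by fun_prop)
  have cid : ContinuousOn (fun t : ℝ => (t : ℂ)) (Icc 0 s) :=
    Complex.continuous_ofReal.continuousOn
  have hd : ∀ t ∈ uIcc 0 s, HasDerivAt (fun t : ℝ => (t : ℂ) ^ 3 * sphInt v t)
      (3 * ((t : ℂ) ^ 2 * sphInt v t) + (t : ℂ) ^ 3 * w t) t := by
    intro t ht
    rw [uIcc_of_le hs0] at ht
    have h1 := hasDerivAt_sphInt isOpen_innerDomain hv isOpen_Ioo hmem (hsub ht)
    have h2 := ((hasDerivAt_id t).ofReal_comp.pow 3).mul h1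
    refine h2.congr_deriv ?_
    simp [w]
    ring
  have c1 : ContinuousOn (fun t : ℝ => 3 * ((t : ℂ) ^ 2 * sphInt v t)) (uIcc 0 s) := by
    rw [uIcc_of_le hs0]; exact continuousOn_const.mul ((cid.pow 2).mul cI)
  have c2 : ContinuousOn (fun t : ℝ => (t : ℂ) ^ 3 * w t) (uIcc 0 s) := by
    rw [uIcc_of_le hs0]; exact (cid.pow 3).mul cW
  have key := intervalIntegral.integral_eq_sub_of_hasDerivAt hd (c1.add c2).intervalIntegrable
  rw [intervalIntegral.integral_add c1.intervalIntegrable c2.intervalIntegrable,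
    intervalIntegral.integral_const_mul] at key
  have e1 : (s : ℂ) ^ 3 * sphInt v s - 3 * meanIn v s = ∫ t in (0 : ℝ)..s, (t : ℂ) ^ 3 * w t := by
    unfold meanIn
    simp at key
    rw [← key]; ring
  rw [e1]
  have h1 : ‖∫ t in (0 : ℝ)..s, (t : ℂ) ^ 3 * w t‖ ≤ ∫ t in (0 : ℝ)..s, t ^ 3 * ‖w t‖ := by
    refine (intervalIntegral.norm_integral_le_integral_norm hs0).trans (le_of_eq ?_)
    refine intervalIntegral.integral_congr fun t ht => ?_
    rw [uIcc_of_le hs0] at ht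
    simp [abs_of_nonneg ht.1]
  have h2 := sq_integral_le_mul hs0 (x := fun t => t ^ 3 * ‖w t‖) (f := fun t => sphMass)
    (g := fun t => t ^ 2 * sphGrad v t) ((continuousOn_id.pow 3).mul cW.norm) continuousOn_const
    ((continuousOn_id.pow 2).mul cG) (fun _ _ => sphMass_nonneg)
    (fun t _ => by have := sphGrad_nonneg v t; positivity) (fun t ht => by
      have h3 := norm_integral_sphere_sq_le
        (continuous_radial_deriv isOpen_innerDomain hv (hmem t (hsub ht)))
      have h4 := sphRad_le_sphGrad isOpen_innerDomain hv (hmem t (hsub ht))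
      have h5 : ‖w t‖ ^ 2 ≤ sphMass * sphGrad v t :=
        h3.trans (mul_le_mul_of_nonneg_left h4 sphMass_nonneg)
      have ht1 : t ≤ 1 := ht.2.trans hs.le
      have h6 : (t ^ 3) ^ 2 ≤ t ^ 2 := by
        rw [← pow_mul]; exact pow_le_pow_of_le_one ht.1 ht1 (by norm_num)
      have h7 : 0 ≤ sphMass * sphGrad v t := mul_nonneg sphMass_nonneg (sphGrad_nonneg v t)
      calc (t ^ 3 * ‖w t‖) ^ 2 = (t ^ 3) ^ 2 * ‖w t‖ ^ 2 := by ring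
        _ ≤ t ^ 2 * (sphMass * sphGrad v t) := by gcongr
        _ = _ := by ring)
  have hE : 0 ≤ energyIn v s := intervalIntegral.integral_nonneg hs0 fun t _ => by
    have := sphGrad_nonneg v t; positivity
  calc _ ≤ (∫ t in (0 : ℝ)..s, t ^ 3 * ‖w t‖) ^ 2 := by gcongr
    _ ≤ _ := h2
    _ = s * (sphMass * energyIn v s) := by
        rw [intervalIntegral.integral_const]; simp [energyIn]; ring
    _ ≤ 1 * (sphMass * energyIn v s) := by
        have := sphMass_nonneg
        gcongr
    _ = _ := one_mul _

lemma norm_meanIn_sq_le (hv : ContinuousOn v innerDomain) {s : ℝ} (hs0 : 0 ≤ s) (hs : s < 1) :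
    ‖meanIn v s‖ ^ 2 ≤ sphMass * massIn v s := by
  have hsub := Icc_subset_Ioo_neg hs
  have hmem : ∀ r ∈ Ioo (-1 : ℝ) 1, ∀ θ : S2, r • (θ : E3) ∈ innerDomain :=
    fun _ hr => smul_mem_innerDomain hr
  have cI : ContinuousOn (sphInt v) (Icc 0 s) := (continuousOn_sphInt hv hmem).mono hsub
  have cS := (continuousOn_sphSq_inner hv).mono hsub
  have h1 : ‖meanIn v s‖ ≤ ∫ t in (0 : ℝ)..s, t ^ 2 * ‖sphInt v t‖ := by
    refine (intervalIntegral.norm_integral_le_integral_norm hs0).trans (le_of_eq ?_)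
    refine intervalIntegral.integral_congr fun t ht => ?_
    simp
  have h2 := sq_integral_le_mul hs0 (x := fun t => t ^ 2 * ‖sphInt v t‖) (f := fun t => sphMass)
    (g := fun t => t ^ 2 * sphSq v t) ((continuousOn_id.pow 2).mul cI.norm) continuousOn_const
    ((continuousOn_id.pow 2).mul cS) (fun _ _ => sphMass_nonneg)
    (fun t _ => by have := sphSq_nonneg v t; positivity) (fun t ht => by
      have h3 : ‖sphInt v t‖ ^ 2 ≤ sphMass * sphSq v t := norm_integral_sphere_sq_le
        (continuous_restrict_sphere hv (hmem t (hsub ht)))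
      have ht1 : t ≤ 1 := ht.2.trans hs.le
      have h6 : (t ^ 2) ^ 2 ≤ t ^ 2 := by
        rw [← pow_mul]; exact pow_le_pow_of_le_one ht.1 ht1 (by norm_num)
      calc (t ^ 2 * ‖sphInt v t‖) ^ 2 = (t ^ 2) ^ 2 * ‖sphInt v t‖ ^ 2 := by ring
        _ ≤ t ^ 2 * (sphMass * sphSq v t) := by gcongr
        _ = _ := by ring)
  have hE : 0 ≤ massIn v s := intervalIntegral.integral_nonneg hs0 fun t _ => by
    have := sphSq_nonneg v t; positivity
  calc _ ≤ (∫ t in (0 : ℝ)..s, t ^ 2 * ‖sphInt v t‖) ^ 2 := by gcongr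
    _ ≤ _ := h2
    _ = s * (sphMass * massIn v s) := by
        rw [intervalIntegral.integral_const]; simp [massIn]; ring
    _ ≤ 1 * (sphMass * massIn v s) := by
        have := sphMass_nonneg
        gcongr
    _ = _ := one_mul _

end BallIdentities

/-! ### Interior fields up to the boundary -/

section Monotone

variable {v : E3 → ℂ}

lemma energyIn_nonneg (v : E3 → ℂ) {s : ℝ} (hs0 : 0 ≤ s) : 0 ≤ energyIn v s :=
  intervalIntegral.integral_nonneg hs0 fun t _ => by
    have := sphGrad_nonneg v t; positivity

lemma massIn_nonneg (v : E3 → ℂ) {s : ℝ} (hs0 : 0 ≤ s) : 0 ≤ massIn v s :=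
  intervalIntegral.integral_nonneg hs0 fun t _ => by
    have := sphSq_nonneg v t; positivity

lemma integral_shell_le_of_tendsto {f : ℝ → ℝ} (hf : ContinuousOn f (Ioo (-1) 1))
    (hf0 : ∀ t, 0 ≤ f t) {A : ℝ}
    (hA : Tendsto (fun s => ∫ t in (0 : ℝ)..s, f t) (𝓝[<] 1) (𝓝 A)) {a s : ℝ} (ha : 0 ≤ a)
    (has : a ≤ s) (hs : s < 1) : ∫ t in a..s, f t ≤ A := by
  refine ge_of_tendsto hA ?_
  filter_upwards [Ioo_mem_nhdsLT hs] with x hx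
  have hint : ∀ {y z : ℝ}, 0 ≤ y → y ≤ z → z < 1 → IntervalIntegrable f volume y z := by
    intro y z hy hyz hz
    refine (hf.mono ?_).intervalIntegrable
    rw [uIcc_of_le hyz]
    exact fun t ht => ⟨by linarith [ht.1], ht.2.trans_lt hz⟩
  have h1 := intervalIntegral.integral_add_adjacent_intervals (hint le_rfl ha (has.trans_lt hs))
    (hint ha has hs)
  have h2 := intervalIntegral.integral_add_adjacent_intervals
    (hint le_rfl (ha.trans has) hs) (hint (ha.trans has) hx.1.le hx.2)
  have h3 : 0 ≤ ∫ t in (0 : ℝ)..a, f t := intervalIntegral.integral_nonneg ha fun t _ => hf0 t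
  have h4 : 0 ≤ ∫ t in s..x, f t := intervalIntegral.integral_nonneg hx.1.le fun t _ => hf0 t
  linarith

lemma integral_energy_le (hv : ContDiffOn ℝ 1 v innerDomain) {A : ℝ}
    (hA : Tendsto (energyIn v) (𝓝[<] 1) (𝓝 A)) {a s : ℝ} (ha : 0 ≤ a) (has : a ≤ s) (hs : s < 1) :
    ∫ t in a..s, t ^ 2 * sphGrad v t ≤ A :=
  integral_shell_le_of_tendsto ((continuousOn_id.pow 2).mul (continuousOn_sphGrad_inner hv))
    (fun t => mul_nonneg (sq_nonneg t) (sphGrad_nonneg v t)) hA ha has hs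

lemma integral_mass_le (hv : ContinuousOn v innerDomain) {B : ℝ}
    (hB : Tendsto (massIn v) (𝓝[<] 1) (𝓝 B)) {a s : ℝ} (ha : 0 ≤ a) (has : a ≤ s) (hs : s < 1) :
    ∫ t in a..s, t ^ 2 * sphSq v t ≤ B :=
  integral_shell_le_of_tendsto ((continuousOn_id.pow 2).mul (continuousOn_sphSq_inner hv))
    (fun t => mul_nonneg (sq_nonneg t) (sphSq_nonneg v t)) hB ha has hs

end Monotone

namespace InteriorField

variable {lam : ℂ} {u : E3 → ℂ} {g q : S2 → ℂ}

lemma contDiffOn_one (h : InteriorField lam u g q) : ContDiffOn ℝ 1 u innerDomain :=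
  h.contDiffOn.of_le (by norm_num)

lemma contDiffOn_shift (h : InteriorField lam u g q) (c : ℂ) :
    ContDiffOn ℝ 1 (fun x => u x - c) innerDomain :=
  h.contDiffOn_one.sub contDiffOn_const

lemma eventually_mem : ∀ᶠ r in 𝓝[<] (1 : ℝ), ∀ θ : S2, r • (θ : E3) ∈ innerDomain \ {0} := by
  filter_upwards [Ioo_mem_nhdsLT (zero_lt_one' ℝ)] with r hr θ
  refine ⟨smul_mem_innerDomain ⟨by linarith [hr.1], hr.2⟩ θ, ?_⟩
  rw [mem_singleton_iff, smul_eq_zero, not_or]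
  refine ⟨hr.1.ne', fun h0 => ?_⟩
  have := norm_sphere θ
  rw [h0, norm_zero] at this
  exact zero_ne_one this

/-- Spherical integrals of functions continuous in the punctured ball converge to those of the
boundary values. -/
lemma tendsto_boundary {G : Type*} [NormedAddCommGroup G] [NormedSpace ℝ G] {φ : E3 → G}
    (hφ : ContinuousOn φ (innerDomain \ {0})) {f : S2 → G}
    (hb : ∀ x : S2, Tendsto φ (𝓝[innerDomain] (x : E3)) (𝓝 (f x))) :
    Continuous f ∧ Tendsto (fun r : ℝ => ∫ θ : S2, φ (r • (θ : E3)) ∂surf) (𝓝[<] 1)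
      (𝓝 (∫ θ, f θ ∂surf)) :=
  tendsto_integral_boundary nhdsWithin_le_nhds eventually_mem hφ
    fun x => (hb x).mono_left (nhdsWithin_mono _ sdiff_subset)

lemma continuousOn_normalDeriv (h : InteriorField lam u g q) :
    ContinuousOn (normalDeriv u) (innerDomain \ {0}) :=
  _root_.continuousOn_normalDeriv (isOpen_innerDomain.sdiff isClosed_singleton)
    (h.contDiffOn_one.mono sdiff_subset) fun _ hx => hx.2

lemma value_shift (h : InteriorField lam u g q) (c : ℂ) (x : S2) :
    Tendsto (fun x => u x - c) (𝓝[innerDomain] (x : E3)) (𝓝 (g x - c)) :=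
  (h.value x).sub_const c

lemma tendsto_sphSq (h : InteriorField lam u g q) (c : ℂ) :
    Tendsto (sphSq fun x => u x - c) (𝓝[<] 1) (𝓝 (l2Sq fun θ => g θ - c)) :=
  (tendsto_boundary (φ := fun x => ‖u x - c‖ ^ 2)
    (((h.contDiffOn_shift c).continuousOn.mono sdiff_subset).norm.pow 2)
    fun x => ((h.value_shift c x).norm.pow 2)).2

lemma tendsto_sphInt (h : InteriorField lam u g q) (c : ℂ) :
    Tendsto (sphInt fun x => u x - c) (𝓝[<] 1) (𝓝 (∫ θ, (g θ - c) ∂surf)) :=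
  (tendsto_boundary ((h.contDiffOn_shift c).continuousOn.mono sdiff_subset) (h.value_shift c)).2

lemma tendsto_flux (h : InteriorField lam u g q) (c : ℂ) :
    Tendsto (sphFlux (fun x => u x - c) u) (𝓝[<] 1) (𝓝 (pairing (fun θ => g θ - c) q)) := by
  have := (tendsto_boundary (φ := fun x => conj (u x - c) * normalDeriv u x)
    ((Complex.continuous_conj.comp_continuousOn
      ((h.contDiffOn_shift c).continuousOn.mono sdiff_subset)).mul h.continuousOn_normalDeriv)
    fun x => ((Complex.continuous_conj.tendsto _).comp (h.value_shift c x)).mul (h.deriv x)).2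
  refine this.congr' ?_
  filter_upwards [Ioo_mem_nhdsLT (zero_lt_one' ℝ)] with r hr
  simp only [normalDeriv_smul_sphere _ hr.1]
  rfl

/-- Green's identity in the ball of radius `s`, tested with `u - c`. -/
lemma flux_eq (h : InteriorField lam u g q) (c : ℂ) {s : ℝ} (hs0 : 0 ≤ s) (hs : s < 1) :
    (s : ℂ) ^ 2 * sphFlux (fun x => u x - c) u s
      = energyIn u s + lam * (massIn (fun x => u x - c) s
          + c * conj (meanIn (fun x => u x - c) s)) := by
  have hsub := Icc_subset_Ioo_neg hs
  have hmem : ∀ r ∈ Ioo (-1 : ℝ) 1, ∀ θ : S2, r • (θ : E3) ∈ innerDomain :=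
    fun _ hr => smul_mem_innerDomain hr
  have hv := h.contDiffOn_shift c
  set v : E3 → ℂ := fun x => u x - c with hvdef
  have cI : ContinuousOn (sphInt v) (Icc 0 s) := (continuousOn_sphInt hv.continuousOn hmem).mono hsub
  have cS : ContinuousOn (sphSq v) (Icc 0 s) := (continuousOn_sphSq_inner hv.continuousOn).mono hsub
  have cG : ContinuousOn (sphGrad u) (Icc 0 s) :=
    (continuousOn_sphGrad_inner h.contDiffOn_one).mono hsub
  have cid : ContinuousOn (fun t : ℝ => (t : ℂ)) (Icc 0 s) :=
    Complex.continuous_ofReal.continuousOn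
  have hd : ∀ t ∈ uIcc 0 s, HasDerivAt (fun t : ℝ => (t : ℂ) ^ 2 * sphFlux v u t)
      (((t ^ 2 * sphGrad u t : ℝ) : ℂ) + lam * (((t ^ 2 * sphSq v t : ℝ) : ℂ)
        + c * conj ((t : ℂ) ^ 2 * sphInt v t))) t := by
    intro t ht
    rw [uIcc_of_le hs0] at ht
    have ht' := hsub ht
    refine (hasDerivAt_green isOpen_innerDomain hv h.contDiffOn isOpen_Ioo hmem ht').congr_deriv ?_
    have i1 := integrable_restrict_sphere (continuousOn_gradSq isOpen_innerDomain h.contDiffOn_one)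
      (hmem t ht')
    have i2 := integrable_restrict_sphere (φ := fun x => ‖v x‖ ^ 2) (hv.continuousOn.norm.pow 2)
      (hmem t ht')
    have i3 : Integrable (fun θ : S2 => conj (v (t • (θ : E3)))) surf := integrable_sphere
      (Complex.continuous_conj.comp (continuous_restrict_sphere hv.continuousOn (hmem t ht')))
    have e1 : ∀ θ : S2, (∑ i, conj (pd i v (t • (θ : E3))) * pd i u (t • (θ : E3)))
        + conj (v (t • (θ : E3))) * Laplacian.laplacian u (t • (θ : E3))
        = (gradSq u (t • (θ : E3)) : ℂ) + (lam * ((‖v (t • (θ : E3))‖ ^ 2 : ℝ) : ℂ)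
          + (lam * c) * conj (v (t • (θ : E3)))) := by
      intro θ
      rw [h.laplacian _ (hmem t ht' θ)]
      have e2 : u (t • (θ : E3)) = v (t • (θ : E3)) + c := by simp [hvdef]
      have e3 : ∀ i, pd i v = pd i u := by
        intro i; funext x; simp only [pd, hvdef, fderiv_shift]
      simp only [e3, gradSq, Complex.ofReal_sum, Complex.ofReal_pow, ← Complex.conj_mul']
      rw [e2]
      ring
    simp only [e1]
    have j1 : Integrable (fun θ : S2 => (gradSq u (t • (θ : E3)) : ℂ)) surf := i1.ofReal
    have j2 : Integrable (fun θ : S2 => lam * ((‖v (t • (θ : E3))‖ ^ 2 : ℝ) : ℂ)) surf :=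
      i2.ofReal.const_mul _
    have j3 : Integrable (fun θ : S2 => (lam * c) * conj (v (t • (θ : E3)))) surf :=
      i3.const_mul _
    rw [integral_add j1 (by exact j2.add j3), integral_add j2 j3, integral_const_mul, integral_const_mul]
    have e4 : ∫ θ : S2, conj (v (t • (θ : E3))) ∂surf = conj (sphInt v t) := integral_conj
    have e5 : ∫ θ : S2, (gradSq u (t • (θ : E3)) : ℂ) ∂surf = (sphGrad u t : ℂ) :=
      integral_complex_ofReal
    have e6 : ∫ θ : S2, ((‖v (t • (θ : E3))‖ ^ 2 : ℝ) : ℂ) ∂surf = (sphSq v t : ℂ) :=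
      integral_complex_ofReal
    rw [e4, e5, e6]
    simp only [map_mul, map_pow, Complex.conj_ofReal, Complex.ofReal_mul, Complex.ofReal_pow]
    ring
  have c1 : ContinuousOn (fun t : ℝ => ((t ^ 2 * sphGrad u t : ℝ) : ℂ)) (uIcc 0 s) := by
    rw [uIcc_of_le hs0]
    exact Complex.continuous_ofReal.comp_continuousOn ((continuousOn_id.pow 2).mul cG)
  have c2 : ContinuousOn (fun t : ℝ => ((t ^ 2 * sphSq v t : ℝ) : ℂ)) (uIcc 0 s) := by
    rw [uIcc_of_le hs0]
    exact Complex.continuous_ofReal.comp_continuousOn ((continuousOn_id.pow 2).mul cS)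
  have c3 : ContinuousOn (fun t : ℝ => conj ((t : ℂ) ^ 2 * sphInt v t)) (uIcc 0 s) := by
    rw [uIcc_of_le hs0]
    exact Complex.continuous_conj.comp_continuousOn ((cid.pow 2).mul cI)
  have c4 : ContinuousOn (fun t : ℝ => ((t ^ 2 * sphSq v t : ℝ) : ℂ)
      + c * conj ((t : ℂ) ^ 2 * sphInt v t)) (uIcc 0 s) := c2.add (continuousOn_const.mul c3)
  have c5 : ContinuousOn (fun t : ℝ => lam * (((t ^ 2 * sphSq v t : ℝ) : ℂ)
      + c * conj ((t : ℂ) ^ 2 * sphInt v t))) (uIcc 0 s) := continuousOn_const.mul c4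
  have c6 : ContinuousOn (fun t : ℝ => c * conj ((t : ℂ) ^ 2 * sphInt v t)) (uIcc 0 s) :=
    continuousOn_const.mul c3
  have key := intervalIntegral.integral_eq_sub_of_hasDerivAt hd (c1.add c5).intervalIntegrable
  rw [intervalIntegral.integral_add c1.intervalIntegrable
      c5.intervalIntegrable, intervalIntegral.integral_const_mul,
    intervalIntegral.integral_add c2.intervalIntegrable
      c6.intervalIntegrable, intervalIntegral.integral_const_mul,
    intervalIntegral.integral_ofReal, intervalIntegral.integral_ofReal] at key
  have e9 : ∫ t in (0 : ℝ)..s, conj ((t : ℂ) ^ 2 * sphInt v t) = conj (meanIn v s) := by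
    unfold meanIn
    rw [intervalIntegral.integral_of_le hs0, intervalIntegral.integral_of_le hs0]
    exact integral_conj
  rw [e9] at key
  simp only [Complex.ofReal_zero, ne_eq, OfNat.ofNat_ne_zero, not_false_eq_true, zero_pow,
    zero_mul, sub_zero] at key
  exact key.symm

/-- The volume integrals of `u - c` over the balls of radius `s` converge as `s → 1`, and Green's
identity and the trace inequalities hold for the limits. -/
lemma exists_limits (h : InteriorField lam u g q) (c : ℂ) :
    ∃ (A B : ℝ) (Y : ℂ), Tendsto (energyIn u) (𝓝[<] 1) (𝓝 A) ∧
      Tendsto (massIn fun x => u x - c) (𝓝[<] 1) (𝓝 B) ∧ 0 ≤ A ∧ 0 ≤ B ∧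
      pairing (fun θ => g θ - c) q = A + lam * (B + c * conj Y) ∧
      l2Sq (fun θ => g θ - c) ≤ A + 4 * B ∧
      ‖(∫ θ, (g θ - c) ∂surf) - 3 * Y‖ ^ 2 ≤ sphMass * A ∧
      ‖Y‖ ^ 2 ≤ sphMass * B := by
  have hv := h.contDiffOn_shift c
  have hmem : ∀ r ∈ Ioo (-1 : ℝ) 1, ∀ θ : S2, r • (θ : E3) ∈ innerDomain :=
    fun _ hr => smul_mem_innerDomain hr
  have hsub : Ico (0 : ℝ) 1 ⊆ Ioo (-1) 1 := fun x hx => ⟨by linarith [hx.1], hx.2⟩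
  have cS := (continuousOn_sphSq_inner hv.continuousOn).mono hsub
  have cI := (continuousOn_sphInt hv.continuousOn hmem).mono hsub
  have cid : ContinuousOn (fun t : ℝ => (t : ℂ)) (Ico 0 1) :=
    Complex.continuous_ofReal.continuousOn
  have hidC : Tendsto (fun t : ℝ => (t : ℂ)) (𝓝[<] 1) (𝓝 1) := by
    have := (Complex.continuous_ofReal.tendsto 1).comp tendsto_id_one_left
    simpa [Function.comp_def] using this
  obtain ⟨B, hB⟩ := exists_tendsto_primitive (φ := fun t => t ^ 2 * sphSq (fun x => u x - c) t)
    ((continuousOn_id.pow 2).mul cS) ((tendsto_id_one_left.pow 2).mul (h.tendsto_sphSq c))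
  obtain ⟨Y, hY⟩ := exists_tendsto_primitive
    (φ := fun t : ℝ => (t : ℂ) ^ 2 * sphInt (fun x => u x - c) t)
    ((cid.pow 2).mul cI) ((hidC.pow 2).mul (h.tendsto_sphInt c))
  have hB' : Tendsto (massIn fun x => u x - c) (𝓝[<] 1) (𝓝 B) := hB
  have hY' : Tendsto (meanIn fun x => u x - c) (𝓝[<] 1) (𝓝 Y) := hY
  have hmassC : Tendsto (fun s => lam * ((massIn (fun x => u x - c) s : ℂ)
      + c * conj (meanIn (fun x => u x - c) s))) (𝓝[<] 1) (𝓝 (lam * (B + c * conj Y))) :=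
    (((Complex.continuous_ofReal.tendsto B).comp hB').add
      (((Complex.continuous_conj.tendsto Y).comp hY').const_mul c)).const_mul lam
  have hfl : Tendsto (fun s : ℝ => (s : ℂ) ^ 2 * sphFlux (fun x => u x - c) u s) (𝓝[<] 1)
      (𝓝 (pairing (fun θ => g θ - c) q)) := by
    simpa using (hidC.pow 2).mul (h.tendsto_flux c)
  have hev : ∀ᶠ s in 𝓝[<] (1 : ℝ), 0 < s ∧ s < 1 := Ioo_mem_nhdsLT (zero_lt_one' ℝ)
  have hEC : Tendsto (fun s => (energyIn u s : ℂ)) (𝓝[<] 1)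
      (𝓝 (pairing (fun θ => g θ - c) q - lam * (B + c * conj Y))) := by
    refine (hfl.sub hmassC).congr' ?_
    filter_upwards [hev] with s hs
    rw [h.flux_eq c hs.1.le hs.2]
    ring
  have hE : Tendsto (energyIn u) (𝓝[<] 1)
      (𝓝 (pairing (fun θ => g θ - c) q - lam * (B + c * conj Y)).re) := by
    simpa only [Function.comp_def, Complex.ofReal_re] using
      (Complex.continuous_re.tendsto _).comp hEC
  have hEq := tendsto_nhds_unique hEC ((Complex.continuous_ofReal.tendsto _).comp hE)
  refine ⟨_, B, Y, hE, hB', ?_, ?_, ?_, ?_, ?_, ?_⟩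
  · exact ge_of_tendsto hE (hev.mono fun s hs => energyIn_nonneg u hs.1.le)
  · exact ge_of_tendsto hB' (hev.mono fun s hs => massIn_nonneg _ hs.1.le)
  · rw [← hEq]; ring
  · refine le_of_tendsto_of_tendsto (f := fun s => s ^ 3 * sphSq (fun x => u x - c) s) ?_
      (hE.add (hB'.const_mul 4)) (hev.mono fun s hs => ?_)
    · simpa using (tendsto_id_one_left.pow 3).mul (h.tendsto_sphSq c)
    · have := trace_le hv hs.1.le hs.2
      rwa [energyIn_shift] at this
  · refine le_of_tendsto_of_tendsto (f := fun s : ℝ => ‖(s : ℂ) ^ 3 * sphInt (fun x => u x - c) s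
        - 3 * meanIn (fun x => u x - c) s‖ ^ 2) ?_ (hE.const_mul sphMass)
      (hev.mono fun s hs => ?_)
    · simpa using ((((hidC.pow 3).mul (h.tendsto_sphInt c)).sub (hY'.const_mul 3)).norm.pow 2)
    · have := norm_mean_sub_sq_le hv hs.1.le hs.2
      rwa [energyIn_shift] at this
  · refine le_of_tendsto_of_tendsto (hY'.norm.pow 2) (hB'.const_mul sphMass)
      (hev.mono fun s hs => ?_)
    exact norm_meanIn_sq_le hv.continuousOn hs.1.le hs.2

end InteriorField

/-! ### Poincaré inequality in the ball -/

section PolarCoordinates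

/-- Integration in polar coordinates for nonnegative functions. -/
lemma lintegral_polar {f : E3 → ENNReal} (hf : Measurable f) :
    ∫⁻ x, f x = ∫⁻ r in Ioi (0 : ℝ),
      ENNReal.ofReal (r ^ 2) * ∫⁻ θ : S2, f (r • (θ : E3)) ∂surf := by
  have hd : Module.finrank ℝ E3 - 1 = 2 := by simp
  have hmeas : Measurable fun p : S2 × Ioi (0 : ℝ) => f ((p.2 : ℝ) • (p.1 : E3)) := by fun_prop
  have hm2 : Measurable fun p : ℝ × S2 => f (p.1 • (p.2 : E3)) := by fun_prop
  have hm3 : Measurable fun r : ℝ => ∫⁻ θ : S2, f (r • (θ : E3)) ∂surf := hm2.lintegral_prod_right'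
  have hmp := (volume : Measure E3).measurePreserving_homeomorphUnitSphereProd
  rw [hd] at hmp
  calc ∫⁻ x, f x = ∫⁻ x in ({(0 : E3)}ᶜ : Set E3), f x := by rw [restrict_compl_singleton]
    _ = ∫⁻ x : ({(0 : E3)}ᶜ : Set E3), f x ∂((volume : Measure E3).comap (↑)) :=
        (lintegral_subtype_comap (measurableSet_singleton _).compl f).symm
    _ = ∫⁻ p, f ((p.2 : ℝ) • (p.1 : E3)) ∂(surf.prod (Measure.volumeIoiPow 2)) := by
        rw [surf, ← hmp.lintegral_comp hmeas]
        refine lintegral_congr fun x => ?_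
        congr 1
        have := congrArg Subtype.val ((homeomorphUnitSphereProd E3).symm_apply_apply x)
        rw [homeomorphUnitSphereProd_symm_apply_coe] at this
        exact this.symm
    _ = ∫⁻ r : Ioi (0 : ℝ), ∫⁻ θ : S2, f ((r : ℝ) • (θ : E3)) ∂surf ∂(Measure.volumeIoiPow 2) :=
        lintegral_prod_symm' _ hmeas
    _ = _ := by
        have hw : Measurable fun r : Ioi (0 : ℝ) => ENNReal.ofReal ((r : ℝ) ^ 2) := by fun_prop
        have := lintegral_withDensity_eq_lintegral_mul
          ((volume : Measure ℝ).comap (Subtype.val : Ioi (0 : ℝ) → ℝ)) hw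
          (hm3.comp measurable_subtype_coe)
        refine this.trans ?_
        exact lintegral_subtype_comap measurableSet_Ioi
          fun r : ℝ => ENNReal.ofReal (r ^ 2) * ∫⁻ θ : S2, f (r • (θ : E3)) ∂surf

/-- The integral over a ball inside the unit ball of a function which is continuous there. -/
lemma setLIntegral_closedBall {φ : E3 → ℝ} (hφ : ContinuousOn φ innerDomain) (h0 : ∀ x, 0 ≤ φ x)
    {s : ℝ} (hs0 : 0 ≤ s) (hs : s < 1) :
    ∫⁻ x in Metric.closedBall (0 : E3) s, ENNReal.ofReal (φ x)
      = ENNReal.ofReal (∫ t in (0 : ℝ)..s, t ^ 2 * sphInt φ t) := by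
  have hsub : Metric.closedBall (0 : E3) s ⊆ innerDomain := fun x hx => by
    have : ‖x‖ ≤ s := by simpa using hx
    exact this.trans_lt hs
  have hmeas : Measurable ((Metric.closedBall (0 : E3) s).indicator
      fun x => ENNReal.ofReal (φ x)) := by
    classical
    rw [← piecewise_eq_indicator]
    exact ContinuousOn.measurable_piecewise
      (ENNReal.continuous_ofReal.comp_continuousOn (hφ.mono hsub)) continuousOn_const
      Metric.isClosed_closedBall.measurableSet
  have cI : ContinuousOn (fun t => t ^ 2 * sphInt φ t) (Icc 0 s) :=
    (continuousOn_id.pow 2).mul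
      ((continuousOn_sphInt hφ fun r hr => smul_mem_innerDomain hr).mono (Icc_subset_Ioo_neg hs))
  have hnn : ∀ t, 0 ≤ t ^ 2 * sphInt φ t := fun t =>
    mul_nonneg (sq_nonneg _) (integral_nonneg fun _ => h0 _)
  rw [← lintegral_indicator Metric.isClosed_closedBall.measurableSet, lintegral_polar hmeas,
    intervalIntegral.integral_of_le hs0,
    ofReal_integral_eq_lintegral_ofReal ((cI.integrableOn_compact isCompact_Icc).mono_set
      Ioc_subset_Icc_self) (Eventually.of_forall hnn)]
  have hIoc : Ioc 0 s ⊆ Ioi (0 : ℝ) := fun _ h => h.1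
  rw [← lintegral_indicator measurableSet_Ioi, ← lintegral_indicator measurableSet_Ioc]
  refine lintegral_congr fun r => ?_
  by_cases hr : r ∈ Ioc 0 s
  · rw [indicator_of_mem hr, indicator_of_mem (hIoc hr), ENNReal.ofReal_mul (sq_nonneg _), sphInt,
      ofReal_integral_eq_lintegral_ofReal (integrable_restrict_sphere hφ
        (smul_mem_innerDomain ⟨by linarith [hr.1], hr.2.trans_lt hs⟩))
        (Eventually.of_forall fun _ => h0 _)]
    congr 1
    refine lintegral_congr fun θ => ?_
    rw [indicator_of_mem]
    simpa [norm_smul_sphere hr.1.le] using hr.2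
  · rw [indicator_of_notMem hr]
    by_cases h1 : r ∈ Ioi (0 : ℝ)
    · rw [indicator_of_mem h1]
      have : ∀ θ : S2, (Metric.closedBall (0 : E3) s).indicator
          (fun x => ENNReal.ofReal (φ x)) (r • (θ : E3)) = 0 := fun θ => by
        rw [indicator_of_notMem]
        rw [mem_closedBall_zero_iff, norm_smul_sphere (le_of_lt h1)]
        exact fun h => hr ⟨h1, h⟩
      simp [this]
    · rw [indicator_of_notMem h1]

end PolarCoordinates

section Poincare

/-- Integrals of nonnegative functions do not grow much under dilations by a factor at least `1/2`. -/
lemma lintegral_comp_affine_le {f : E3 → ENNReal} (hf : Measurable f) {t : ℝ} (ht : 1 / 2 ≤ t)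
    (c : E3) : ∫⁻ x, f (c + t • x) ≤ 8 * ∫⁻ x, f x := by
  have ht0 : 0 < t := by linarith
  have hs : Measurable fun x : E3 => t • x := measurable_const_smul t
  have h1 : ∫⁻ x, f (c + t • x) = ∫⁻ y, f (c + y) ∂(Measure.map (fun x : E3 => t • x) volume) := by
    rw [lintegral_map (by fun_prop) hs]
  rw [h1, Measure.map_addHaar_smul volume ht0.ne', lintegral_smul_measure,
    lintegral_add_left_eq_self, smul_eq_mul]
  gcongr
  rw [abs_of_nonneg (by positivity)]
  have : (t ^ Module.finrank ℝ E3)⁻¹ ≤ 8 := by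
    have hd : Module.finrank ℝ E3 = 3 := by simp
    rw [hd, inv_le_comm₀ (by positivity) (by norm_num)]
    calc (8 : ℝ)⁻¹ = (1 / 2) ^ 3 := by norm_num
      _ ≤ t ^ 3 := by gcongr
  calc ENNReal.ofReal _ ≤ ENNReal.ofReal 8 := ENNReal.ofReal_le_ofReal this
    _ = 8 := by norm_num

/-- The increment along a segment, estimated by the gradient on the segment. -/
lemma norm_sub_sq_le_segment {v : E3 → ℂ} (hv : ContDiffOn ℝ 1 v innerDomain) {s : ℝ}
    (hs : s < 1) {x y : E3} (hx : x ∈ Metric.closedBall (0 : E3) s)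
    (hy : y ∈ Metric.closedBall (0 : E3) s) :
    ENNReal.ofReal (‖v x - v y‖ ^ 2) ≤ 4 * ∫⁻ t in Ioc (0 : ℝ) 1,
      (Metric.closedBall (0 : E3) s).indicator (fun z => ENNReal.ofReal (gradSq v z))
        ((1 - t) • y + t • x) := by
  have hseg : ∀ t ∈ Icc (0 : ℝ) 1, (1 - t) • y + t • x ∈ Metric.closedBall (0 : E3) s :=
    fun t ht => convex_closedBall _ _ hy hx (by linarith [ht.2]) ht.1 (by ring)
  have hsub : Metric.closedBall (0 : E3) s ⊆ innerDomain := fun x hx => by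
    have : ‖x‖ ≤ s := by simpa using hx
    exact this.trans_lt hs
  let γ : ℝ → E3 := fun t => (1 - t) • y + t • x
  have hγ : Continuous γ := by fun_prop
  have hmaps : MapsTo γ (Icc 0 1) innerDomain := fun t ht => hsub (hseg t ht)
  have hd : ∀ t ∈ uIcc (0 : ℝ) 1, HasDerivAt (fun t => v (γ t)) (fderiv ℝ v (γ t) (x - y)) t := by
    intro t ht
    rw [uIcc_of_le zero_le_one] at ht
    have h1 : HasFDerivAt v (fderiv ℝ v (γ t)) (γ t) :=
      ((hv.differentiableOn one_ne_zero).differentiableAt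
        (isOpen_innerDomain.mem_nhds (hmaps ht))).hasFDerivAt
    have h2 : HasDerivAt γ (x - y) t := by
      have := (((hasDerivAt_id t).const_sub 1).smul_const y).add ((hasDerivAt_id t).smul_const x)
      refine this.congr_deriv ?_
      simp [sub_eq_neg_add]
    exact h1.comp_hasDerivAt t h2
  have cD : ContinuousOn (fun t => fderiv ℝ v (γ t) (x - y)) (Icc 0 1) :=
    ((hv.continuousOn_fderiv_of_isOpen isOpen_innerDomain le_rfl).comp hγ.continuousOn
      hmaps).clm_apply continuousOn_const
  have cG : ContinuousOn (fun t => gradSq v (γ t)) (Icc 0 1) :=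
    (continuousOn_gradSq isOpen_innerDomain hv).comp hγ.continuousOn hmaps
  have key := intervalIntegral.integral_eq_sub_of_hasDerivAt hd
    (by rw [← uIcc_of_le zero_le_one] at cD; exact cD.intervalIntegrable)
  have h01 : v (γ 1) - v (γ 0) = v x - v y := by simp [γ]
  rw [h01] at key
  have hxy : ‖x - y‖ ^ 2 ≤ 4 := by
    have h1 : ‖x‖ ≤ s := by simpa using hx
    have h2 : ‖y‖ ≤ s := by simpa using hy
    have h3 := norm_sub_le x y
    have h4 : ‖x - y‖ ≤ 2 := by linarith
    calc ‖x - y‖ ^ 2 ≤ 2 ^ 2 := by gcongr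
      _ = 4 := by norm_num
  have hpt : ∀ t, ‖fderiv ℝ v (γ t) (x - y)‖ ^ 2 ≤ 4 * gradSq v (γ t) := by
    intro t
    have := gradSq_nonneg v (γ t)
    exact (norm_fderiv_sq_le v (γ t) (x - y)).trans (by gcongr)
  have h2 := sq_integral_le_mul zero_le_one (x := fun t => ‖fderiv ℝ v (γ t) (x - y)‖)
    (f := fun _ => 1) (g := fun t => 4 * gradSq v (γ t)) cD.norm continuousOn_const
    (continuousOn_const.mul cG) (fun _ _ => zero_le_one)
    (fun t _ => by have := gradSq_nonneg v (γ t); positivity)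
    (fun t _ => by rw [one_mul]; exact hpt t)
  have h3 : ‖v x - v y‖ ^ 2 ≤ 4 * ∫ t in (0 : ℝ)..1, gradSq v (γ t) := by
    rw [← key]
    have := intervalIntegral.norm_integral_le_integral_norm (μ := volume)
      (f := fun t => fderiv ℝ v (γ t) (x - y)) (zero_le_one' ℝ)
    rw [intervalIntegral.integral_const_mul] at h2
    simp only [intervalIntegral.integral_const, sub_zero, smul_eq_mul, mul_one, one_mul] at h2
    calc _ ≤ (∫ t in (0 : ℝ)..1, ‖fderiv ℝ v (γ t) (x - y)‖) ^ 2 := by gcongr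
      _ ≤ _ := h2
  refine (ENNReal.ofReal_le_ofReal h3).trans (le_of_eq ?_)
  rw [ENNReal.ofReal_mul (by norm_num), intervalIntegral.integral_of_le zero_le_one,
    ofReal_integral_eq_lintegral_ofReal ((cG.integrableOn_compact isCompact_Icc).mono_set
      Ioc_subset_Icc_self) (Eventually.of_forall fun t => gradSq_nonneg v (γ t))]
  congr 1
  · norm_num
  · refine setLIntegral_congr_fun measurableSet_Ioc fun t ht => ?_
    rw [indicator_of_mem (hseg t ⟨ht.1.le, ht.2⟩)]

/-- **Poincaré inequality** on a ball, for the deviation from a suitable value. -/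
lemma exists_massIn_sub_le {v : E3 → ℂ} (hv : ContDiffOn ℝ 1 v innerDomain) {s : ℝ}
    (hs0 : 0 < s) (hs : s < 1) : ∃ m : ℂ, massIn (fun x => v x - m) s ≤ 32 * energyIn v s := by
  set b := Metric.closedBall (0 : E3) s with hb
  have hbm : MeasurableSet b := Metric.isClosed_closedBall.measurableSet
  have hsub : b ⊆ innerDomain := fun x hx => by
    have : ‖x‖ ≤ s := by simpa [hb] using hx
    exact this.trans_lt hs
  set G : E3 → ENNReal := b.indicator fun z => ENNReal.ofReal (gradSq v z) with hG
  have hGm : Measurable G := by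
    classical
    rw [hG, ← piecewise_eq_indicator]
    exact ContinuousOn.measurable_piecewise (ENNReal.continuous_ofReal.comp_continuousOn
      ((continuousOn_gradSq isOpen_innerDomain hv).mono hsub)) continuousOn_const hbm
  have hGint : ∫⁻ z, G z = ENNReal.ofReal (energyIn v s) := by
    rw [hG, lintegral_indicator hbm]
    exact setLIntegral_closedBall (continuousOn_gradSq isOpen_innerDomain hv)
      (gradSq_nonneg v) hs0.le hs
  have hb0 : volume b ≠ 0 := (Metric.measure_closedBall_pos _ _ hs0).ne'
  have hbt : volume b ≠ ⊤ := (isCompact_closedBall _ _).measure_ne_top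
  have hm1 : Measurable fun p : E3 × E3 × ℝ => G ((1 - p.2.2) • p.1 + p.2.2 • p.2.1) := by
    fun_prop
  let H : E3 → ENNReal := fun y => ∫⁻ x in b, ∫⁻ t in Ioc (0 : ℝ) 1, G ((1 - t) • y + t • x)
  have hHm : Measurable H := by
    have h2 : Measurable fun p : E3 × E3 => ∫⁻ t in Ioc (0 : ℝ) 1,
        G ((1 - t) • p.1 + t • p.2) := by
      refine Measurable.lintegral_prod_right' (f := fun q : (E3 × E3) × ℝ =>
        G ((1 - q.2) • q.1.1 + q.2 • q.1.2)) ?_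
      fun_prop
    exact h2.lintegral_prod_right'
  have hHint : ∫⁻ y in b, H y ≤ volume b * (8 * ∫⁻ z, G z) := by
    have e1 : ∫⁻ y in b, H y = ∫⁻ t in Ioc (0 : ℝ) 1, ∫⁻ y in b, ∫⁻ x in b,
        G ((1 - t) • y + t • x) := by
      rw [lintegral_lintegral_swap (μ := volume.restrict (Ioc (0 : ℝ) 1))
        (ν := volume.restrict b) (f := fun t y => ∫⁻ x in b, G ((1 - t) • y + t • x))]
      · refine lintegral_congr fun y => ?_
        refine lintegral_lintegral_swap ?_
        exact Measurable.aemeasurable (by fun_prop)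
      · refine Measurable.aemeasurable ?_
        exact Measurable.lintegral_prod_right' (f := fun q : (ℝ × E3) × E3 =>
          G ((1 - q.1.1) • q.1.2 + q.1.1 • q.2)) (by fun_prop)
    have e2 : ∀ t : ℝ, ∫⁻ y in b, ∫⁻ x in b, G ((1 - t) • y + t • x)
        ≤ volume b * (8 * ∫⁻ z, G z) := by
      intro t
      rcases le_total (1 / 2) t with h | h
      · calc _ ≤ ∫⁻ y in b, 8 * ∫⁻ z, G z := by
              gcongr with y
              exact (setLIntegral_le_lintegral _ _).trans (lintegral_comp_affine_le hGm h _)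
          _ = _ := by rw [setLIntegral_const, mul_comm]
      · rw [lintegral_lintegral_swap (by exact Measurable.aemeasurable (by fun_prop))]
        calc _ ≤ ∫⁻ y in b, 8 * ∫⁻ z, G z := by
              gcongr with x
              refine (setLIntegral_le_lintegral _ _).trans ?_
              simp_rw [add_comm _ (t • x)]
              exact lintegral_comp_affine_le hGm (by linarith) _
          _ = _ := by rw [setLIntegral_const, mul_comm]
    rw [e1]
    calc _ ≤ ∫⁻ t in Ioc (0 : ℝ) 1, volume b * (8 * ∫⁻ z, G z) := by
          gcongr with t
          exact e2 t
      _ = _ := by simp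
  obtain ⟨y, hy, hyH⟩ := exists_le_setLAverage hb0 hbt hHm.aemeasurable
  refine ⟨v y, ?_⟩
  have h1 : H y ≤ 8 * ∫⁻ z, G z := by
    refine hyH.trans ?_
    rw [setLAverage_eq]
    refine ENNReal.div_le_of_le_mul ?_
    rw [mul_comm]
    exact hHint
  have h2 : ENNReal.ofReal (massIn (fun x => v x - v y) s) ≤ ENNReal.ofReal (32 * energyIn v s) := by
    calc _ = ∫⁻ x in b, ENNReal.ofReal (‖v x - v y‖ ^ 2) :=
          (setLIntegral_closedBall (φ := fun x => ‖v x - v y‖ ^ 2)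
            ((hv.continuousOn.sub continuousOn_const).norm.pow 2) (fun _ => by positivity)
            hs0.le hs).symm
      _ ≤ ∫⁻ x in b, 4 * ∫⁻ t in Ioc (0 : ℝ) 1, G ((1 - t) • y + t • x) :=
          setLIntegral_mono' hbm fun x hx => norm_sub_sq_le_segment hv hs hx hy
      _ = 4 * H y := by
          rw [lintegral_const_mul' _ _ (by norm_num)]
      _ ≤ 4 * (8 * ∫⁻ z, G z) := by gcongr
      _ = _ := by
          rw [hGint, ENNReal.ofReal_mul (by norm_num), ← mul_assoc]
          norm_num
  have h3 := energyIn_nonneg v hs0.le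
  exact (ENNReal.ofReal_le_ofReal_iff (by positivity)).1 h2

end Poincare

namespace InteriorField

variable {lam : ℂ} {u : E3 → ℂ} {g q : S2 → ℂ}

/-- Against functions of mean zero, the boundary values are controlled by the energy alone. -/
lemma norm_pairing_sq_le_of_mean_zero (h : InteriorField lam u g q) {A : ℝ}
    (hA : Tendsto (energyIn u) (𝓝[<] 1) (𝓝 A)) {q₀ : S2 → ℂ} (hq : Continuous q₀)
    (hq0 : ∫ θ, q₀ θ ∂surf = 0) : ‖pairing g q₀‖ ^ 2 ≤ 129 * A * l2Sq q₀ := by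
  have hint : Tendsto (fun s => s ^ 3 * ‖∫ θ : S2, conj (u (s • (θ : E3))) * q₀ θ ∂surf‖ ^ 2)
      (𝓝[<] 1) (𝓝 (1 ^ 3 * ‖pairing g q₀‖ ^ 2)) := by
    refine (tendsto_id_one_left.pow 3).mul (Tendsto.pow (Tendsto.norm ?_) 2)
    exact tendsto_integral_boundary_mul (φ := fun x => conj (u x)) nhdsWithin_le_nhds
      (by filter_upwards [Ioo_mem_nhdsLT (show (-1 : ℝ) < 1 by norm_num)] with r hr using
        smul_mem_innerDomain hr)
      (Complex.continuous_conj.comp_continuousOn h.contDiffOn.continuousOn)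
      (fun x => (Complex.continuous_conj.tendsto _).comp (h.value x)) hq
  have hlim := le_of_tendsto_of_tendsto hint ((hA.const_mul 129).mul_const (l2Sq q₀)) (by
    filter_upwards [Ioo_mem_nhdsLT (zero_lt_one' ℝ)] with s hs
    obtain ⟨m, hm⟩ := exists_massIn_sub_le h.contDiffOn_one hs.1 hs.2
    have hmem : ∀ θ : S2, s • (θ : E3) ∈ innerDomain :=
      smul_mem_innerDomain ⟨by linarith [hs.1], hs.2⟩
    have hcu := continuous_restrict_sphere h.contDiffOn.continuousOn hmem
    have e1 : ∫ θ : S2, conj (u (s • (θ : E3))) * q₀ θ ∂surf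
        = ∫ θ : S2, conj (u (s • (θ : E3)) - m) * q₀ θ ∂surf := by
      have : ∀ θ : S2, conj (u (s • (θ : E3)) - m) * q₀ θ
          = conj (u (s • (θ : E3))) * q₀ θ - conj m * q₀ θ := fun θ => by
        rw [map_sub]; ring
      simp_rw [this]
      have i1 : Integrable (fun θ : S2 => conj (u (s • (θ : E3))) * q₀ θ) surf :=
        integrable_sphere ((Complex.continuous_conj.comp hcu).mul hq)
      have i2 : Integrable (fun θ : S2 => conj m * q₀ θ) surf :=
        integrable_sphere (continuous_const.mul hq)
      rw [integral_sub i1 i2, integral_const_mul, hq0, mul_zero, sub_zero]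
    have h1 := norm_integral_conj_mul_sq_le (hcu.sub (continuous_const (y := m))) hq
    have h2 := trace_le (h.contDiffOn_shift m) hs.1.le hs.2
    rw [energyIn_shift] at h2
    have h3 : s ^ 3 * sphSq (fun x => u x - m) s ≤ 129 * energyIn u s := by linarith
    have h4 := l2Sq_nonneg q₀
    have hs3 : 0 ≤ s ^ 3 := pow_nonneg hs.1.le 3
    rw [e1]
    calc _ ≤ s ^ 3 * (sphSq (fun x => u x - m) s * l2Sq q₀) :=
          mul_le_mul_of_nonneg_left h1 hs3
      _ = s ^ 3 * sphSq (fun x => u x - m) s * l2Sq q₀ := by ring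
      _ ≤ _ := mul_le_mul_of_nonneg_right h3 h4)
  simpa using hlim

end InteriorField

/-! ### Duality between exterior and interior fields -/

/-- A shell inside the unit ball. -/
def innerShell : Set E3 := {x | 1 / 3 < ‖x‖ ∧ ‖x‖ < 1}

lemma isOpen_innerShell : IsOpen innerShell :=
  (isOpen_lt continuous_const continuous_norm).inter (isOpen_lt continuous_norm continuous_const)

lemma innerShell_subset : innerShell ⊆ innerDomain := fun _ hx => hx.2

lemma smul_mem_innerShell {s : ℝ} (hs : s ∈ Ioo (1 / 3 : ℝ) 1) (θ : S2) :
    s • (θ : E3) ∈ innerShell := by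
  have h : ‖s • (θ : E3)‖ = s := norm_smul_sphere (by linarith [hs.1]) θ
  refine ⟨?_, ?_⟩ <;> rw [h]
  exacts [hs.1, hs.2]

lemma ne_zero_of_mem_innerShell {x : E3} (hx : x ∈ innerShell) : x ≠ 0 := by
  rintro rfl
  have := hx.1
  rw [norm_zero] at this
  linarith

lemma inversion_smul_sphere {s : ℝ} (hs : 0 < s) (θ : S2) :
    EuclideanGeometry.inversion (0 : E3) 1 (s • (θ : E3)) = s⁻¹ • (θ : E3) := by
  rw [EuclideanGeometry.inversion, dist_zero_right, norm_smul_sphere hs.le]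
  simp only [vsub_eq_sub, sub_zero, vadd_eq_add, add_zero, smul_smul]
  congr 1
  field_simp

lemma norm_inversion {x : E3} (hx : x ≠ 0) :
    ‖EuclideanGeometry.inversion (0 : E3) 1 x‖ = ‖x‖⁻¹ := by
  have h : ‖x‖ ≠ 0 := norm_ne_zero_iff.2 hx
  rw [EuclideanGeometry.inversion, dist_zero_right]
  simp only [vsub_eq_sub, sub_zero, vadd_eq_add, add_zero, norm_smul]
  simp
  field_simp

lemma inversion_mem_outerDomain {x : E3} (hx : x ∈ innerShell) :
    EuclideanGeometry.inversion (0 : E3) 1 x ∈ outerDomain := by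
  change 1 < ‖_‖
  have h0 := ne_zero_of_mem_innerShell hx
  rw [norm_inversion h0]
  exact (one_lt_inv₀ (norm_pos_iff.2 h0)).2 hx.2

/-- The extension of a field `e` from the exterior into the ball, by inversion at the unit sphere
and a linear cutoff in a layer of width `ε`. -/
noncomputable def layerExtension (ε : ℝ) (e : E3 → ℂ) (x : E3) : ℂ :=
  ((‖x‖ - 1 + ε) / ε) • e (EuclideanGeometry.inversion 0 1 x)

section Layer

variable {e : E3 → ℂ} {ε : ℝ}

lemma layerExtension_smul_sphere {s : ℝ} (hs : 0 < s) (θ : S2) :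
    layerExtension ε e (s • (θ : E3)) = ((s - 1 + ε) / ε) • e (s⁻¹ • (θ : E3)) := by
  rw [layerExtension, norm_smul_sphere hs.le, inversion_smul_sphere hs]

lemma contDiffOn_layerExtension (he : ContDiffOn ℝ 1 e outerDomain) :
    ContDiffOn ℝ 1 (layerExtension ε e) innerShell := by
  have h1 : ContDiffOn ℝ 1 (fun x : E3 => ‖x‖) innerShell := fun x hx =>
    (contDiffAt_norm ℝ (ne_zero_of_mem_innerShell hx)).contDiffWithinAt
  have h2 : ContDiffOn ℝ 1 (fun x : E3 => EuclideanGeometry.inversion (0 : E3) 1 x) innerShell :=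
    ContDiffOn.inversion (n := 1) contDiffOn_const contDiffOn_const contDiffOn_id
      fun x hx => ne_zero_of_mem_innerShell hx
  exact (((h1.sub contDiffOn_const).add contDiffOn_const).div_const ε).smul
    (he.comp h2 fun x hx => inversion_mem_outerDomain hx)

lemma gradSq_layerExtension_le (hε : 0 < ε) (he : ContDiffOn ℝ 1 e outerDomain) {s : ℝ}
    (hs : s ∈ Ioo (1 / 3 : ℝ) 1) (hsε : 1 - ε ≤ s) (θ : S2) :
    gradSq (layerExtension ε e) (s • (θ : E3))
      ≤ 6 / ε ^ 2 * ‖e (s⁻¹ • (θ : E3))‖ ^ 2 + 6 / s ^ 4 * gradSq e (s⁻¹ • (θ : E3)) := by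
  have hs0 : 0 < s := by linarith [hs.1]
  set x : E3 := s • (θ : E3) with hx
  have hxm : x ∈ innerShell := smul_mem_innerShell hs θ
  have hx0 := ne_zero_of_mem_innerShell hxm
  have hxn : ‖x‖ = s := norm_smul_sphere hs0.le θ
  have hinv : EuclideanGeometry.inversion (0 : E3) 1 x = s⁻¹ • (θ : E3) :=
    inversion_smul_sphere hs0 θ
  have h1 : HasFDerivAt (fun y : E3 => ‖y‖) (fderiv ℝ (fun y : E3 => ‖y‖) x) x :=
    ((contDiffAt_norm (n := 1) ℝ hx0).differentiableAt one_ne_zero).hasFDerivAt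
  have hn1 : ‖fderiv ℝ (fun y : E3 => ‖y‖) x‖ ≤ 1 := by
    simpa using norm_fderiv_le_of_lipschitz ℝ (x₀ := x) (lipschitzWith_one_norm (E := E3))
  have h2 := EuclideanGeometry.hasFDerivAt_inversion (R := 1) hx0
  have h3 : HasFDerivAt e (fderiv ℝ e (s⁻¹ • (θ : E3)))
      (EuclideanGeometry.inversion (0 : E3) 1 x) := by
    rw [hinv]
    exact ((he.differentiableOn one_ne_zero).differentiableAt
      (isOpen_outerDomain.mem_nhds (hinv ▸ inversion_mem_outerDomain hxm))).hasFDerivAt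
  have h4 := (((h1.sub_const 1).add_const ε).mul_const ε⁻¹).smul (h3.comp x h2)
  set c : ℝ := (s - 1 + ε) * ε⁻¹ with hc
  have hc0 : 0 ≤ c := mul_nonneg (by linarith) (by positivity)
  have hc1 : c ≤ 1 := by
    rw [hc, ← div_eq_mul_inv, div_le_one hε]; linarith [hs.2]
  have hpd : ∀ i, ‖pd i (layerExtension ε e) x‖ ^ 2
      ≤ 2 / ε ^ 2 * ‖e (s⁻¹ • (θ : E3))‖ ^ 2 + 2 / s ^ 4 * gradSq e (s⁻¹ • (θ : E3)) := by
    intro i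
    have hi : ‖e3 i‖ = 1 := by simp [e3]
    set w : E3 := (Submodule.span ℝ {x - 0})ᗮ.reflection (e3 i) with hw
    have hwn : ‖w‖ = 1 := by rw [hw, LinearIsometryEquiv.norm_map, hi]
    have e1 : pd i (layerExtension ε e) x
        = c • ((1 / s) ^ 2 • fderiv ℝ e (s⁻¹ • (θ : E3)) w)
          + (ε⁻¹ * fderiv ℝ (fun y : E3 => ‖y‖) x (e3 i)) • e (s⁻¹ • (θ : E3)) := by
      have : fderiv ℝ (layerExtension ε e) x = _ := HasFDerivAt.fderiv (f := layerExtension ε e) h4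
      rw [pd, this]
      simp [hinv, hxn, hc, hw, dist_zero_right]
    have n1 : ‖c • ((1 / s) ^ 2 • fderiv ℝ e (s⁻¹ • (θ : E3)) w)‖ ^ 2
        ≤ 1 / s ^ 4 * gradSq e (s⁻¹ • (θ : E3)) := by
      have h5 := norm_fderiv_sq_le e (s⁻¹ • (θ : E3)) w
      rw [hwn, one_pow, one_mul] at h5
      rw [norm_smul, norm_smul, Real.norm_of_nonneg hc0, Real.norm_of_nonneg (by positivity),
        mul_pow, mul_pow ((1 / s) ^ 2)]
      calc c ^ 2 * (((1 / s) ^ 2) ^ 2 * ‖fderiv ℝ e (s⁻¹ • (θ : E3)) w‖ ^ 2)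
          ≤ 1 ^ 2 * (((1 / s) ^ 2) ^ 2 * gradSq e (s⁻¹ • (θ : E3))) := by gcongr
        _ = _ := by field_simp
    have n2 : ‖(ε⁻¹ * fderiv ℝ (fun y : E3 => ‖y‖) x (e3 i)) • e (s⁻¹ • (θ : E3))‖ ^ 2
        ≤ 1 / ε ^ 2 * ‖e (s⁻¹ • (θ : E3))‖ ^ 2 := by
      have h5 : ‖fderiv ℝ (fun y : E3 => ‖y‖) x (e3 i)‖ ≤ 1 := by
        refine (ContinuousLinearMap.le_opNorm _ _).trans ?_
        rw [hi, mul_one]; exact hn1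
      rw [norm_smul, norm_mul, mul_pow, mul_pow, norm_inv, Real.norm_of_nonneg hε.le]
      calc _ ≤ ε⁻¹ ^ 2 * 1 ^ 2 * ‖e (s⁻¹ • (θ : E3))‖ ^ 2 := by gcongr
        _ = _ := by field_simp
    rw [e1]
    refine (pow_le_pow_left₀ (norm_nonneg _) (norm_add_le _ _) 2).trans ?_
    refine (add_sq_le (a := ‖c • ((1 / s) ^ 2 • fderiv ℝ e (s⁻¹ • (θ : E3)) w)‖)).trans ?_
    calc _ ≤ 2 * (1 / s ^ 4 * gradSq e (s⁻¹ • (θ : E3))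
          + 1 / ε ^ 2 * ‖e (s⁻¹ • (θ : E3))‖ ^ 2) := by gcongr
      _ = _ := by ring
  calc gradSq (layerExtension ε e) x ≤ ∑ i : Fin 3, (2 / ε ^ 2 * ‖e (s⁻¹ • (θ : E3))‖ ^ 2
        + 2 / s ^ 4 * gradSq e (s⁻¹ • (θ : E3))) := Finset.sum_le_sum fun i _ => hpd i
    _ = _ := by simp; ring

end Layer

section Shell

lemma norm_integral_sum_conj_mul_sq_le {f w : Fin 3 → S2 → ℂ} (hf : ∀ i, Continuous (f i))
    (hw : ∀ i, Continuous (w i)) :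
    ‖∫ θ, ∑ i, conj (f i θ) * w i θ ∂surf‖ ^ 2
      ≤ (∫ θ, ∑ i, ‖f i θ‖ ^ 2 ∂surf) * ∫ θ, ∑ i, ‖w i θ‖ ^ 2 ∂surf := by
  have i1 : ∀ i ∈ Finset.univ, Integrable (fun θ => conj (f i θ) * w i θ) surf := fun i _ =>
    integrable_sphere ((Complex.continuous_conj.comp (hf i)).mul (hw i))
  have i2 : ∀ F : Fin 3 → S2 → ℂ, (∀ i, Continuous (F i)) →
      ∀ i ∈ Finset.univ, Integrable (fun θ => ‖F i θ‖ ^ 2) surf := fun F hF i _ =>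
    integrable_sphere ((hF i).norm.pow 2)
  rw [integral_finsetSum _ i1, integral_finsetSum _ (i2 f hf), integral_finsetSum _ (i2 w hw)]
  have h1 : ∀ i, ‖∫ θ, conj (f i θ) * w i θ ∂surf‖
      ≤ Real.sqrt (∫ θ, ‖f i θ‖ ^ 2 ∂surf) * Real.sqrt (∫ θ, ‖w i θ‖ ^ 2 ∂surf) := fun i => by
    rw [← Real.sqrt_mul (integral_nonneg fun _ => by positivity)]
    exact Real.le_sqrt_of_sq_le (norm_integral_conj_mul_sq_le (hf i) (hw i))
  have h2 := Finset.sum_mul_sq_le_sq_mul_sq Finset.univ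
    (fun i => Real.sqrt (∫ θ, ‖f i θ‖ ^ 2 ∂surf)) (fun i => Real.sqrt (∫ θ, ‖w i θ‖ ^ 2 ∂surf))
  have h3 : ∀ F : S2 → ℂ, Real.sqrt (∫ θ, ‖F θ‖ ^ 2 ∂surf) ^ 2 = ∫ θ, ‖F θ‖ ^ 2 ∂surf :=
    fun F => Real.sq_sqrt (integral_nonneg fun _ => by positivity)
  simp only [h3] at h2
  refine le_trans ?_ h2
  gcongr
  exact (norm_sum_le _ _).trans (Finset.sum_le_sum fun i _ => h1 i)

variable {k : ℝ} {e : E3 → ℂ} {g p : S2 → ℂ} {ε K a s : ℝ}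

lemma ExteriorField.continuousOn_sphGrad_inv (h : ExteriorField k e g p) :
    ContinuousOn (fun s => sphGrad e s⁻¹) (Ioo 0 1) :=
  (continuousOn_sphGrad isOpen_outerDomain h.contDiffOn_one
    (fun _ hr => smul_mem_outerDomain hr)).comp
    (continuousOn_inv₀.mono fun _ hx => hx.1.ne') fun _ hx => (one_lt_inv₀ hx.1).2 hx.2

lemma ExteriorField.layer_mass_le (h : ExteriorField k e g p) (hε : 0 < ε) (hε2 : ε ≤ 1 / 2)
    (hK1 : ∀ r, 1 < r → r ≤ 2 → sphSq e r ≤ K) (hs : 1 - ε ≤ s) (hs1 : s < 1) :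
    ∫ t in (1 - ε)..s, t ^ 2 * sphSq (layerExtension ε e) t ≤ ε * K := by
  have hI : Icc (1 - ε) s ⊆ Ioo (1 / 3 : ℝ) 1 := fun t ht =>
    ⟨by linarith [ht.1], ht.2.trans_lt hs1⟩
  have hK : 0 ≤ K := (sphSq_nonneg e 2).trans (hK1 2 (by norm_num) le_rfl)
  have c1 : ContinuousOn (fun t => t ^ 2 * sphSq (layerExtension ε e) t) (Icc (1 - ε) s) :=
    (continuousOn_id.pow 2).mul ((continuousOn_sphSq
      (contDiffOn_layerExtension h.contDiffOn_one).continuousOn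
      fun _ hr => smul_mem_innerShell hr).mono hI)
  calc _ ≤ ∫ t in (1 - ε)..s, K := by
        refine intervalIntegral.integral_mono_on hs
          (ContinuousOn.intervalIntegrable (by rwa [uIcc_of_le hs])) intervalIntegrable_const
          fun t ht => ?_
        have ht' := hI ht
        have ht0 : 0 < t := by linarith [ht'.1]
        have h1 : sphSq (layerExtension ε e) t = ((t - 1 + ε) / ε) ^ 2 * sphSq e t⁻¹ := by
          rw [sphSq, sphSq, ← integral_const_mul]
          refine integral_congr_ae (Eventually.of_forall fun θ => ?_)
          simp only [layerExtension_smul_sphere ht0, norm_smul, mul_pow, Real.norm_eq_abs, sq_abs]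
        have h2 : sphSq e t⁻¹ ≤ K := hK1 _ ((one_lt_inv₀ ht0).2 ht'.2)
          ((inv_le_comm₀ ht0 two_pos).2 (by linarith [ht.1]))
        have h3 : ((t - 1 + ε) / ε) ^ 2 ≤ 1 := by
          refine pow_le_one₀ (div_nonneg (by linarith [ht.1]) hε.le) ?_
          rw [div_le_one hε]; linarith [ht'.2]
        have h4 : t ^ 2 ≤ 1 := pow_le_one₀ ht0.le ht'.2.le
        have h5 := sphSq_nonneg e t⁻¹
        rw [h1]
        calc _ ≤ 1 * (1 * K) := by gcongr
          _ = K := by ring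
    _ = (s - (1 - ε)) * K := by simp
    _ ≤ _ := by gcongr; linarith

lemma ExteriorField.layer_energy_le (h : ExteriorField k e g p) (hε : 0 < ε) (hε2 : ε ≤ 1 / 2)
    (hK1 : ∀ r, 1 < r → r ≤ 2 → sphSq e r ≤ K)
    (hK2 : ∀ a, 1 < a → a ≤ 2 → ∫ r in a..2, r ^ 2 * sphGrad e r ≤ K)
    (hs : 1 - ε ≤ s) (hs1 : s < 1) :
    ∫ t in (1 - ε)..s, t ^ 2 * sphGrad (layerExtension ε e) t ≤ 9 / ε * K := by
  have hI : Icc (1 - ε) s ⊆ Ioo (1 / 3 : ℝ) 1 := fun t ht =>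
    ⟨by linarith [ht.1], ht.2.trans_lt hs1⟩
  have hI2 : Icc (1 - ε) s ⊆ Ioo (0 : ℝ) 1 := fun t ht =>
    ⟨by linarith [ht.1], ht.2.trans_lt hs1⟩
  have hK : 0 ≤ K := (sphSq_nonneg e 2).trans (hK1 2 (by norm_num) le_rfl)
  have hv := contDiffOn_layerExtension (ε := ε) h.contDiffOn_one
  have c1 : ContinuousOn (fun t => t ^ 2 * sphGrad (layerExtension ε e) t) (Icc (1 - ε) s) :=
    (continuousOn_id.pow 2).mul ((continuousOn_sphGrad isOpen_innerShell hv
      fun _ hr => smul_mem_innerShell hr).mono hI)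
  have c2 : ContinuousOn (fun t => 6 / t ^ 4 * sphGrad e t⁻¹) (Icc (1 - ε) s) :=
    (continuousOn_const.div (continuousOn_id.pow 4) fun t ht => by
      have := (hI2 ht).1; simp [this.ne']).mul (h.continuousOn_sphGrad_inv.mono hI2)
  have hpt : ∀ t ∈ Icc (1 - ε) s, t ^ 2 * sphGrad (layerExtension ε e) t
      ≤ 6 / ε ^ 2 * K + 6 / t ^ 4 * sphGrad e t⁻¹ := by
    intro t ht
    have ht' := hI ht
    have ht0 : 0 < t := by linarith [ht'.1]
    have hti : t⁻¹ ∈ Ioi (1 : ℝ) := (one_lt_inv₀ ht0).2 ht'.2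
    have i1 : Integrable (fun θ : S2 => ‖e (t⁻¹ • (θ : E3))‖ ^ 2) surf :=
      integrable_sphere ((continuous_restrict_sphere h.contDiffOn.continuousOn
        (smul_mem_outerDomain hti)).norm.pow 2)
    have i2 : Integrable (fun θ : S2 => gradSq e (t⁻¹ • (θ : E3))) surf :=
      integrable_restrict_sphere (continuousOn_gradSq isOpen_outerDomain h.contDiffOn_one)
        (smul_mem_outerDomain hti)
    have h1 : sphGrad (layerExtension ε e) t
        ≤ 6 / ε ^ 2 * sphSq e t⁻¹ + 6 / t ^ 4 * sphGrad e t⁻¹ := by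
      rw [sphSq, sphGrad, sphGrad, ← integral_const_mul, ← integral_const_mul,
        ← integral_add (i1.const_mul _) (i2.const_mul _)]
      exact integral_mono (integrable_restrict_sphere (continuousOn_gradSq isOpen_innerShell hv)
        (smul_mem_innerShell ht')) ((i1.const_mul _).add (i2.const_mul _))
        fun θ => gradSq_layerExtension_le hε h.contDiffOn_one ht' ht.1 θ
    have h2 : sphSq e t⁻¹ ≤ K := hK1 _ hti
      ((inv_le_comm₀ ht0 two_pos).2 (by linarith [ht.1]))
    have h4 : t ^ 2 ≤ 1 := pow_le_one₀ ht0.le ht'.2.le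
    have h5 := sphGrad_nonneg e t⁻¹
    calc _ ≤ 1 * (6 / ε ^ 2 * K + 6 / t ^ 4 * sphGrad e t⁻¹) := by
          have := sphGrad_nonneg (layerExtension ε e) t
          gcongr
          exact h1.trans (by gcongr)
      _ = _ := one_mul _
  have hsub : ∫ t in (1 - ε)..s, 6 / t ^ 4 * sphGrad e t⁻¹ ≤ 6 * K := by
    have hs0 : 0 < s := by linarith
    have hcv := intervalIntegral.integral_comp_mul_deriv' (a := 1 - ε) (b := s)
      (f := fun t : ℝ => t⁻¹) (f' := fun t => -(t ^ 2)⁻¹) (g := fun r => r ^ 2 * sphGrad e r)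
      (fun t ht => by
        rw [uIcc_of_le hs] at ht
        exact hasDerivAt_inv (hI2 ht).1.ne')
      (by
        rw [uIcc_of_le hs]
        exact (ContinuousOn.inv₀ (continuousOn_id.pow 2) fun t ht => by
          have := (hI2 ht).1; simp [this.ne']).neg)
      (by
        rw [uIcc_of_le hs]
        refine ((continuousOn_id.pow 2).mul (continuousOn_sphGrad isOpen_outerDomain
          h.contDiffOn_one (fun _ hr => smul_mem_outerDomain hr))).mono ?_
        rintro _ ⟨t, ht, rfl⟩
        exact (one_lt_inv₀ (hI2 ht).1).2 (hI2 ht).2)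
    have e1 : ∫ t in (1 - ε)..s, 6 / t ^ 4 * sphGrad e t⁻¹
        = 6 * ∫ r in s⁻¹..(1 - ε)⁻¹, r ^ 2 * sphGrad e r := by
      rw [intervalIntegral.integral_symm (1 - ε)⁻¹ s⁻¹, ← hcv,
        ← intervalIntegral.integral_neg, ← intervalIntegral.integral_const_mul]
      refine intervalIntegral.integral_congr fun t ht => ?_
      rw [uIcc_of_le hs] at ht
      have := (hI2 ht).1
      simp only [Function.comp]
      field_simp
    have hsi : 1 < s⁻¹ := (one_lt_inv₀ hs0).2 hs1
    have hle : s⁻¹ ≤ (1 - ε)⁻¹ := inv_anti₀ (by linarith) hs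
    have hle2 : (1 - ε)⁻¹ ≤ 2 := (inv_le_comm₀ (by linarith) two_pos).2 (by linarith)
    have c3 : ContinuousOn (fun r => r ^ 2 * sphGrad e r) (Ioi 1) :=
      (continuousOn_id.pow 2).mul (continuousOn_sphGrad isOpen_outerDomain h.contDiffOn_one
        (fun _ hr => smul_mem_outerDomain hr))
    have ii : ∀ {x y : ℝ}, 1 < x → x ≤ y →
        IntervalIntegrable (fun r => r ^ 2 * sphGrad e r) volume x y := by
      intro x y hx hxy
      refine (c3.mono ?_).intervalIntegrable
      rw [uIcc_of_le hxy]; exact fun z hz => hx.trans_le hz.1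
    have hadd := intervalIntegral.integral_add_adjacent_intervals (ii hsi hle)
      (ii (hsi.trans_le hle) hle2)
    have hnn : 0 ≤ ∫ r in (1 - ε)⁻¹..2, r ^ 2 * sphGrad e r :=
      intervalIntegral.integral_nonneg hle2 fun r _ => by
        have := sphGrad_nonneg e r
        positivity
    have := hK2 _ hsi (hle.trans hle2)
    rw [e1]
    linarith
  have ic : IntervalIntegrable (fun _ : ℝ => 6 / ε ^ 2 * K) volume (1 - ε) s :=
    intervalIntegrable_const
  have i2 : IntervalIntegrable (fun t => 6 / t ^ 4 * sphGrad e t⁻¹) volume (1 - ε) s :=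
    ContinuousOn.intervalIntegrable (by rwa [uIcc_of_le hs])
  calc _ ≤ ∫ t in (1 - ε)..s, (6 / ε ^ 2 * K + 6 / t ^ 4 * sphGrad e t⁻¹) :=
        intervalIntegral.integral_mono_on hs
          (ContinuousOn.intervalIntegrable (by rwa [uIcc_of_le hs])) (ic.add i2) hpt
    _ = (s - (1 - ε)) * (6 / ε ^ 2 * K) + ∫ t in (1 - ε)..s, 6 / t ^ 4 * sphGrad e t⁻¹ := by
        rw [intervalIntegral.integral_add ic i2, intervalIntegral.integral_const, smul_eq_mul]
    _ ≤ ε * (6 / ε ^ 2 * K) + 6 * K := by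
        gcongr
        linarith
    _ ≤ _ := by
        have : 6 * K ≤ 3 / ε * K := by
          gcongr
          rw [le_div_iff₀ hε]; linarith
        have e2 : ε * (6 / ε ^ 2 * K) = 6 / ε * K := by field_simp
        have e3 : 9 / ε * K = 6 / ε * K + 3 / ε * K := by ring
        linarith

lemma innerShell_boundary {G : Type*} [TopologicalSpace G] {φ : E3 → G} {f : S2 → G}
    (h : ∀ x : S2, Tendsto φ (𝓝[innerDomain] (x : E3)) (𝓝 (f x))) (x : S2) :
    Tendsto φ (𝓝[innerShell] (x : E3)) (𝓝 (f x)) :=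
  (h x).mono_left (nhdsWithin_mono _ innerShell_subset)

lemma ExteriorField.layerExtension_boundary (h : ExteriorField k e g p) (hε : 0 < ε) (x : S2) :
    Tendsto (layerExtension ε e) (𝓝[innerShell] (x : E3)) (𝓝 (g x)) := by
  have hx0 : (x : E3) ≠ 0 := ne_zero_of_mem_unit_sphere x
  have h1 : Tendsto (fun y : E3 => EuclideanGeometry.inversion (0 : E3) 1 y)
      (𝓝[innerShell] (x : E3)) (𝓝[outerDomain] (x : E3)) := by
    refine tendsto_nhdsWithin_iff.2 ⟨?_, ?_⟩
    · have := (EuclideanGeometry.hasFDerivAt_inversion (R := 1) hx0).continuousAt.tendsto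
      have e1 : EuclideanGeometry.inversion (0 : E3) 1 (x : E3) = x := by
        simpa using inversion_smul_sphere one_pos x
      rw [e1] at this
      exact this.mono_left nhdsWithin_le_nhds
    · filter_upwards [self_mem_nhdsWithin] with y hy using inversion_mem_outerDomain hy
  have h2 : Tendsto (fun y : E3 => (‖y‖ - 1 + ε) / ε) (𝓝[innerShell] (x : E3)) (𝓝 1) := by
    have : Tendsto (fun y : E3 => (‖y‖ - 1 + ε) / ε) (𝓝 (x : E3)) (𝓝 ((‖(x : E3)‖ - 1 + ε) / ε)) :=
      Continuous.tendsto (by fun_prop) _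
    rw [norm_sphere, sub_self, zero_add, div_self hε.ne'] at this
    exact this.mono_left nhdsWithin_le_nhds
  have h3 := h2.smul ((h.value x).comp h1)
  rwa [one_smul] at h3

/-- **Duality estimate**: the boundary values of an exterior field, paired with the normal
derivative of a solution in the ball, are controlled by the energy `A` and the mass `B` of that
solution, with the width `ε` of a boundary layer to choose. -/
lemma norm_pairing_le_layer (h : ExteriorField k e g p)
    (hK1 : ∀ r, 1 < r → r ≤ 2 → sphSq e r ≤ K)
    (hK2 : ∀ a, 1 < a → a ≤ 2 → ∫ r in a..2, r ^ 2 * sphGrad e r ≤ K)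
    {lam : ℂ} {u : E3 → ℂ} {gu q : S2 → ℂ} (hu : InteriorField lam u gu q) {A B : ℝ}
    (hA : Tendsto (energyIn u) (𝓝[<] 1) (𝓝 A)) (hB : Tendsto (massIn u) (𝓝[<] 1) (𝓝 B))
    (hε : 0 < ε) (hε2 : ε ≤ 1 / 2) :
    ‖pairing g q‖ ≤ Real.sqrt (9 / ε * K * A) + ‖lam‖ * Real.sqrt (ε * K * B) := by
  have hv := contDiffOn_layerExtension (ε := ε) h.contDiffOn_one
  set v := layerExtension ε e with hvdef
  have huS : ContDiffOn ℝ 2 u innerShell := hu.contDiffOn.mono innerShell_subset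
  have huS1 : ContDiffOn ℝ 1 u innerShell := huS.of_le (by norm_num)
  have hmem : ∀ r ∈ Ioo (1 / 3 : ℝ) 1, ∀ θ : S2, r • (θ : E3) ∈ innerShell :=
    fun _ hr => smul_mem_innerShell hr
  -- the flux of `conj v ∇u` tends to the pairing
  have hlim : Tendsto (fun s : ℝ => (s : ℂ) ^ 2 * sphFlux v u s) (𝓝[<] 1)
      (𝓝 ((1 : ℝ) ^ 2 * pairing g q)) := by
    refine ((Complex.continuous_ofReal.tendsto _).comp tendsto_id_one_left).pow 2 |>.mul ?_
    have h1 := (tendsto_integral_boundary (D := innerShell) (l := 𝓝[<] (1 : ℝ))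
      (φ := fun x => conj (v x) * normalDeriv u x) (h := fun x => conj (g x) * q x)
      nhdsWithin_le_nhds
      (by filter_upwards [Ioo_mem_nhdsLT (show (1 / 3 : ℝ) < 1 by norm_num)] with r hr using
        hmem r hr)
      ((Complex.continuous_conj.comp_continuousOn hv.continuousOn).mul
        (continuousOn_normalDeriv isOpen_innerShell huS1 fun x => ne_zero_of_mem_innerShell))
      fun x => ((Complex.continuous_conj.tendsto _).comp (h.layerExtension_boundary hε x)).mul
        (innerShell_boundary hu.deriv x)).2
    refine h1.congr' ?_
    filter_upwards [Ioo_mem_nhdsLT (zero_lt_one' ℝ)] with r hr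
    simp only [normalDeriv_smul_sphere _ hr.1]
    rfl
  rw [Complex.ofReal_one, one_pow, one_mul] at hlim
  refine le_of_tendsto hlim.norm ?_
  filter_upwards [Ioo_mem_nhdsLT (show 1 - ε < 1 by linarith)] with s hs
  have hs' : 1 - ε ≤ s := hs.1.le
  have hI : Icc (1 - ε) s ⊆ Ioo (1 / 3 : ℝ) 1 := fun t ht =>
    ⟨by linarith [ht.1], ht.2.trans_lt hs.2⟩
  have hmaps : MapsTo (fun p : ℝ × S2 => p.1 • (p.2 : E3)) (Icc (1 - ε) s ×ˢ univ) innerShell :=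
    fun p hp => hmem p.1 (hI hp.1) p.2
  have hsm : ContinuousOn (fun p : ℝ × S2 => p.1 • (p.2 : E3)) (Icc (1 - ε) s ×ˢ univ) := by
    fun_prop
  -- the two terms of Green's identity
  let G : ℝ → ℂ := fun t =>
    ∫ θ : S2, ∑ i, conj (pd i v (t • (θ : E3))) * pd i u (t • (θ : E3)) ∂surf
  let M : ℝ → ℂ := fun t => ∫ θ : S2, conj (v (t • (θ : E3))) * u (t • (θ : E3)) ∂surf
  have cpd : ∀ {w : E3 → ℂ}, ContDiffOn ℝ 1 w innerShell → ∀ i, ContinuousOn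
      (fun p : ℝ × S2 => pd i w (p.1 • (p.2 : E3))) (Icc (1 - ε) s ×ˢ univ) :=
    fun hw i => (continuousOn_pd isOpen_innerShell hw i).comp hsm hmaps
  have cG : ContinuousOn G (Icc (1 - ε) s) :=
    continuousOn_sphere_integral (continuousOn_finsetSum _ fun i _ =>
      (Complex.continuous_conj.comp_continuousOn (cpd hv i)).mul (cpd huS1 i))
  have cM : ContinuousOn M (Icc (1 - ε) s) :=
    continuousOn_sphere_integral ((Complex.continuous_conj.comp_continuousOn
      (hv.continuousOn.comp hsm hmaps)).mul (huS.continuousOn.comp hsm hmaps))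
  have cid : ContinuousOn (fun t : ℝ => (t : ℂ) ^ 2) (Icc (1 - ε) s) := by fun_prop
  have hder : ∀ t ∈ uIcc (1 - ε) s, HasDerivAt (fun s : ℝ => (s : ℂ) ^ 2 * sphFlux v u s)
      ((t : ℂ) ^ 2 * G t + lam * ((t : ℂ) ^ 2 * M t)) t := by
    intro t ht
    rw [uIcc_of_le hs'] at ht
    have h1 := hasDerivAt_green isOpen_innerShell hv huS isOpen_Ioo hmem (hI ht)
    refine h1.congr_deriv ?_
    have cp : ∀ {w : E3 → ℂ}, ContDiffOn ℝ 1 w innerShell → ∀ i,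
        Continuous fun θ : S2 => pd i w (t • (θ : E3)) := fun hw i =>
      continuous_restrict_sphere (continuousOn_pd isOpen_innerShell hw i) (hmem t (hI ht))
    have cv := continuous_restrict_sphere hv.continuousOn (hmem t (hI ht))
    have cu := continuous_restrict_sphere huS.continuousOn (hmem t (hI ht))
    have i1 : Integrable (fun θ : S2 =>
        ∑ i, conj (pd i v (t • (θ : E3))) * pd i u (t • (θ : E3))) surf :=
      integrable_sphere (continuous_finsetSum _ fun i _ =>
        (Complex.continuous_conj.comp (cp hv i)).mul (cp huS1 i))
    have i2 : Integrable (fun θ : S2 => conj (v (t • (θ : E3))) * u (t • (θ : E3))) surf :=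
      integrable_sphere ((Complex.continuous_conj.comp cv).mul cu)
    have e1 : ∀ θ : S2, conj (v (t • (θ : E3))) * Laplacian.laplacian u (t • (θ : E3))
        = lam * (conj (v (t • (θ : E3))) * u (t • (θ : E3))) := fun θ => by
      rw [hu.laplacian _ (innerShell_subset (hmem t (hI ht) θ))]; ring
    simp_rw [e1]
    rw [integral_add i1 (i2.const_mul _), integral_const_mul]
    ring
  have hint1 : IntervalIntegrable (fun t : ℝ => (t : ℂ) ^ 2 * G t) volume (1 - ε) s :=
    ContinuousOn.intervalIntegrable (by rw [uIcc_of_le hs']; exact cid.mul cG)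
  have hint2 : IntervalIntegrable (fun t : ℝ => (t : ℂ) ^ 2 * M t) volume (1 - ε) s :=
    ContinuousOn.intervalIntegrable (by rw [uIcc_of_le hs']; exact cid.mul cM)
  have key := intervalIntegral.integral_eq_sub_of_hasDerivAt hder
    (hint1.add (hint2.const_mul lam))
  have hzero : sphFlux v u (1 - ε) = 0 := by
    have : ∀ θ : S2, v ((1 - ε) • (θ : E3)) = 0 := fun θ => by
      rw [hvdef, layerExtension_smul_sphere (by linarith)]
      simp
    simp [sphFlux, this]
  rw [hzero, mul_zero, sub_zero, intervalIntegral.integral_add hint1 (hint2.const_mul lam),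
    intervalIntegral.integral_const_mul] at key
  have cs : ∀ {w : E3 → ℂ}, ContDiffOn ℝ 1 w innerShell → ContinuousOn
      (fun t => t ^ 2 * sphSq w t) (Icc (1 - ε) s) := fun hw =>
    (continuousOn_id.pow 2).mul ((continuousOn_sphSq hw.continuousOn hmem).mono hI)
  have cg : ∀ {w : E3 → ℂ}, ContDiffOn ℝ 1 w innerShell → ContinuousOn
      (fun t => t ^ 2 * sphGrad w t) (Icc (1 - ε) s) := fun hw =>
    (continuousOn_id.pow 2).mul ((continuousOn_sphGrad isOpen_innerShell hw hmem).mono hI)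
  have nn1 : ∀ (w : E3 → ℂ) t, 0 ≤ t ^ 2 * sphSq w t := fun w t =>
    mul_nonneg (sq_nonneg _) (sphSq_nonneg w t)
  have nn2 : ∀ (w : E3 → ℂ) t, 0 ≤ t ^ 2 * sphGrad w t := fun w t =>
    mul_nonneg (sq_nonneg _) (sphGrad_nonneg w t)
  have hnorm : ∀ F : ℝ → ℂ, ‖∫ t in (1 - ε)..s, (t : ℂ) ^ 2 * F t‖
      ≤ ∫ t in (1 - ε)..s, t ^ 2 * ‖F t‖ := fun F => by
    refine (intervalIntegral.norm_integral_le_integral_norm hs').trans (le_of_eq ?_)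
    refine intervalIntegral.integral_congr fun t _ => ?_
    simp
  have bG : (∫ t in (1 - ε)..s, t ^ 2 * ‖G t‖) ^ 2 ≤ 9 / ε * K * A := by
    refine (sq_integral_le_mul hs' ((continuousOn_id.pow 2).mul cG.norm) (cg hv) (cg huS1)
      (fun t _ => nn2 v t) (fun t _ => nn2 u t) fun t ht => ?_).trans ?_
    · have cp : ∀ {w : E3 → ℂ}, ContDiffOn ℝ 1 w innerShell → ∀ i,
          Continuous fun θ : S2 => pd i w (t • (θ : E3)) := fun hw i =>
        continuous_restrict_sphere (continuousOn_pd isOpen_innerShell hw i) (hmem t (hI ht))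
      have := norm_integral_sum_conj_mul_sq_le (fun i => cp hv i) (fun i => cp huS1 i)
      calc (t ^ 2 * ‖G t‖) ^ 2 = (t ^ 2) ^ 2 * ‖G t‖ ^ 2 := by ring
        _ ≤ (t ^ 2) ^ 2 * (sphGrad v t * sphGrad u t) := by gcongr; exact this
        _ = _ := by ring
    · have h1 := h.layer_energy_le hε hε2 hK1 hK2 hs' hs.2
      have h2 := integral_energy_le hu.contDiffOn_one hA (by linarith : 0 ≤ 1 - ε) hs' hs.2
      have h3 : 0 ≤ ∫ t in (1 - ε)..s, t ^ 2 * sphGrad v t :=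
        intervalIntegral.integral_nonneg hs' fun t _ => nn2 v t
      have h4 : 0 ≤ ∫ t in (1 - ε)..s, t ^ 2 * sphGrad u t :=
        intervalIntegral.integral_nonneg hs' fun t _ => nn2 u t
      exact mul_le_mul h1 h2 h4 (h3.trans h1)
  have bM : (∫ t in (1 - ε)..s, t ^ 2 * ‖M t‖) ^ 2 ≤ ε * K * B := by
    refine (sq_integral_le_mul hs' ((continuousOn_id.pow 2).mul cM.norm) (cs hv) (cs huS1)
      (fun t _ => nn1 v t) (fun t _ => nn1 u t) fun t ht => ?_).trans ?_
    · have := norm_integral_conj_mul_sq_le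
        (continuous_restrict_sphere hv.continuousOn (hmem t (hI ht)))
        (continuous_restrict_sphere huS.continuousOn (hmem t (hI ht)))
      calc (t ^ 2 * ‖M t‖) ^ 2 = (t ^ 2) ^ 2 * ‖M t‖ ^ 2 := by ring
        _ ≤ (t ^ 2) ^ 2 * (sphSq v t * sphSq u t) := by gcongr; exact this
        _ = _ := by ring
    · have h1 := h.layer_mass_le hε hε2 hK1 hs' hs.2
      have h2 := integral_mass_le hu.contDiffOn.continuousOn hB (by linarith : 0 ≤ 1 - ε) hs' hs.2
      have h3 : 0 ≤ ∫ t in (1 - ε)..s, t ^ 2 * sphSq v t :=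
        intervalIntegral.integral_nonneg hs' fun t _ => nn1 v t
      have h4 : 0 ≤ ∫ t in (1 - ε)..s, t ^ 2 * sphSq u t :=
        intervalIntegral.integral_nonneg hs' fun t _ => nn1 u t
      exact mul_le_mul h1 h2 h4 (h3.trans h1)
  change ‖(s : ℂ) ^ 2 * sphFlux v u s‖ ≤ _
  rw [← key]
  calc _ ≤ ‖∫ t in (1 - ε)..s, (t : ℂ) ^ 2 * G t‖
        + ‖lam * ∫ t in (1 - ε)..s, (t : ℂ) ^ 2 * M t‖ := norm_add_le _ _
    _ ≤ _ := by
        rw [norm_mul]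
        gcongr
        · exact (hnorm G).trans (Real.le_sqrt_of_sq_le bG)
        · exact (hnorm M).trans (Real.le_sqrt_of_sq_le bM)

end Shell

/-! ### Comparison of the penetrable ball with the obstacles -/

section Pairing

variable {f f' h h' : S2 → ℂ}

lemma integrable_conj_mul (hf : Continuous f) (hh : Continuous h) :
    Integrable (fun θ => conj (f θ) * h θ) surf :=
  integrable_sphere ((Complex.continuous_conj.comp hf).mul hh)

lemma pairing_sub_left (hf : Continuous f) (hf' : Continuous f') (hh : Continuous h) :
    pairing (fun θ => f θ - f' θ) h = pairing f h - pairing f' h := by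
  unfold pairing
  rw [← integral_sub (integrable_conj_mul hf hh) (integrable_conj_mul hf' hh)]
  simp only [map_sub, sub_mul]

lemma pairing_sub_right (hf : Continuous f) (hh : Continuous h) (hh' : Continuous h') :
    pairing f (fun θ => h θ - h' θ) = pairing f h - pairing f h' := by
  unfold pairing
  rw [← integral_sub (integrable_conj_mul hf hh) (integrable_conj_mul hf hh')]
  simp only [mul_sub]

lemma pairing_const_mul_right (c : ℂ) : pairing f (fun θ => c * h θ) = c * pairing f h := by
  unfold pairing
  rw [← integral_const_mul]
  simp only [mul_left_comm]

lemma pairing_const_left (c : ℂ) : pairing (fun _ => c) h = conj c * ∫ θ, h θ ∂surf :=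
  integral_const_mul _ _

lemma norm_pairing_sq_le (hf : Continuous f) (hh : Continuous h) :
    ‖pairing f h‖ ^ 2 ≤ l2Sq f * l2Sq h := norm_integral_conj_mul_sq_le hf hh

end Pairing

section Differences

variable {k : ℝ} {ui u v : E3 → ℂ} {g p g' p' F F' : S2 → ℂ}

lemma SolvesExterior.exteriorField (h : SolvesExterior k ui u g p) : ExteriorField k u g p :=
  ⟨h.1.1, fun x hx => by linear_combination h.1.2 x hx, h.2.1, h.2.2.1⟩

lemma SolvesExterior.differentiableAt (h : SolvesExterior k ui u g p) {x : E3}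
    (hx : x ∈ outerDomain) : DifferentiableAt ℝ u x :=
  (h.1.1.differentiableOn (by norm_num)).differentiableAt (isOpen_outerDomain.mem_nhds hx)

lemma ExteriorField.sub (h : ExteriorField k u g p) (h' : ExteriorField k v g' p') :
    ExteriorField k (fun x => u x - v x) (fun θ => g θ - g' θ) fun θ => p θ - p' θ where
  contDiffOn := h.contDiffOn.sub h'.contDiffOn
  laplacian x hx := by
    have hn := isOpen_outerDomain.mem_nhds hx
    have := ContDiffAt.laplacian_sub ((h.contDiffOn x hx).contDiffAt hn)
      ((h'.contDiffOn x hx).contDiffAt hn)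
    rw [h.laplacian x hx, h'.laplacian x hx] at this
    change Laplacian.laplacian (u - v) x = _
    rw [this]; ring
  value x := (h.value x).sub (h'.value x)
  deriv x := by
    refine ((h.deriv x).sub (h'.deriv x)).congr' ?_
    filter_upwards [self_mem_nhdsWithin] with y hy
    have hn := isOpen_outerDomain.mem_nhds hy
    simp only [normalDeriv]
    rw [fderiv_fun_sub ((h.contDiffOn.differentiableOn (by norm_num)).differentiableAt hn)
      ((h'.contDiffOn.differentiableOn (by norm_num)).differentiableAt hn)]
    rfl

/-- The difference of two total fields for the same incident field is radiating. -/
lemma SolvesExterior.sommerfeld_sub (hui : ContDiff ℝ 2 ui) (h : SolvesExterior k ui u g p)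
    (h' : SolvesExterior k ui v g' p') : Sommerfeld k fun x => u x - v x := by
  have h1 := h.2.2.2.sub h'.2.2.2
  rw [sub_zero] at h1
  refine h1.congr' ?_
  have hout : ∀ᶠ x in Bornology.cobounded E3, x ∈ outerDomain :=
    tendsto_norm_cobounded_atTop.eventually (eventually_gt_atTop 1)
  filter_upwards [hout] with x hx
  have d0 : DifferentiableAt ℝ ui x := (hui.differentiable (by norm_num)) x
  have d1 := h.differentiableAt hx
  have d2 := h'.differentiableAt hx
  simp only [normalDeriv]
  rw [fderiv_fun_sub d1 d0, fderiv_fun_sub d2 d0, fderiv_fun_sub d1 d2]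
  simp only [sub_apply]
  ring

lemma IsFarFieldPattern.sub (h : IsFarFieldPattern k (fun x => u x - ui x) F)
    (h' : IsFarFieldPattern k (fun x => v x - ui x) F') :
    IsFarFieldPattern k (fun x => u x - v x) fun θ => F θ - F' θ := by
  obtain ⟨C, R, hC⟩ := h
  obtain ⟨C', R', hC'⟩ := h'
  refine ⟨C + C', max R R', fun r hr θ => ?_⟩
  have h1 := hC r ((le_max_left _ _).trans hr) θ
  have h2 := hC' r ((le_max_right _ _).trans hr) θ
  calc _ = ‖(u (r • (θ : E3)) - ui (r • (θ : E3)) - Complex.exp (Complex.I * k * r) / r * F θ)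
        - (v (r • (θ : E3)) - ui (r • (θ : E3)) - Complex.exp (Complex.I * k * r) / r * F' θ)‖ := by
        congr 1; ring
    _ ≤ _ := norm_sub_le _ _
    _ ≤ C / r ^ 2 + C' / r ^ 2 := add_le_add h1 h2
    _ = _ := by ring

end Differences

/-- A total field for an obstacle, with Dirichlet data `g`, Neumann data `p` and far-field
pattern `F` of its scattered part. -/
structure ObstacleField (k : ℝ) (ui u : E3 → ℂ) (g p F : S2 → ℂ) : Prop where
  exterior : SolvesExterior k ui u g p
  farField : IsFarFieldPattern k (fun x => u x - ui x) F

/-- A total field for the penetrable ball with density contrast `δ`, in the normalization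
`Δu = δ z u` of the equation in the ball; the normal derivative from inside is `δ` times that from
outside. -/
structure PenetrableField (k δ : ℝ) (z : ℂ) (ui u : E3 → ℂ) (g p F : S2 → ℂ) : Prop
    extends ObstacleField k ui u g p F where
  interior : InteriorField ((δ : ℂ) * z) u g fun θ => (δ : ℂ) * p θ

/-- Consequences of the energy identity `a + z B = I + J` for a flux `I` through the sphere of a
radiating field, for `z` in a sector of the lower half plane. -/
lemma coercive {a B M L k : ℝ} {z I J : ℂ} (hB : 0 ≤ B) (hz : z.im < 0)
    (hL : |z.re| ≤ L * |z.im|) (hk : 0 ≤ k) (hI : 0 ≤ I.im)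
    (hR : I.re ≤ -(M / 2) + 2 * k * I.im) (h : (a : ℂ) + z * B = I + J) :
    a + ‖z‖ * B + M / 2 ≤ 2 * (L + k + 1) * ‖J‖ ∧ I.im ≤ ‖J‖ := by
  have hre := congrArg Complex.re h
  have him := congrArg Complex.im h
  simp at hre him
  have j1 := neg_le_of_abs_le (Complex.abs_im_le_norm J)
  have j2 := (le_abs_self _).trans (Complex.abs_re_le_norm J)
  have hI2 : I.im ≤ ‖J‖ := by nlinarith [mul_nonneg (neg_nonneg.2 hz.le) hB]
  have hzB : |z.im| * B ≤ ‖J‖ := by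
    rw [abs_of_neg hz]; linarith
  have hL0 : 0 ≤ L := by
    have h1 : 0 < |z.im| := abs_pos.2 hz.ne
    have h2 := abs_nonneg z.re
    by_contra hneg
    nlinarith
  have hzr : |z.re| * B ≤ L * ‖J‖ := by
    calc _ ≤ L * |z.im| * B := by gcongr
      _ = L * (|z.im| * B) := by ring
      _ ≤ _ := by gcongr
  have hzn : ‖z‖ * B ≤ (L + 1) * ‖J‖ := by
    calc _ ≤ (|z.re| + |z.im|) * B := by
          gcongr; exact Complex.norm_le_abs_re_add_abs_im z
      _ = |z.re| * B + |z.im| * B := by ring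
      _ ≤ _ := by linarith
  have hzr2 : -(|z.re| * B) ≤ z.re * B := by
    have := neg_abs_le z.re
    nlinarith
  have : k * I.im ≤ k * ‖J‖ := by gcongr
  refine ⟨?_, hI2⟩
  nlinarith

lemma le_of_sq_le_mul_self {x y : ℝ} (hy : 0 ≤ y) (h : x ^ 2 ≤ y * x) : x ≤ y := by
  rcases le_or_gt x 0 with h0 | h0
  · exact h0.trans hy
  · nlinarith

namespace PenetrableField

variable {k δ L : ℝ} {z : ℂ} {ui u v : E3 → ℂ} {g p F gv pv Fv : S2 → ℂ}

lemma exteriorField (h : PenetrableField k δ z ui u g p F) : ExteriorField k u g p :=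
  h.exterior.exteriorField

/-- The energy identity in the ball, divided by `δ`: here `δ a` is the Dirichlet integral of `u`,
`B` the mass of `u - c` and `Y` the integral of `u - c`. -/
lemma exists_energy (h : PenetrableField k δ z ui u g p F) (hδ : 0 < δ) (c : ℂ) :
    ∃ (a B : ℝ) (Y : ℂ), Tendsto (energyIn u) (𝓝[<] 1) (𝓝 (δ * a)) ∧
      Tendsto (massIn fun x => u x - c) (𝓝[<] 1) (𝓝 B) ∧ 0 ≤ a ∧ 0 ≤ B ∧
      pairing (fun θ => g θ - c) p = a + z * (B + c * conj Y) ∧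
      l2Sq (fun θ => g θ - c) ≤ δ * a + 4 * B ∧
      ‖(∫ θ, (g θ - c) ∂surf) - 3 * Y‖ ^ 2 ≤ sphMass * (δ * a) ∧
      ‖Y‖ ^ 2 ≤ sphMass * B := by
  obtain ⟨A, B, Y, hA, hB, hA0, hB0, hI, hM, hY1, hY2⟩ := h.interior.exists_limits c
  have hδc : (δ : ℂ) ≠ 0 := by exact_mod_cast hδ.ne'
  have e1 : δ * (A / δ) = A := mul_div_cancel₀ A hδ.ne'
  rw [pairing_const_mul_right] at hI
  refine ⟨A / δ, B, Y, by rwa [e1], hB, by positivity, hB0, ?_, by rwa [e1], by rwa [e1], hY2⟩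
  apply mul_left_cancel₀ hδc
  rw [hI]
  push_cast
  field_simp

/-- The energy estimate for the difference of the penetrable and the obstacle problem. -/
lemma energy_le (hk : 0 < k) (hui : ContDiff ℝ 2 ui) (hz : z.im < 0)
    (hL : |z.re| ≤ L * |z.im|) (h : PenetrableField k δ z ui u g p F)
    (hv : ObstacleField k ui v gv pv Fv) {a B : ℝ} {J : ℂ} (hB : 0 ≤ B)
    (hJ : (a : ℂ) + z * B = pairing (fun θ => g θ - gv θ) (fun θ => p θ - pv θ) + J) :
    a + ‖z‖ * B + l2Sq (fun θ => g θ - gv θ) / 2 ≤ 2 * (L + k + 1) * ‖J‖ ∧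
      k * l2Sq (fun θ => F θ - Fv θ) ≤ ‖J‖ := by
  have he := h.exteriorField.sub hv.exterior.exteriorField
  have hS := h.exterior.sommerfeld_sub hui hv.exterior
  have hF := h.farField.sub hv.farField
  have him := he.im_pairing hS hF
  have h0 := l2Sq_nonneg fun θ => F θ - Fv θ
  have := coercive hB hz hL hk.le (by rw [him]; positivity) (he.re_pairing_le hS hF) hJ
  rwa [him] at this

/-- The sound-soft limit. -/
lemma farField_sub_soft (hk : 0 < k) (hui : ContDiff ℝ 2 ui) (hz : z.im < 0)
    (hL : |z.re| ≤ L * |z.im|) (hL0 : 0 ≤ L) (hδ : 0 < δ) (h : PenetrableField k δ z ui u g p F)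
    (hv : ObstacleField k ui v (fun _ => 0) pv Fv) :
    k * l2Sq (fun θ => F θ - Fv θ) ≤ 2 * (L + k + 1) * l2Sq pv * (δ + 4 / ‖z‖) := by
  have hz0 : 0 < ‖z‖ := norm_pos_iff.2 fun h0 => by simp [h0] at hz
  obtain ⟨a, B, Y, -, -, ha0, hB0, hI, hM, -, -⟩ := h.exists_energy hδ 0
  have hg := h.exteriorField.continuous_value
  have hp := h.exteriorField.continuous_deriv
  have hpv := hv.exterior.exteriorField.continuous_deriv
  simp only [sub_zero, zero_mul, add_zero] at hI hM
  have hJ : (a : ℂ) + z * B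
      = pairing (fun θ => g θ - 0) (fun θ => p θ - pv θ) + pairing g pv := by
    simp only [sub_zero]
    rw [pairing_sub_right hg hp hpv, hI]; ring
  obtain ⟨h1, h2⟩ := energy_le hk hui hz hL h hv hB0 hJ
  simp only [sub_zero] at h1
  set J := ‖pairing g pv‖
  set N := 2 * (L + k + 1)
  have hJ0 : 0 ≤ J := norm_nonneg _
  have hP := l2Sq_nonneg pv
  have hg0 := l2Sq_nonneg g
  have ha : a ≤ N * J := by nlinarith [mul_nonneg hz0.le hB0]
  have hB : B ≤ N * J / ‖z‖ := by
    rw [le_div_iff₀ hz0]; linarith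
  have hM2 : l2Sq g ≤ N * (δ + 4 / ‖z‖) * J := by
    calc _ ≤ δ * (N * J) + 4 * (N * J / ‖z‖) := hM.trans (by gcongr)
      _ = _ := by ring
  refine h2.trans (le_of_sq_le_mul_self (by positivity) ?_)
  calc J ^ 2 ≤ l2Sq g * l2Sq pv := norm_pairing_sq_le hg hpv
    _ ≤ N * (δ + 4 / ‖z‖) * J * l2Sq pv := by gcongr
    _ = _ := by ring

/-- The energy identity when the obstacle field is the constant `c` on the sphere. -/
lemma energy_identity_const {c : ℂ} {a B : ℝ} {Y : ℂ} (h : PenetrableField k δ z ui u g p F)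
    (hv : ObstacleField k ui v (fun _ => c) pv Fv)
    (hI : pairing (fun θ => g θ - c) p = a + z * (B + c * conj Y)) :
    (a : ℂ) + z * B = pairing (fun θ => g θ - c) (fun θ => p θ - pv θ)
      + (pairing (fun θ => g θ - c) pv - z * c * conj Y) := by
  have hg : Continuous fun θ => g θ - c := h.exteriorField.continuous_value.sub continuous_const
  rw [pairing_sub_right hg h.exteriorField.continuous_deriv hv.exterior.exteriorField.continuous_deriv, hI]
  ring

/-- The limit with constant value and zero flux. -/
lemma farField_sub_constant {c : ℂ} (hk : 0 < k) (hui : ContDiff ℝ 2 ui) (hz : z.im < 0)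
    (hL : |z.re| ≤ L * |z.im|) (hL0 : 0 ≤ L) (hδ : 0 < δ) (h : PenetrableField k δ z ui u g p F)
    (hv : ObstacleField k ui v (fun _ => c) pv Fv) (hflux : ∫ θ, pv θ ∂surf = 0) :
    k * l2Sq (fun θ => F θ - Fv θ)
      ≤ 4 * (L + k + 1) * (129 * l2Sq pv * δ + ‖c‖ ^ 2 * sphMass * ‖z‖) := by
  obtain ⟨a, B, Y, hA, -, ha0, hB0, hI, -, -, hY⟩ := h.exists_energy hδ c
  have hg := h.exteriorField.continuous_value
  have hpv := hv.exterior.exteriorField.continuous_deriv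
  obtain ⟨h1, h2⟩ := energy_le hk hui hz hL h hv hB0 (h.energy_identity_const hv hI)
  set J := pairing (fun θ => g θ - c) pv - z * c * conj Y with hJ
  set N := 2 * (L + k + 1) with hN
  have hP := l2Sq_nonneg pv
  have hm := sphMass_nonneg
  have hM0 := l2Sq_nonneg fun θ => g θ - c
  have ha : a ≤ N * ‖J‖ := by nlinarith [mul_nonneg (norm_nonneg z) hB0]
  have hB : ‖z‖ * B ≤ N * ‖J‖ := by linarith
  have e1 : pairing (fun θ => g θ - c) pv = pairing g pv := by
    rw [pairing_sub_left hg continuous_const hpv, pairing_const_left, hflux, mul_zero, sub_zero]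
  have b1 : ‖pairing g pv‖ ^ 2 ≤ 129 * (δ * (N * ‖J‖)) * l2Sq pv :=
    (h.interior.norm_pairing_sq_le_of_mean_zero hA hpv hflux).trans (by gcongr)
  have b2 : ‖z * c * conj Y‖ ^ 2 ≤ ‖c‖ ^ 2 * sphMass * ‖z‖ * (N * ‖J‖) := by
    calc _ = ‖z‖ ^ 2 * ‖c‖ ^ 2 * ‖Y‖ ^ 2 := by rw [norm_mul, norm_mul, RCLike.norm_conj]; ring
      _ ≤ ‖z‖ ^ 2 * ‖c‖ ^ 2 * (sphMass * B) := by gcongr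
      _ = ‖c‖ ^ 2 * sphMass * ‖z‖ * (‖z‖ * B) := by ring
      _ ≤ _ := by gcongr
  refine h2.trans (le_of_sq_le_mul_self (by positivity) ?_)
  calc ‖J‖ ^ 2 ≤ (‖pairing g pv‖ + ‖z * c * conj Y‖) ^ 2 := by
        rw [hJ, e1]; gcongr; exact norm_sub_le _ _
    _ ≤ 2 * (‖pairing g pv‖ ^ 2 + ‖z * c * conj Y‖ ^ 2) := add_sq_le
    _ ≤ 2 * (129 * (δ * (N * ‖J‖)) * l2Sq pv + ‖c‖ ^ 2 * sphMass * ‖z‖ * (N * ‖J‖)) := by gcongr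
    _ = _ := by rw [hN]; ring

/-- The limit with the nonlocal boundary condition. Its flux condition says that `pv - z c / 3`
has mean zero. -/
lemma farField_sub_nonlocal {c : ℂ} (hk : 0 < k) (hui : ContDiff ℝ 2 ui) (hz : z.im < 0)
    (hL : |z.re| ≤ L * |z.im|) (hL0 : 0 ≤ L) (hδ : 0 < δ) (h : PenetrableField k δ z ui u g p F)
    (hv : ObstacleField k ui v (fun _ => c) pv Fv)
    (hflux : ∫ θ, pv θ ∂surf = z * c / 3 * sphMass) :
    k * l2Sq (fun θ => F θ - Fv θ) ≤ 4 * (L + k + 1) *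
      (129 * l2Sq (fun θ => pv θ - z * c / 3) + ‖z * c / 3‖ ^ 2 * sphMass) * δ := by
  obtain ⟨a, B, Y, hA, -, ha0, hB0, hI, -, hY, -⟩ := h.exists_energy hδ c
  have hg := h.exteriorField.continuous_value
  have hpv := hv.exterior.exteriorField.continuous_deriv
  obtain ⟨h1, h2⟩ := energy_le hk hui hz hL h hv hB0 (h.energy_identity_const hv hI)
  set J := pairing (fun θ => g θ - c) pv - z * c * conj Y with hJ
  set N := 2 * (L + k + 1) with hN
  set q : S2 → ℂ := fun θ => pv θ - z * c / 3 with hq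
  have hqc : Continuous q := hpv.sub continuous_const
  have hq0 : ∫ θ, q θ ∂surf = 0 := by
    rw [hq, integral_sub (integrable_sphere hpv) (integrable_const _), hflux, integral_const,
      Complex.real_smul]
    change z * c / 3 * sphMass - sphMass * (z * c / 3) = 0
    ring
  have hP := l2Sq_nonneg q
  have hm := sphMass_nonneg
  have hM0 := l2Sq_nonneg fun θ => g θ - c
  have ha : a ≤ N * ‖J‖ := by nlinarith [mul_nonneg (norm_nonneg z) hB0]
  have e0 : pairing (fun θ => g θ - c) q = pairing g q := by
    rw [pairing_sub_left hg continuous_const hqc, pairing_const_left, hq0, mul_zero, sub_zero]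
  have e2 : pairing (fun θ => g θ - c) (fun _ => z * c / 3)
      = z * c / 3 * conj (∫ θ, (g θ - c) ∂surf) := by
    rw [← integral_conj, pairing, integral_mul_const, mul_comm]
  have e1 : J = pairing g q + z * c / 3 * conj ((∫ θ, (g θ - c) ∂surf) - 3 * Y) := by
    have hgc : Continuous fun θ => g θ - c := hg.sub continuous_const
    rw [hJ, ← e0, hq, pairing_sub_right hgc hpv continuous_const, e2,
      map_sub, map_mul, Complex.conj_ofNat]
    ring
  have b1 : ‖pairing g q‖ ^ 2 ≤ 129 * (δ * (N * ‖J‖)) * l2Sq q :=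
    (h.interior.norm_pairing_sq_le_of_mean_zero hA hqc hq0).trans (by gcongr)
  have b2 : ‖z * c / 3 * conj ((∫ θ, (g θ - c) ∂surf) - 3 * Y)‖ ^ 2
      ≤ ‖z * c / 3‖ ^ 2 * (sphMass * (δ * (N * ‖J‖))) := by
    rw [norm_mul, RCLike.norm_conj, mul_pow]
    gcongr
    exact hY.trans (by gcongr)
  refine h2.trans (le_of_sq_le_mul_self (by positivity) ?_)
  calc ‖J‖ ^ 2 ≤ (‖pairing g q‖ + ‖z * c / 3 * conj ((∫ θ, (g θ - c) ∂surf) - 3 * Y)‖) ^ 2 := by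
        nth_rw 1 [e1]; gcongr; exact norm_add_le _ _
    _ ≤ 2 * (‖pairing g q‖ ^ 2 + ‖z * c / 3 * conj ((∫ θ, (g θ - c) ∂surf) - 3 * Y)‖ ^ 2) :=
        add_sq_le
    _ ≤ 2 * (129 * (δ * (N * ‖J‖)) * l2Sq q + ‖z * c / 3‖ ^ 2 * (sphMass * (δ * (N * ‖J‖)))) := by
        gcongr
    _ = _ := by rw [hN]; ring

/-- The duality estimate with a boundary layer of width `δ^(-1/2)`. -/
lemma norm_pairing_sq_le_layer (h : PenetrableField k δ z ui u g p F) (hδ : 4 ≤ δ) {a B : ℝ}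
    (ha : 0 ≤ a) (hB0 : 0 ≤ B)
    (hA : Tendsto (energyIn u) (𝓝[<] 1) (𝓝 (δ * a))) (hB : Tendsto (massIn u) (𝓝[<] 1) (𝓝 B))
    {e : E3 → ℂ} {ge pe : S2 → ℂ} {K : ℝ} (he : ExteriorField k e ge pe)
    (hK1 : ∀ r, 1 < r → r ≤ 2 → sphSq e r ≤ K)
    (hK2 : ∀ a, 1 < a → a ≤ 2 → ∫ r in a..2, r ^ 2 * sphGrad e r ≤ K) :
    ‖pairing ge p‖ ^ 2 ≤ 2 / Real.sqrt δ * K * (9 * a + ‖z‖ ^ 2 * B) := by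
  have hK : 0 ≤ K := (sphSq_nonneg e 2).trans (hK1 2 (by norm_num) le_rfl)
  have hδ0 : 0 < δ := by linarith
  set s := Real.sqrt δ with hs
  have hs2 : s ^ 2 = δ := Real.sq_sqrt hδ0.le
  have hs4 : 2 ≤ s := Real.le_sqrt_of_sq_le (by linarith)
  have hs0 : 0 < s := by linarith
  have key := norm_pairing_le_layer he hK1 hK2 h.interior hA hB (ε := 1 / s) (by positivity)
    (one_div_le_one_div_of_le two_pos hs4)
  rw [pairing_const_mul_right, norm_mul, norm_mul, Complex.norm_real,
    Real.norm_of_nonneg hδ0.le] at key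
  set X := Real.sqrt (9 / (1 / s) * K * (δ * a))
  set Z := Real.sqrt (1 / s * K * B)
  have hX : X ^ 2 = 9 / (1 / s) * K * (δ * a) := Real.sq_sqrt (by positivity)
  have hZ : Z ^ 2 = 1 / s * K * B := Real.sq_sqrt (by positivity)
  have h1 : (δ * ‖pairing ge p‖) ^ 2 ≤ 2 * (X ^ 2 + (δ * ‖z‖ * Z) ^ 2) :=
    (pow_le_pow_left₀ (by positivity) key 2).trans add_sq_le
  rw [mul_pow _ Z, hX, hZ, mul_pow δ ‖pairing ge p‖] at h1
  have h2 : 2 * (9 / (1 / s) * K * (δ * a) + (δ * ‖z‖) ^ 2 * (1 / s * K * B))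
      = δ ^ 2 * (2 / s * K * (9 * a + ‖z‖ ^ 2 * B)) := by
    rw [← hs2]; field_simp
  rw [h2] at h1
  exact le_of_mul_le_mul_left h1 (by positivity)

/-- The sound-hard limit. The energy is first estimated by pairing with the boundary values of the
obstacle field; a second use of the duality estimate, for the radiating difference, improves the
rate of the flux. -/
lemma farField_sub_hard (hk : 0 < k) (hui : ContDiff ℝ 2 ui) (hz : z.im < 0)
    (hL : |z.re| ≤ L * |z.im|) (hL0 : 0 ≤ L) (hδ : 4 ≤ δ) (h : PenetrableField k δ z ui u g p F)
    (hv : ObstacleField k ui v gv (fun _ => 0) Fv) {K : ℝ}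
    (hK1 : ∀ r, 1 < r → r ≤ 2 → sphSq v r ≤ K)
    (hK2 : ∀ a, 1 < a → a ≤ 2 → ∫ r in a..2, r ^ 2 * sphGrad v r ≤ K) :
    k * l2Sq (fun θ => F θ - Fv θ)
      ≤ (2 * (9 + ‖z‖) * (2 * (L + k + 1))) ^ 2 * K * (100 * (1 + k) ^ 3) / δ := by
  have hK : 0 ≤ K := (sphSq_nonneg v 2).trans (hK1 2 (by norm_num) le_rfl)
  have hδ0 : 0 < δ := by linarith
  obtain ⟨a, B, Y, hA, hB, ha0, hB0, hI, -, -, -⟩ := h.exists_energy hδ0 0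
  simp only [sub_zero, zero_mul, add_zero] at hB hI
  have hg := h.exteriorField.continuous_value
  have hp := h.exteriorField.continuous_deriv
  have hgv := hv.exterior.exteriorField.continuous_value
  have eI : pairing (fun θ => g θ - gv θ) (fun θ => p θ - 0) = pairing g p - pairing gv p := by
    simp only [sub_zero]
    exact pairing_sub_left hg hgv hp
  have hJ : (a : ℂ) + z * B
      = pairing (fun θ => g θ - gv θ) (fun θ => p θ - 0) + pairing gv p := by
    rw [eI, hI]; ring
  have h1 := (energy_le hk hui hz hL h hv hB0 hJ).1
  set J := ‖pairing gv p‖ with hJdef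
  set N := 2 * (L + k + 1) with hN
  have hN0 : 0 ≤ N := by positivity
  set s := Real.sqrt δ with hs
  have hs2 : s ^ 2 = δ := Real.sq_sqrt hδ0.le
  have hs0 : 0 < s := Real.sqrt_pos.2 hδ0
  have hM0 := l2Sq_nonneg fun θ => g θ - gv θ
  have hE : 9 * a + ‖z‖ ^ 2 * B ≤ (9 + ‖z‖) * N * J := by
    have h2 : 0 ≤ ‖z‖ * B := mul_nonneg (norm_nonneg z) hB0
    have h3 : a ≤ N * J := by linarith
    have h4 : ‖z‖ * (‖z‖ * B) ≤ ‖z‖ * (N * J) :=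
      mul_le_mul_of_nonneg_left (by linarith) (norm_nonneg z)
    nlinarith
  have hJ1 : J ≤ 2 / s * K * ((9 + ‖z‖) * N) := by
    refine le_of_sq_le_mul_self (by positivity) ?_
    calc J ^ 2 ≤ 2 / s * K * (9 * a + ‖z‖ ^ 2 * B) :=
          h.norm_pairing_sq_le_layer hδ ha0 hB0 hA hB hv.exterior.exteriorField hK1 hK2
      _ ≤ 2 / s * K * ((9 + ‖z‖) * N * J) := by gcongr
      _ = _ := by ring
  have he := h.exteriorField.sub hv.exterior.exteriorField
  have hS := h.exterior.sommerfeld_sub hui hv.exterior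
  have hF := h.farField.sub hv.farField
  obtain ⟨l1, l2⟩ := he.local_bound_of_radiating hk hS hF
  have hp0 : pairing (fun θ => g θ - gv θ) (fun θ => p θ - 0) = pairing (fun θ => g θ - gv θ) p := by
    simp only [sub_zero]
  have him := he.im_pairing hS hF
  rw [hp0] at l1 l2 him
  set I := ‖pairing (fun θ => g θ - gv θ) p‖ with hIdef
  have hI1 : I ≤ 2 / s * (100 * (1 + k) ^ 3) * ((9 + ‖z‖) * N * J) := by
    have hJ0 : 0 ≤ J := norm_nonneg _
    refine le_of_sq_le_mul_self (by positivity) ?_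
    calc I ^ 2 ≤ 2 / s * (100 * (1 + k) ^ 3 * I) * (9 * a + ‖z‖ ^ 2 * B) :=
          h.norm_pairing_sq_le_layer hδ ha0 hB0 hA hB he l1 l2
      _ ≤ 2 / s * (100 * (1 + k) ^ 3 * I) * ((9 + ‖z‖) * N * J) := by
          have : 0 ≤ I := norm_nonneg _
          gcongr
      _ = _ := by ring
  rw [← him]
  calc _ ≤ I := (le_abs_self _).trans (Complex.abs_im_le_norm _)
    _ ≤ _ := hI1
    _ ≤ 2 / s * (100 * (1 + k) ^ 3) * ((9 + ‖z‖) * N * (2 / s * K * ((9 + ‖z‖) * N))) := by gcongr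
    _ = _ := by rw [← hs2]; field_simp

end PenetrableField

/-! ### Coefficients and scattering problems -/

section SquareNorm

variable {F G : S2 → ℂ}

lemma memLp_of_continuous (hF : Continuous F) : MemLp F 2 surf := by
  obtain ⟨C, hC⟩ := isCompact_univ.exists_bound_of_continuousOn hF.continuousOn
  exact MemLp.of_bound (integrable_sphere hF).aestronglyMeasurable C
    (Eventually.of_forall fun θ => hC θ (mem_univ _))

lemma l2Dist_eq (hF : Continuous F) (hG : Continuous G) :
    l2Dist F G = ENNReal.ofReal (l2Sq (fun θ => F θ - G θ) ^ (1 / 2 : ℝ)) := by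
  have hc : Continuous fun θ => F θ - G θ := hF.sub hG
  rw [l2Dist, (memLp_of_continuous hc).eLpNorm_eq_integral_rpow_norm two_ne_zero
    ENNReal.ofNat_ne_top, l2Sq]
  norm_num

/-- A bound of the squared distance gives one of the distance. -/
lemma l2Dist_le {k D x : ℝ} (hk : 0 < k) (hF : Continuous F) (hG : Continuous G) (hD : 0 ≤ D)
    (hx : 0 ≤ x) (h : k * l2Sq (fun θ => F θ - G θ) ≤ D * x) :
    l2Dist F G ≤ ENNReal.ofReal ((D / k) ^ (1 / 2 : ℝ) * x ^ (1 / 2 : ℝ)) := by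
  rw [l2Dist_eq hF hG, ← Real.mul_rpow (by positivity) hx]
  refine ENNReal.ofReal_le_ofReal (Real.rpow_le_rpow (l2Sq_nonneg _) ?_ (by norm_num))
  rw [div_mul_eq_mul_div, le_div_iff₀ hk]
  linarith

lemma l2Dist_le_add {k D x y : ℝ} (hk : 0 < k) (hF : Continuous F) (hG : Continuous G)
    (hD : 0 ≤ D) (hx : 0 ≤ x) (hy : 0 ≤ y)
    (h : k * l2Sq (fun θ => F θ - G θ) ≤ D * (x + y)) :
    l2Dist F G ≤ ENNReal.ofReal
      ((D / k) ^ (1 / 2 : ℝ) * (x ^ (1 / 2 : ℝ) + y ^ (1 / 2 : ℝ))) := by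
  refine (l2Dist_le hk hF hG hD (by positivity) h).trans (ENNReal.ofReal_le_ofReal ?_)
  gcongr
  exact Real.rpow_add_le_add_rpow hx hy (by norm_num) (by norm_num)

end SquareNorm

section Coefficients

variable {ρ κ ω α β κ₀ : ℝ}

lemma wavenumber_pos (hρ : 0 < ρ) (hκ : 0 < κ) (hω : 0 < ω) : 0 < wavenumber ρ κ ω := by
  unfold wavenumber; positivity

lemma wavenumber_sq (hρ : 0 < ρ) (hκ : 0 < κ) : wavenumber ρ κ ω ^ 2 = ω ^ 2 * ρ / κ := by
  rw [wavenumber, mul_pow, Real.sq_sqrt (by positivity)]; ring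

/-- The coefficient `z` for which the equation in a ball with density `δ ρ` and bulk modulus `κ'`
reads `Δu = δ z u`. -/
noncomputable def innerCoeff (ρ ω : ℝ) (κ' : ℂ) : ℂ := -((ω : ℂ) ^ 2 * ρ / κ')

lemma bulkModulus_ne_zero (hβ : 0 < β) (hκ₀ : 0 < κ₀) : bulkModulus α β κ₀ ≠ 0 := by
  intro h
  have := congrArg Complex.im h
  simp [bulkModulus] at this
  rcases this with h | h <;> linarith

lemma innerCoeff_eq (hβ : 0 < β) (hκ₀ : 0 < κ₀) : innerCoeff ρ ω (bulkModulus α β κ₀)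
    = ((-(ω ^ 2 * ρ / (κ₀ * (α ^ 2 + β ^ 2))) : ℝ) : ℂ) * (α + β * Complex.I) := by
  have h1 := bulkModulus_ne_zero (α := α) hβ hκ₀
  have h2 : ((κ₀ * (α ^ 2 + β ^ 2) : ℝ) : ℂ) ≠ 0 := by
    have : 0 < κ₀ * (α ^ 2 + β ^ 2) := by positivity
    exact_mod_cast this.ne'
  have h3 : bulkModulus α β κ₀ * (α + β * Complex.I) = ((κ₀ * (α ^ 2 + β ^ 2) : ℝ) : ℂ) := by
    unfold bulkModulus
    push_cast
    linear_combination -(κ₀ : ℂ) * β ^ 2 * Complex.I_sq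
  rw [innerCoeff, Complex.ofReal_neg, Complex.ofReal_div, neg_mul, neg_inj, div_mul_eq_mul_div,
    div_eq_div_iff h1 h2, ← h3]
  push_cast
  ring

lemma innerCoeff_im_neg (hρ : 0 < ρ) (hω : 0 < ω) (hβ : 0 < β) (hκ₀ : 0 < κ₀) :
    (innerCoeff ρ ω (bulkModulus α β κ₀)).im < 0 := by
  rw [innerCoeff_eq hβ hκ₀, Complex.im_ofReal_mul]
  simp
  positivity

lemma abs_re_innerCoeff_le (hβ : 0 < β) (hκ₀ : 0 < κ₀) :
    |(innerCoeff ρ ω (bulkModulus α β κ₀)).re|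
      ≤ |α| / β * |(innerCoeff ρ ω (bulkModulus α β κ₀)).im| := by
  rw [innerCoeff_eq hβ hκ₀, Complex.im_ofReal_mul, Complex.re_ofReal_mul, abs_mul, abs_mul]
  simp only [Complex.add_re, Complex.ofReal_re, Complex.mul_re, Complex.I_re, mul_zero,
    Complex.ofReal_im, Complex.I_im, mul_one, sub_self, add_zero, Complex.add_im, Complex.mul_im,
    zero_add]
  rw [abs_of_pos hβ]
  refine le_of_eq ?_
  field_simp

lemma absTau_pos (hκ : 0 < κ) (hβ : 0 < β) (hκ₀ : 0 < κ₀) : 0 < absTau κ α β κ₀ := by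
  refine norm_pos_iff.2 (div_ne_zero (bulkModulus_ne_zero hβ hκ₀) ?_)
  exact_mod_cast hκ.ne'

lemma absTau_eq (hκ : 0 < κ) (hκ₀ : 0 < κ₀) :
    absTau κ α β κ₀ = κ₀ * absTau κ α β 1 := by
  simp [absTau, bulkModulus, abs_of_pos hκ, abs_of_pos hκ₀, mul_div_assoc]

lemma norm_innerCoeff (hρ : 0 < ρ) (hκ : 0 < κ) :
    ‖innerCoeff ρ ω (bulkModulus α β κ₀)‖ = wavenumber ρ κ ω ^ 2 / absTau κ α β κ₀ := by
  rw [wavenumber_sq hρ hκ, absTau, innerCoeff]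
  simp only [norm_neg, norm_div, norm_mul, norm_pow, Complex.norm_real, Real.norm_eq_abs, sq_abs,
    abs_of_pos hρ, abs_of_pos hκ]
  field_simp

end Coefficients

section Problems

variable {ρ κ ω δ : ℝ} {κ' : ℂ} {ui u : E3 → ℂ} {F : S2 → ℂ}

lemma IsFarFieldOf.exists_penetrableField (hρ : 0 < ρ) (hκ : 0 < κ) (hδ : 0 < δ)
    (h : IsFarFieldOf (wavenumber ρ κ ω) ui (SolvesTransmission ρ κ ω (δ * ρ) κ' ui) F) :
    ∃ u g p, PenetrableField (wavenumber ρ κ ω) δ (innerCoeff ρ ω κ') ui u g p F := by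
  obtain ⟨u, ⟨ho, hi, ⟨g, hg1, hg2⟩, ⟨p, q, hp, hq, hpq⟩, hS⟩, hF⟩ := h
  have hρc : (ρ : ℂ) ≠ 0 := by exact_mod_cast hρ.ne'
  have hκc : (κ : ℂ) ≠ 0 := by exact_mod_cast hκ.ne'
  have hδc : (δ : ℂ) ≠ 0 := by exact_mod_cast hδ.ne'
  have hk : (wavenumber ρ κ ω : ℂ) ^ 2 = (ω : ℂ) ^ 2 * ρ / κ := by
    exact_mod_cast congrArg Complex.ofReal (wavenumber_sq (ω := ω) hρ hκ)
  have hqp : q = fun θ => (δ : ℂ) * p θ := by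
    funext θ
    have := hpq θ
    push_cast at this
    field_simp at this
    rw [← this, mul_comm]
  refine ⟨u, g, p, ⟨⟨⟨ho.1, fun x hx => ?_⟩, hg1, hp, hS⟩, hF⟩, ⟨hi.1, fun x hx => ?_, hg2, ?_⟩⟩
  · have := ho.2 x hx
    rw [hk]
    field_simp at this ⊢
    linear_combination this
  · have := hi.2 x hx
    rw [innerCoeff]
    push_cast at this
    have h2 : (δ : ℂ) * ρ * (1 / (δ * ρ) * Laplacian.laplacian u x + ω ^ 2 * (1 / κ') * u x) = 0 := by
      rw [this, mul_zero]
    have h3 : (δ : ℂ) * ρ * (1 / (δ * ρ)) = 1 := by field_simp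
    linear_combination h2 - h3 * Laplacian.laplacian u x
  · rw [← hqp]; exact hq

lemma ObstacleField.continuous {k : ℝ} {g p : S2 → ℂ} (hui : ContDiff ℝ 2 ui)
    (h : ObstacleField k ui u g p F) : Continuous F :=
  continuous_farField (h.exterior.1.1.continuousOn.sub hui.continuous.continuousOn) h.farField

lemma sphMass_eq : sphMass = 3 * ballVolume := by
  have h1 : innerDomain = Metric.ball (0 : E3) 1 := by
    ext x; simp [innerDomain]
  have h2 := (volume : Measure E3).toSphere_real_apply_univ
  rw [ballVolume, h1, sphMass, surf, h2]
  simp [measureReal_def]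

lemma ballVolume_pos : 0 < ballVolume := by
  have h1 : innerDomain = Metric.ball (0 : E3) 1 := by
    ext x; simp [innerDomain]
  rw [ballVolume, h1]
  exact ENNReal.toReal_pos (Metric.measure_ball_pos _ _ one_pos).ne' measure_ball_lt_top.ne

lemma IsFarFieldOf.exists_nonlocal (hρ : 0 < ρ) (hω : 0 < ω) (hκ' : κ' ≠ 0)
    (h : IsFarFieldOf (wavenumber ρ κ ω) ui (SolvesNonlocal ρ κ ω κ' ui) F) :
    ∃ (u : E3 → ℂ) (c : ℂ) (p : S2 → ℂ),
      ObstacleField (wavenumber ρ κ ω) ui u (fun _ => c) p F ∧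
      ∫ θ, p θ ∂surf = innerCoeff ρ ω κ' * c / 3 * sphMass := by
  obtain ⟨u, ⟨g, p, hE, hcond⟩, hF⟩ := h
  have hρc : (ρ : ℂ) ≠ 0 := by exact_mod_cast hρ.ne'
  have hωc : (ω : ℂ) ≠ 0 := by exact_mod_cast hω.ne'
  have hV : (ballVolume : ℂ) ≠ 0 := by exact_mod_cast ballVolume_pos.ne'
  obtain ⟨x₀⟩ : Nonempty S2 := ⟨⟨e3 0, by simp [e3]⟩⟩
  have hg : g = fun _ => g x₀ := by
    funext x
    have h1 : (ω : ℂ) ^ 2 / κ' * ballVolume ≠ 0 := by positivity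
    exact mul_left_cancel₀ h1 (add_left_cancel ((hcond x).trans (hcond x₀).symm))
  refine ⟨u, g x₀, p, ⟨by rwa [← hg], hF⟩, ?_⟩
  have h1 := hcond x₀
  rw [integral_const_mul] at h1
  rw [sphMass_eq, innerCoeff]
  push_cast
  field_simp at h1 ⊢
  linear_combination h1

lemma IsFarFieldOf.exists_constantValue
    (h : IsFarFieldOf (wavenumber ρ κ ω) ui (SolvesConstantValue ρ κ ω ui) F) :
    ∃ (u : E3 → ℂ) (c : ℂ) (p : S2 → ℂ),
      ObstacleField (wavenumber ρ κ ω) ui u (fun _ => c) p F ∧ ∫ θ, p θ ∂surf = 0 := by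
  obtain ⟨u, ⟨g, p, hE, ⟨c, hc⟩, hp⟩, hF⟩ := h
  obtain rfl : g = fun _ => c := funext hc
  exact ⟨u, c, p, ⟨hE, hF⟩, hp⟩

lemma IsFarFieldOf.exists_soundSoft
    (h : IsFarFieldOf (wavenumber ρ κ ω) ui (SolvesSoundSoft ρ κ ω ui) F) :
    ∃ (u : E3 → ℂ) (p : S2 → ℂ), ObstacleField (wavenumber ρ κ ω) ui u (fun _ => 0) p F := by
  obtain ⟨u, ⟨g, p, hE, hc⟩, hF⟩ := h
  obtain rfl : g = fun _ => 0 := funext hc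
  exact ⟨u, p, hE, hF⟩

lemma IsFarFieldOf.exists_soundHard
    (h : IsFarFieldOf (wavenumber ρ κ ω) ui (SolvesSoundHard ρ κ ω ui) F) :
    ∃ (u : E3 → ℂ) (g : S2 → ℂ), ObstacleField (wavenumber ρ κ ω) ui u g (fun _ => 0) F := by
  obtain ⟨u, ⟨g, p, hE, hc⟩, hF⟩ := h
  obtain rfl : p = fun _ => 0 := funext hc
  exact ⟨u, g, hE, hF⟩

end Problems

/-- A bound by a multiple of a quantity tending to zero gives convergence. -/
lemma tendsto_zero_of_eventually_le {ι : Type*} {l : Filter ι} {f : ι → ENNReal} {x : ι → ℝ}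
    {C : ℝ} (hx : Tendsto x l (𝓝 0)) (h : ∀ᶠ i in l, f i ≤ ENNReal.ofReal (C * x i)) :
    Tendsto f l (𝓝 0) := by
  have h1 : Tendsto (fun i => ENNReal.ofReal (C * x i)) l (𝓝 0) := by
    have := ENNReal.tendsto_ofReal (hx.const_mul C)
    simpa using this
  exact tendsto_of_tendsto_of_tendsto_of_le_of_le' tendsto_const_nhds h1
    (Eventually.of_forall fun _ => zero_le) h

lemma tendsto_rpow_half_zero : Tendsto (fun x : ℝ => x ^ (1 / 2 : ℝ)) (𝓝[>] 0) (𝓝 0) := by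
  have := (Real.continuousAt_rpow_const 0 (1 / 2 : ℝ) (Or.inr (by norm_num))).tendsto
  rw [Real.zero_rpow (by norm_num)] at this
  exact this.mono_left nhdsWithin_le_nhds

lemma tendsto_absTau_zero {κ α β : ℝ} (hκ : 0 < κ) (hβ : 0 < β) :
    Tendsto (absTau κ α β) (𝓝[>] 0) (𝓝[>] 0) := by
  refine tendsto_nhdsWithin_iff.2 ⟨?_, ?_⟩
  · have h1 : Tendsto (fun x : ℝ => x * absTau κ α β 1) (𝓝[>] 0) (𝓝 (0 * absTau κ α β 1)) :=
      ((continuous_id.mul continuous_const).tendsto 0).mono_left nhdsWithin_le_nhds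
    rw [zero_mul] at h1
    refine h1.congr' ?_
    filter_upwards [self_mem_nhdsWithin] with x hx using (absTau_eq hκ hx).symm
  · filter_upwards [self_mem_nhdsWithin] with x hx using absTau_pos hκ hβ hx

lemma tendsto_absTau_atTop {κ α β : ℝ} (hκ : 0 < κ) (hβ : 0 < β) :
    Tendsto (absTau κ α β) atTop atTop := by
  refine (tendsto_id.atTop_mul_const (absTau_pos (α := α) hκ hβ one_pos)).congr' ?_
  filter_upwards [eventually_gt_atTop 0] with x hx using (absTau_eq hκ hx).symm

/-- `Fd δ κ₀` is the far-field pattern of the transmission problem with density `δ ρ` and bulk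
modulus `κ₀ (α - β i)` in the unit ball; `Fv κ₀`, `Ft`, `Fw`, `Fu` are those of the four
obstacle problems. -/
theorem corollary4p2 (ρ κ ω α β : ℝ) (hρ : 0 < ρ) (hκ : 0 < κ) (hω : 0 < ω) (hβ : 0 < β)
    (ui : E3 → ℂ) (hui : IsIncident (wavenumber ρ κ ω) ui)
    (Fd : ℝ → ℝ → S2 → ℂ) (Fv : ℝ → S2 → ℂ) (Ft Fw Fu : S2 → ℂ)
    (hFd : ∀ δ κ₀ : ℝ, 0 < δ → 0 < κ₀ → IsFarFieldOf (wavenumber ρ κ ω) ui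
      (SolvesTransmission ρ κ ω (δ * ρ) (bulkModulus α β κ₀) ui) (Fd δ κ₀))
    (hFv : ∀ κ₀ : ℝ, 0 < κ₀ → IsFarFieldOf (wavenumber ρ κ ω) ui
      (SolvesNonlocal ρ κ ω (bulkModulus α β κ₀) ui) (Fv κ₀))
    (hFt : IsFarFieldOf (wavenumber ρ κ ω) ui (SolvesConstantValue ρ κ ω ui) Ft)
    (hFw : IsFarFieldOf (wavenumber ρ κ ω) ui (SolvesSoundSoft ρ κ ω ui) Fw)
    (hFu : IsFarFieldOf (wavenumber ρ κ ω) ui (SolvesSoundHard ρ κ ω ui) Fu) :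
    -- all the patterns belong to `L²(S²)`
    ((∀ δ κ₀ : ℝ, 0 < δ → 0 < κ₀ → MemLp (Fd δ κ₀) 2 surf) ∧
      (∀ κ₀ : ℝ, 0 < κ₀ → MemLp (Fv κ₀) 2 surf) ∧
      MemLp Ft 2 surf ∧ MemLp Fw 2 surf ∧ MemLp Fu 2 surf) ∧
    -- `δ → ∞`
    (∀ κ₀ : ℝ, 0 < κ₀ →
      Tendsto (fun δ => l2Dist (Fd δ κ₀) Fu) atTop (𝓝 0) ∧
      ∃ C : ℝ, ∀ᶠ δ in atTop,
        l2Dist (Fd δ κ₀) Fu ≤ ENNReal.ofReal (C * δ ^ (-(1 / 2) : ℝ))) ∧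
    -- `δ → 0` and `|τ| → 0`
    (Tendsto (fun q : ℝ × ℝ => l2Dist (Fd q.1 q.2) Fw) (𝓝[>] 0 ×ˢ 𝓝[>] 0) (𝓝 0) ∧
      ∃ C : ℝ, ∀ᶠ q : ℝ × ℝ in 𝓝[>] 0 ×ˢ 𝓝[>] 0,
        l2Dist (Fd q.1 q.2) Fw ≤ ENNReal.ofReal
          (C * (q.1 ^ (1 / 2 : ℝ) + absTau κ α β q.2 ^ (1 / 2 : ℝ)))) ∧
    -- `δ → 0`
    (∀ κ₀ : ℝ, 0 < κ₀ →
      Tendsto (fun δ => l2Dist (Fd δ κ₀) (Fv κ₀)) (𝓝[>] 0) (𝓝 0) ∧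
      ∃ C : ℝ, ∀ᶠ δ in 𝓝[>] 0,
        l2Dist (Fd δ κ₀) (Fv κ₀) ≤ ENNReal.ofReal (C * δ ^ (1 / 2 : ℝ))) ∧
    -- `δ → 0` and `|τ| → ∞`
    (Tendsto (fun q : ℝ × ℝ => l2Dist (Fd q.1 q.2) Ft) (𝓝[>] 0 ×ˢ atTop) (𝓝 0) ∧
      ∃ C : ℝ, ∀ᶠ q : ℝ × ℝ in 𝓝[>] 0 ×ˢ atTop,
        l2Dist (Fd q.1 q.2) Ft ≤ ENNReal.ofReal
          (C * (q.1 ^ (1 / 2 : ℝ) + absTau κ α β q.2 ^ (-(1 / 2) : ℝ)))) := by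
  set k := wavenumber ρ κ ω with hkdef
  have hk : 0 < k := wavenumber_pos hρ hκ hω
  have hu := hui.1
  set L := |α| / β with hLdef
  have hL0 : 0 ≤ L := by positivity
  have hpen : ∀ δ κ₀ : ℝ, 0 < δ → 0 < κ₀ → ∃ u g p, PenetrableField k δ
      (innerCoeff ρ ω (bulkModulus α β κ₀)) ui u g p (Fd δ κ₀) := fun δ κ₀ h1 h2 =>
    (hFd δ κ₀ h1 h2).exists_penetrableField hρ hκ h1
  have hz : ∀ {κ₀ : ℝ}, 0 < κ₀ → (innerCoeff ρ ω (bulkModulus α β κ₀)).im < 0 :=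
    fun h => innerCoeff_im_neg hρ hω hβ h
  have hL : ∀ {κ₀ : ℝ}, 0 < κ₀ → |(innerCoeff ρ ω (bulkModulus α β κ₀)).re|
      ≤ L * |(innerCoeff ρ ω (bulkModulus α β κ₀)).im| := fun h => abs_re_innerCoeff_le hβ h
  have hnl := fun (κ₀ : ℝ) (h : 0 < κ₀) =>
    (hFv κ₀ h).exists_nonlocal hρ hω (bulkModulus_ne_zero hβ h)
  obtain ⟨ut, ct, pt, ht, htflux⟩ := hFt.exists_constantValue
  obtain ⟨uw, pw, hw⟩ := hFw.exists_soundSoft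
  obtain ⟨uh, gh, hh⟩ := hFu.exists_soundHard
  have cd : ∀ δ κ₀ : ℝ, 0 < δ → 0 < κ₀ → Continuous (Fd δ κ₀) := fun δ κ₀ h1 h2 => by
    obtain ⟨u, g, p, h⟩ := hpen δ κ₀ h1 h2
    exact h.toObstacleField.continuous hu
  have cv : ∀ κ₀ : ℝ, 0 < κ₀ → Continuous (Fv κ₀) := fun κ₀ h => by
    obtain ⟨u, c, p, h, -⟩ := hnl κ₀ h
    exact h.continuous hu
  have ct' := ht.continuous hu
  have cw := hw.continuous hu
  have ch := hh.continuous hu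
  refine ⟨⟨fun δ κ₀ h1 h2 => memLp_of_continuous (cd δ κ₀ h1 h2),
    fun κ₀ h => memLp_of_continuous (cv κ₀ h), memLp_of_continuous ct', memLp_of_continuous cw,
    memLp_of_continuous ch⟩, fun κ₀ hκ₀ => ?_, ?_, fun κ₀ hκ₀ => ?_, ?_⟩
  · obtain ⟨K, hK0, hK1, hK2⟩ := hh.exterior.exteriorField.exists_local_bound
    set D := (2 * (9 + ‖innerCoeff ρ ω (bulkModulus α β κ₀)‖) * (2 * (L + k + 1))) ^ 2 * K
      * (100 * (1 + k) ^ 3)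
    have hbound : ∀ᶠ δ in atTop, l2Dist (Fd δ κ₀) Fu
        ≤ ENNReal.ofReal ((D / k) ^ (1 / 2 : ℝ) * δ ^ (-(1 / 2) : ℝ)) := by
      filter_upwards [eventually_ge_atTop 4] with δ hδ
      have hδ0 : 0 < δ := by linarith
      obtain ⟨u, g, p, h⟩ := hpen δ κ₀ hδ0 hκ₀
      rw [Real.rpow_neg hδ0.le, ← Real.inv_rpow hδ0.le]
      refine l2Dist_le hk (cd δ κ₀ hδ0 hκ₀) ch (by positivity) (by positivity) ?_
      have := h.farField_sub_hard hk hu (hz hκ₀) (hL hκ₀) hL0 hδ hh hK1 hK2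
      rwa [div_eq_mul_inv] at this
    exact ⟨tendsto_zero_of_eventually_le (tendsto_rpow_neg_atTop (by norm_num)) hbound, _, hbound⟩
  · have hP := l2Sq_nonneg pw
    set D := 2 * (L + k + 1) * l2Sq pw * (1 + 4 / k ^ 2)
    have hbound : ∀ᶠ q : ℝ × ℝ in 𝓝[>] 0 ×ˢ 𝓝[>] 0, l2Dist (Fd q.1 q.2) Fw ≤ ENNReal.ofReal
        ((D / k) ^ (1 / 2 : ℝ) * (q.1 ^ (1 / 2 : ℝ) + absTau κ α β q.2 ^ (1 / 2 : ℝ))) := by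
      filter_upwards [prod_mem_prod self_mem_nhdsWithin self_mem_nhdsWithin] with q hq
      have h1 : 0 < q.1 := hq.1
      have h2 : 0 < q.2 := hq.2
      have hτ : 0 < absTau κ α β q.2 := absTau_pos hκ hβ h2
      obtain ⟨u, g, p, h⟩ := hpen _ _ h1 h2
      refine l2Dist_le_add hk (cd _ _ h1 h2) cw (by positivity) h1.le hτ.le ?_
      refine (h.farField_sub_soft hk hu (hz h2) (hL h2) hL0 h1 hw).trans ?_
      rw [norm_innerCoeff hρ hκ, ← hkdef]
      have e1 : 4 / (k ^ 2 / absTau κ α β q.2) = 4 / k ^ 2 * absTau κ α β q.2 := by field_simp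
      have e2 : q.1 + 4 / k ^ 2 * absTau κ α β q.2
          ≤ (1 + 4 / k ^ 2) * (q.1 + absTau κ α β q.2) := by
        have : 0 ≤ 4 / k ^ 2 * q.1 := by positivity
        nlinarith
      rw [e1]
      calc _ ≤ 2 * (L + k + 1) * l2Sq pw * ((1 + 4 / k ^ 2) * (q.1 + absTau κ α β q.2)) := by
            gcongr
        _ = _ := by ring
    refine ⟨tendsto_zero_of_eventually_le ?_ hbound, _, hbound⟩
    have hlim : Tendsto (fun q : ℝ × ℝ => q.1 ^ (1 / 2 : ℝ) + absTau κ α β q.2 ^ (1 / 2 : ℝ))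
        (𝓝[>] 0 ×ˢ 𝓝[>] 0) (𝓝 (0 + 0)) := (tendsto_rpow_half_zero.comp tendsto_fst).add
      (tendsto_rpow_half_zero.comp ((tendsto_absTau_zero hκ hβ).comp tendsto_snd))
    rwa [add_zero] at hlim
  · obtain ⟨uv, c, pv, hv, hflux⟩ := hnl κ₀ hκ₀
    set z := innerCoeff ρ ω (bulkModulus α β κ₀)
    have hP := l2Sq_nonneg fun θ => pv θ - z * c / 3
    have hm := sphMass_nonneg
    set D := 4 * (L + k + 1) *
      (129 * l2Sq (fun θ => pv θ - z * c / 3) + ‖z * c / 3‖ ^ 2 * sphMass)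
    have hbound : ∀ᶠ δ in 𝓝[>] 0, l2Dist (Fd δ κ₀) (Fv κ₀)
        ≤ ENNReal.ofReal ((D / k) ^ (1 / 2 : ℝ) * δ ^ (1 / 2 : ℝ)) := by
      filter_upwards [self_mem_nhdsWithin] with δ hδ
      have hδ0 : 0 < δ := hδ
      obtain ⟨u, g, p, h⟩ := hpen δ κ₀ hδ0 hκ₀
      exact l2Dist_le hk (cd δ κ₀ hδ0 hκ₀) (cv κ₀ hκ₀) (by positivity) hδ0.le
        (h.farField_sub_nonlocal hk hu (hz hκ₀) (hL hκ₀) hL0 hδ0 hv hflux)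
    exact ⟨tendsto_zero_of_eventually_le tendsto_rpow_half_zero hbound, _, hbound⟩
  · have hP := l2Sq_nonneg pt
    have hm := sphMass_nonneg
    set D := 4 * (L + k + 1) * (129 * l2Sq pt + ‖ct‖ ^ 2 * sphMass * k ^ 2)
    have hbound : ∀ᶠ q : ℝ × ℝ in 𝓝[>] 0 ×ˢ atTop, l2Dist (Fd q.1 q.2) Ft ≤ ENNReal.ofReal
        ((D / k) ^ (1 / 2 : ℝ) * (q.1 ^ (1 / 2 : ℝ) + absTau κ α β q.2 ^ (-(1 / 2) : ℝ))) := by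
      filter_upwards [prod_mem_prod self_mem_nhdsWithin (Ioi_mem_atTop 0)] with q hq
      have h1 : 0 < q.1 := hq.1
      have h2 : 0 < q.2 := hq.2
      have hτ : 0 < absTau κ α β q.2 := absTau_pos hκ hβ h2
      obtain ⟨u, g, p, h⟩ := hpen _ _ h1 h2
      rw [Real.rpow_neg hτ.le, ← Real.inv_rpow hτ.le]
      refine l2Dist_le_add hk (cd _ _ h1 h2) ct' (by positivity) h1.le (by positivity) ?_
      refine (h.farField_sub_constant hk hu (hz h2) (hL h2) hL0 h1 ht htflux).trans ?_
      rw [norm_innerCoeff hρ hκ, ← hkdef, div_eq_mul_inv]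
      have e2 : 129 * l2Sq pt * q.1 + ‖ct‖ ^ 2 * sphMass * (k ^ 2 * (absTau κ α β q.2)⁻¹)
          ≤ (129 * l2Sq pt + ‖ct‖ ^ 2 * sphMass * k ^ 2) * (q.1 + (absTau κ α β q.2)⁻¹) := by
        have i1 : 0 ≤ 129 * l2Sq pt * (absTau κ α β q.2)⁻¹ := by positivity
        have i2 : 0 ≤ ‖ct‖ ^ 2 * sphMass * k ^ 2 * q.1 := by positivity
        nlinarith
      calc _ ≤ 4 * (L + k + 1) * ((129 * l2Sq pt + ‖ct‖ ^ 2 * sphMass * k ^ 2)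
            * (q.1 + (absTau κ α β q.2)⁻¹)) := by gcongr
        _ = _ := by ring
    refine ⟨tendsto_zero_of_eventually_le ?_ hbound, _, hbound⟩
    have hlim : Tendsto (fun q : ℝ × ℝ => q.1 ^ (1 / 2 : ℝ) + absTau κ α β q.2 ^ (-(1 / 2) : ℝ))
        (𝓝[>] 0 ×ˢ atTop) (𝓝 (0 + 0)) := (tendsto_rpow_half_zero.comp tendsto_fst).add
      ((tendsto_rpow_neg_atTop (by norm_num : (0 : ℝ) < 1 / 2)).comp
        ((tendsto_absTau_atTop hκ hβ).comp tendsto_snd))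
    rwa [add_zero] at hlim
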